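/- Let $K$ be a field and let $q\in K$ be nonzero and not a root of unity (for instance $K=\mathbb{C}(q)$ with $q$ an indeterminate). For an element $z$ of a commutative $K$-algebra and an integer $m\ge 0$ put $(z)_m=\prod_{j=0}^{m-1}(1-zq^j)$, and for nonnegative integers $m,c$ put $\binom{m}{c}_q=(q^{m-c+1})_c/(q)_c$. Let $p\ge 1$, let $n_0\geq 1$ and $n_1,\dots,n_p\ge 0$ be integers, and put $n=n_0+\cdots+n_p$. For $0\le l\le p$ let $N_l=\{n_0+\cdots+n_{l-1}+1,\dots,n_0+\cdots+n_l\}$. Set $\varepsilon_{ij}=1$ if $\{i,j\}\subseteq N_l$ for some $l\in\{1,\dots,p\}$ and $\varepsilon_{ij}=0$ otherwise. For nonnegative integers $a,b,c$ let $$L_{n_0,\dots,n_p}(a,b,c;x)=\prod_{i=1}^{n}(x_0/x_i)_a(qx_i/x_0)_b\prod_{1\le i<j\le n}(x_i/x_j)_{c+\varepsilon_{ij}}(qx_j/x_i)_{c+\varepsilon_{ij}},$$ a Laurent polynomial in $x_0,x_1,\dots,x_n$ over $K$, and let $D_n\big((n_0,\dots,n_p);a,b,c\big)$ be its constant term with respect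 to $x_1,\dots,x_n$. If $k\in\{1,\dots,p\}$ is any index with $n_k=\max\{n_1,\dots,n_p\}$ and $n_k\ge 1$, then for all nonnegative integers $a,b,c$ $$D_n\big((n_0,\dots,n_p);a,b,c\big)=\frac{(1-q^{n_k(c+1)})\,(q^{a+(n-1)c+n_k})_b}{(1-q^{c+1})\,(q^{(n-1)c+n_k})_b}\binom{nc+n_k-1}{c}_q\,D_{n-1}\big((n_0,\dots,n_{k-1},n_k-1,n_{k+1},\dots,n_p);a,b,c\big).$$ -/

import Mathlib

namespace BakerForrester

/-- Laurent polynomials over `K` in the variables `x_0, x_1, x_2, …`: the monoid algebra of the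
exponent vectors `ℕ →₀ ℤ`. -/
abbrev Laurent (K : Type*) [Field K] : Type _ := AddMonoidAlgebra K (ℕ →₀ ℤ)

/-- The Laurent monomial `x_i / x_j`. -/
noncomputable def ratio (K : Type*) [Field K] (i j : ℕ) : Laurent K :=
  AddMonoidAlgebra.single (Finsupp.single i 1 - Finsupp.single j 1) 1

/-- The `q`-shifted factorial `(z)_m = (z; q)_m = ∏_{j=0}^{m-1} (1 - z q^j)`, for `z` in any
commutative algebra over the field that contains `q`. -/
def qPoch {K R : Type*} [Field K] [CommRing R] [Algebra K R] (q : K) (z : R) (m : ℕ) : R :=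
  ∏ j ∈ Finset.range m, (1 - q ^ j • z)

/-- The `q`-binomial coefficient `[m choose c]_q = (q^{m-c+1})_c / (q)_c`. (If `m < c` the truncated
exponent `m + 1 - c` is `0` and the value is `0`, as it is with the integer exponent.) -/
def qBinom {K : Type*} [Field K] (q : K) (m c : ℕ) : K :=
  qPoch q (q ^ (m + 1 - c)) c / qPoch q q c

/-- The constant term of `f` with respect to the variables `x_i`, `i ∈ S`: the sum of the terms of
`f` in which every `x_i` with `i ∈ S` has exponent `0`. -/
def constTerm {K : Type*} [Field K] (S : Finset ℕ) (f : Laurent K) : Laurent K :=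
  AddMonoidAlgebra.ofCoeff (f.coeff.filter fun e => ∀ i ∈ S, e i = 0)

/-- The `l`-th block of consecutive indices,
`N_l = {n_0 + ⋯ + n_{l-1} + 1, …, n_0 + ⋯ + n_l}`. -/
def block {p : ℕ} (n : Fin (p + 1) → ℕ) (l : Fin (p + 1)) : Finset ℕ :=
  Finset.Ioc (∑ m ∈ Finset.Iio l, n m) (∑ m ∈ Finset.Iic l, n m)

/-- `ε_{ij}` is `1` if `i` and `j` lie in the same block `N_l` with `l ≠ 0`, and `0` otherwise. -/
def eps {p : ℕ} (n : Fin (p + 1) → ℕ) (i j : ℕ) : ℕ :=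
  if ∃ l : Fin (p + 1), l ≠ 0 ∧ i ∈ block n l ∧ j ∈ block n l then 1 else 0

/-- The `(p+1)`-component `q`-Morris product, with `N = n_0 + ⋯ + n_p`:
`L = ∏_{i=1}^{N} (x_0/x_i)_a (q x_i/x_0)_b
  ∏_{1 ≤ i < j ≤ N} (x_i/x_j)_{c+ε_{ij}} (q x_j/x_i)_{c+ε_{ij}}`. -/
noncomputable def L {K : Type*} [Field K] (q : K) {p : ℕ} (n : Fin (p + 1) → ℕ) (a b c : ℕ) :
    Laurent K :=
  (∏ i ∈ Finset.Icc 1 (∑ l, n l),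
      qPoch q (ratio K 0 i) a * qPoch q (q • ratio K i 0) b) *
    ∏ i ∈ Finset.Icc 1 (∑ l, n l), ∏ j ∈ Finset.Ioc i (∑ l, n l),
      qPoch q (ratio K i j) (c + eps n i j) * qPoch q (q • ratio K j i) (c + eps n i j)

/-- `D_N((n_0, …, n_p); a, b, c)`: the constant term of `L` with respect to `x_1, …, x_N`, where
`N = n_0 + ⋯ + n_p`. -/
noncomputable def D {K : Type*} [Field K] (q : K) {p : ℕ} (n : Fin (p + 1) → ℕ) (a b c : ℕ) :
    Laurent K :=
  constTerm (Finset.Icc 1 (∑ l, n l)) (L q n a b c)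

end BakerForrester

/-! Give each block N_l with l ≥ 1 one colour and each element of N_0 a colour of its own, so that
ε_{ij} = 1 exactly when i and j have equal colours. Renaming the variables cyclically and scaling
the old x_0 by q turns D into `ctLast`: the constant term of ∏_i (x_i/x_n)_b (q x_n/x_i)_a times the
coloured kernel, where x_n is the old x_0.

For fixed b and c this is a polynomial in q^a of degree at most nb (`natDegree_lastPoly_le`), and
its value at 1 is the constant term of the kernel alone (`ctLast_zero`). It remains to find zeros.
At q^a = q^{-h} the coefficient functional in x_i kills every multiple of X^s ∏_{1-h ≤ α ≤ -b} (X -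
q^α) as soon as s + h exceeds the exponent of x_i in the denominator of the kernel
(`momentFun_coeffFun`). Deforming X^s to ∏_{e ∈ E_i} (X - q^e τ) produces a grid of simple points,
and by the Combinatorial Nullstellensatz the functional vanishes on the numerator of the kernel
whenever that numerator vanishes on the grid (`prodFun_kernelNum_eq_zero`). The numerator vanishes
unless the exponents are well separated, both among the τ-free points and among the multiples of τ.
For h = rc + y a pigeonhole over slots (level, colour) excludes r + 1 separated points of the first
kind and n - r of the second (`not_chain_low`, `not_chain_high`).

Let ν_l be the sizes of the colour classes and y_r the least y with ∑_l min(ν_l, y) > r. The zeros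
are h = rc + y_r + j with r < n and j < b, whence ctLast = CT(kernel) ∏_{r<n} (q^{a+rc+y_r})_b /
(q^{rc+y_r})_b. The zeros are distinct when b ≤ c. The identity extends to every c because all
constant terms involved are rational functions of q^c times the uncoloured constant term
(`isRationalMultiple_ctMon`, `ctLast_const_mul_prod_eq`).

Deleting an element from a largest class keeps y_0, …, y_{n-2} and removes y_{n-1} = n_k, which
accounts for the factor containing a and b. The rest is the quotient of two kernel constant terms
(`ctKernel_recursion`). The kernel is cyclically quasi-symmetric, so the large block may be moved to
the end. Antisymmetry inside that block strips the factors 1 - q^{c+1} x_n/x_i from its last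
variable x_n, at the cost of (1 - q^{n_k(c+1)})/(1 - q^{c+1}) (`ctKernel_eq_ctLast`). What is left
is again a `ctLast`, and counting zeros once more gives the q-binomial coefficient
(`ctLast_last_mul_eq`). -/

namespace BakerForrester

open Finset

/-! ### Laurent polynomials, substitutions and the cyclic symmetry of the kernel. -/

section Basics

variable {K : Type*} [Field K]

/-- The coefficient of the trivial monomial. -/
noncomputable def ct : Laurent K →ₗ[K] K where
  toFun f := f.coeff 0
  map_add' _ _ := rfl
  map_smul' _ _ := rfl

/-- The monomial with exponent vector `r`. -/
noncomputable def mon (K : Type*) [Field K] (r : ℕ →₀ ℤ) : Laurent K :=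
  AddMonoidAlgebra.single r 1

lemma mon_mul (r s : ℕ →₀ ℤ) : mon K r * mon K s = mon K (r + s) := by
  simp [mon, AddMonoidAlgebra.single_mul_single]

@[simp] lemma mon_zero : mon K 0 = 1 := rfl

lemma mon_neg_mul (r : ℕ →₀ ℤ) : mon K (-r) * mon K r = 1 := by simp [mon_mul]

lemma mon_prod {ι : Type*} (s : Finset ι) (f : ι → ℕ →₀ ℤ) :
    ∏ i ∈ s, mon K (f i) = mon K (∑ i ∈ s, f i) := by
  classical
  induction s using Finset.induction_on with
  | empty => simp
  | insert a s ha ih => rw [prod_insert ha, sum_insert ha, ih, mon_mul]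

lemma mon_pow (r : ℕ →₀ ℤ) (m : ℕ) : mon K r ^ m = mon K (m • r) := by
  simp [mon, AddMonoidAlgebra.single_pow]

lemma ratio_eq_mon (i j : ℕ) : ratio K i j = mon K (Finsupp.single i 1 - Finsupp.single j 1) := rfl

lemma ratio_mul (i j k : ℕ) : ratio K i j * ratio K j k = ratio K i k := by
  simp [ratio_eq_mon, mon_mul]

lemma ratio_self (i : ℕ) : ratio K i i = 1 := by simp [ratio_eq_mon]

lemma ct_mon (r : ℕ →₀ ℤ) : ct (mon K r) = if r = 0 then 1 else 0 := by
  classical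
  change (AddMonoidAlgebra.single r (1 : K)).coeff 0 = _
  rw [AddMonoidAlgebra.coeff_single, Finsupp.single_apply]

lemma single_eq_smul_mon (r : ℕ →₀ ℤ) (u : K) : AddMonoidAlgebra.single r u = u • mon K r := by
  simp [mon]

lemma Laurent.induction_mon {motive : Laurent K → Prop} (f : Laurent K) (zero : motive 0)
    (add : ∀ f g, motive f → motive g → motive (f + g))
    (smul_mon : ∀ r (u : K), motive (u • mon K r)) : motive f :=
  AddMonoidAlgebra.induction_linear f zero add fun r u => single_eq_smul_mon r u ▸ smul_mon r u

/-- The substitution `x^r ↦ χ r x^(φ r)`. -/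
noncomputable def subst (φ : (ℕ →₀ ℤ) →+ (ℕ →₀ ℤ)) (χ : Multiplicative (ℕ →₀ ℤ) →* K) :
    Laurent K →ₐ[K] Laurent K :=
  AddMonoidAlgebra.lift K (Laurent K) (ℕ →₀ ℤ)
    { toFun := fun r => χ r • mon K (φ r.toAdd)
      map_one' := by simp
      map_mul' := fun r s => by
        simp only [map_mul, toAdd_mul, map_add, ← mon_mul, smul_mul_smul_comm] }

lemma subst_mon (φ : (ℕ →₀ ℤ) →+ (ℕ →₀ ℤ)) (χ : Multiplicative (ℕ →₀ ℤ) →* K) (r : ℕ →₀ ℤ) :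
    subst φ χ (mon K r) = χ (Multiplicative.ofAdd r) • mon K (φ r) := by
  simp [subst, mon, AddMonoidAlgebra.lift_single]

lemma ct_subst {φ : (ℕ →₀ ℤ) →+ (ℕ →₀ ℤ)} (hφ : Function.Injective φ)
    (χ : Multiplicative (ℕ →₀ ℤ) →* K) (f : Laurent K) : ct (subst φ χ f) = ct f := by
  induction f using Laurent.induction_mon with
  | zero => simp
  | add f g hf hg => simp [hf, hg]
  | smul_mon r u =>
    rw [map_smul, map_smul, map_smul, subst_mon, map_smul, ct_mon, ct_mon]
    by_cases h : r = 0
    · subst h; simp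
    · have : φ r ≠ 0 := fun h' => h (hφ (by simpa using h'))
      simp [h, this]

/-- The permutation of variables `x_i ↦ x_{σ i}`. -/
noncomputable def permVar (σ : Equiv.Perm ℕ) : Laurent K →ₐ[K] Laurent K :=
  subst (Finsupp.mapDomain.addMonoidHom σ) 1

lemma permVar_mon (σ : Equiv.Perm ℕ) (r : ℕ →₀ ℤ) :
    permVar σ (mon K r) = mon K (r.mapDomain σ) := by
  simp [permVar, subst_mon]

@[simp] lemma permVar_ratio (σ : Equiv.Perm ℕ) (i j : ℕ) :
    permVar σ (ratio K i j) = ratio K (σ i) (σ j) := by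
  simp only [ratio_eq_mon, permVar_mon]
  congr 1
  rw [sub_eq_add_neg, sub_eq_add_neg, ← Finsupp.single_neg, ← Finsupp.single_neg,
    Finsupp.mapDomain_add, Finsupp.mapDomain_single, Finsupp.mapDomain_single]

lemma ct_permVar (σ : Equiv.Perm ℕ) (f : Laurent K) : ct (permVar σ f) = ct f :=
  ct_subst (Finsupp.mapDomain_injective σ.injective) _ f

/-- The scaling of one variable, `x_i ↦ u x_i`. -/
noncomputable def scaleVar (i : ℕ) (u : Kˣ) : Laurent K →ₐ[K] Laurent K :=
  subst (AddMonoidHom.id _)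
    { toFun := fun r => ((u ^ (r.toAdd i) : Kˣ) : K)
      map_one' := by simp
      map_mul' := fun r s => by simp [zpow_add] }

lemma scaleVar_mon (i : ℕ) (u : Kˣ) (r : ℕ →₀ ℤ) :
    scaleVar i u (mon K r) = ((u ^ (r i) : Kˣ) : K) • mon K r := by
  simp only [scaleVar, subst_mon]; rfl

lemma ct_scaleVar (i : ℕ) (u : Kˣ) (f : Laurent K) : ct (scaleVar i u f) = ct f :=
  ct_subst Function.injective_id _ f

lemma scaleVar_ratio_left {i j : ℕ} (h : i ≠ j) (u : Kˣ) :
    scaleVar i u (ratio K i j) = (u : K) • ratio K i j := by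
  simp [ratio_eq_mon, scaleVar_mon, h]

lemma scaleVar_ratio_right {i j : ℕ} (h : i ≠ j) (u : Kˣ) :
    scaleVar i u (ratio K j i) = ((u⁻¹ : Kˣ) : K) • ratio K j i := by
  simp [ratio_eq_mon, scaleVar_mon, h]

lemma scaleVar_ratio_of_ne {i j k : ℕ} (hj : i ≠ j) (hk : i ≠ k) (u : Kˣ) :
    scaleVar i u (ratio K j k) = ratio K j k := by
  simp [ratio_eq_mon, scaleVar_mon, hj, hk]

lemma map_qPoch {R S : Type*} [CommRing R] [Algebra K R] [CommRing S] [Algebra K S]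
    (f : R →ₐ[K] S) (q : K) (z : R) (m : ℕ) : f (qPoch q z m) = qPoch q (f z) m := by
  simp [qPoch, map_prod]

lemma qPoch_zero {R : Type*} [CommRing R] [Algebra K R] (q : K) (z : R) : qPoch q z 0 = 1 := rfl

lemma qPoch_succ {R : Type*} [CommRing R] [Algebra K R] (q : K) (z : R) (m : ℕ) :
    qPoch q z (m + 1) = qPoch q z m * (1 - q ^ m • z) := prod_range_succ _ _

lemma qPoch_succ' {R : Type*} [CommRing R] [Algebra K R] (q : K) (z : R) (m : ℕ) :
    qPoch q z (m + 1) = (1 - z) * qPoch q (q • z) m := by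
  simp only [qPoch]
  rw [prod_range_succ', mul_comm, pow_zero, one_smul]
  simp [pow_succ, mul_smul]

lemma qPoch_add {R : Type*} [CommRing R] [Algebra K R] (q : K) (z : R) (m k : ℕ) :
    qPoch q z (m + k) = qPoch q z m * qPoch q (q ^ m • z) k := by
  simp only [qPoch, prod_range_add, smul_smul]
  congr 1
  exact prod_congr rfl fun i _ => by rw [pow_add, mul_comm]

/-- The product `(x_i/x_j)_m (q x_j/x_i)_m`. -/
noncomputable def pair (q : K) (m i j : ℕ) : Laurent K :=
  qPoch q (ratio K i j) m * qPoch q (q • ratio K j i) m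

lemma permVar_pair (σ : Equiv.Perm ℕ) (q : K) (m i j : ℕ) :
    permVar σ (pair q m i j) = pair q m (σ i) (σ j) := by
  simp [pair, map_qPoch]

lemma scaleVar_pair_of_ne {i j k : ℕ} (hj : i ≠ j) (hk : i ≠ k) (u : Kˣ) (q : K) (m : ℕ) :
    scaleVar i u (pair q m j k) = pair q m j k := by
  simp [pair, map_qPoch, scaleVar_ratio_of_ne, hj, hk]

/-- The scaling moves the factor q from one of the two shifted factorials to the other, which
reverses the roles of i and j. This is what makes the kernel cyclically quasi-symmetric. -/
lemma scaleVar_pair_right {i j : ℕ} (h : i ≠ j) {q : Kˣ} (m : ℕ) :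
    scaleVar i q⁻¹ (pair (q : K) m j i) = pair (q : K) m i j := by
  have h1 := scaleVar_ratio_left (K := K) h q⁻¹
  have h2 := scaleVar_ratio_right (K := K) h q⁻¹
  simp [pair, map_qPoch, h1, h2, smul_smul, mul_comm]

/-- The exponent `1` attached to two indices of the same colour. -/
def colEps (κ : ℕ → ℕ) (i j : ℕ) : ℕ := if κ i = κ j then 1 else 0

/-- The product of `pair`s over `i < j < n`, with exponents `c + ε`. -/
noncomputable def kernel (q : K) (c : ℕ) (ε : ℕ → ℕ → ℕ) (n : ℕ) : Laurent K :=
  ∏ j ∈ range n, ∏ i ∈ range j, pair q (c + ε i j) i j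

lemma kernel_succ (q : K) (c : ℕ) (ε : ℕ → ℕ → ℕ) (n : ℕ) :
    kernel q c ε (n + 1) = kernel q c ε n * ∏ i ∈ range n, pair q (c + ε i n) i n :=
  prod_range_succ _ _

lemma kernel_congr {q : K} {c : ℕ} {ε ε' : ℕ → ℕ → ℕ} {n : ℕ}
    (h : ∀ j < n, ∀ i < j, ε i j = ε' i j) : kernel q c ε n = kernel q c ε' n :=
  prod_congr rfl fun j hj => prod_congr rfl fun i hi => by
    rw [h j (mem_range.1 hj) i (mem_range.1 hi)]

/-- Peeling the first variable off the kernel. -/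
lemma kernel_succ' (q : K) (c : ℕ) (ε : ℕ → ℕ → ℕ) (n : ℕ) :
    kernel q c ε (n + 1) = (∏ j ∈ range n, ∏ i ∈ range j, pair q (c + ε (i + 1) (j + 1)) (i + 1) (j + 1)) *
      ∏ j ∈ range n, pair q (c + ε 0 (j + 1)) 0 (j + 1) := by
  rw [kernel, prod_range_succ', range_zero, prod_empty, mul_one, ← prod_mul_distrib]
  exact prod_congr rfl fun j _ => prod_range_succ' _ _

/-- The cycle `0 ↦ n, i + 1 ↦ i` on `{0, …, n}`. -/
def rotPerm (n : ℕ) : Equiv.Perm ℕ where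
  toFun i := if i = 0 then n else if i ≤ n then i - 1 else i
  invFun i := if i = n then 0 else if i < n then i + 1 else i
  left_inv i := by grind
  right_inv i := by grind

lemma rotPerm_zero (n : ℕ) : rotPerm n 0 = n := rfl

lemma rotPerm_succ {n i : ℕ} (h : i < n) : rotPerm n (i + 1) = i := by
  simp [rotPerm, h]

/-- Cyclic quasi-symmetry of the kernel: rotating the variables amounts to scaling one of them. -/
lemma kernel_rotate (q : Kˣ) (c : ℕ) (ε ε' : ℕ → ℕ → ℕ) (n : ℕ)
    (h1 : ∀ i j, i < j → j < n → ε' i j = ε (i + 1) (j + 1))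
    (h2 : ∀ i, i < n → ε' i n = ε 0 (i + 1)) :
    kernel (q : K) c ε (n + 1) =
      scaleVar 0 q⁻¹ (permVar (rotPerm n).symm (kernel (q : K) c ε' (n + 1))) := by
  have e0 : (rotPerm n).symm n = 0 := by rw [Equiv.symm_apply_eq]; rfl
  have e1 : ∀ i < n, (rotPerm n).symm i = i + 1 := fun i hi => by
    rw [Equiv.symm_apply_eq, rotPerm_succ hi]
  rw [kernel_succ', kernel_succ, kernel]
  simp only [map_mul, map_prod, permVar_pair]
  congr 1
  · refine prod_congr rfl fun j hj => prod_congr rfl fun i hi => ?_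
    have hj' := mem_range.1 hj
    have hi' := mem_range.1 hi
    rw [e1 j hj', e1 i (hi'.trans hj'), scaleVar_pair_of_ne (by omega) (by omega), h1 i j hi' hj']
  · refine prod_congr rfl fun i hi => ?_
    have hi' := mem_range.1 hi
    rw [e0, e1 i hi', scaleVar_pair_right (by omega), h2 i hi']

/-- The constant term of the coloured kernel. -/
noncomputable def ctKernel (q : K) (c : ℕ) (κ : ℕ → ℕ) (n : ℕ) : K := ct (kernel q c (colEps κ) n)

lemma ctKernel_congr {q : K} {c : ℕ} {κ κ' : ℕ → ℕ} {n : ℕ}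
    (h : ∀ i < n, ∀ j < n, (κ i = κ j ↔ κ' i = κ' j)) : ctKernel q c κ n = ctKernel q c κ' n := by
  rw [ctKernel, ctKernel, kernel_congr]
  intro j hj i hi
  simp [colEps, h i (hi.trans hj) j hj]

/-- Neither renaming nor scaling variables affects a constant term, so only the cyclic order of the
colours matters. -/
lemma ctKernel_rotate_one {q : K} (hq : q ≠ 0) (c : ℕ) (κ : ℕ → ℕ) (n : ℕ) :
    ctKernel q c κ n = ctKernel q c (fun i => κ ((i + 1) % n)) n := by
  obtain _ | n := n
  · rfl
  lift q to Kˣ using hq.isUnit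
  rw [ctKernel, kernel_rotate q c _ (colEps fun i => κ ((i + 1) % (n + 1))) n, ct_scaleVar,
    ct_permVar, ctKernel]
  · intro i j hij hj
    simp [colEps, Nat.mod_eq_of_lt (show i + 1 < n + 1 by omega),
      Nat.mod_eq_of_lt (show j + 1 < n + 1 by omega)]
  · intro i hi
    simp [colEps, Nat.mod_eq_of_lt (show i + 1 < n + 1 by omega), eq_comm]

lemma ctKernel_rotate {q : K} (hq : q ≠ 0) (c : ℕ) (κ : ℕ → ℕ) (n k : ℕ) :
    ctKernel q c κ n = ctKernel q c (fun i => κ ((i + k) % n)) n := by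
  induction k with
  | zero =>
    refine ctKernel_congr fun i hi j hj => ?_
    simp [Nat.mod_eq_of_lt hi, Nat.mod_eq_of_lt hj]
  | succ k ih =>
    rw [ih, ctKernel_rotate_one hq]
    refine ctKernel_congr fun i hi j hj => ?_
    simp only [Nat.mod_add_mod, add_assoc, add_comm 1 k]

end Basics

end BakerForrester

namespace BakerForrester

open Finset

/-! ### Functionals that alternate under adjacent transpositions. -/

section Alternating

variable {K : Type*} [Field K]

/-- The variable `x_i`. -/
noncomputable def var (K : Type*) [Field K] (i : ℕ) : Laurent K := mon K (Finsupp.single i 1)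

lemma permVar_var (σ : Equiv.Perm ℕ) (i : ℕ) : permVar σ (var K i) = var K (σ i) := by
  simp [var, permVar_mon, Finsupp.mapDomain_single]

lemma ratio_mul_var (i j : ℕ) : ratio K i j * var K j = var K i := by
  simp [ratio_eq_mon, var, mon_mul]

/-- The monomial `∏_{j < N} x_{b + j}^{e j}`. -/
noncomputable def varProd (K : Type*) [Field K] (b N : ℕ) (e : ℕ → ℕ) : Laurent K :=
  ∏ j ∈ range N, var K (b + j) ^ e j

lemma varProd_congr {b N : ℕ} {e e' : ℕ → ℕ} (h : ∀ j < N, e j = e' j) :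
    varProd K b N e = varProd K b N e' :=
  prod_congr rfl fun j hj => by rw [h j (mem_range.1 hj)]

lemma varProd_mul_var {b N i : ℕ} (hi : i < N) (e e' : ℕ → ℕ) (h1 : e' i = e i + 1)
    (h2 : ∀ j < N, j ≠ i → e' j = e j) :
    varProd K b N e * var K (b + i) = varProd K b N e' := by
  rw [varProd, varProd, ← mul_prod_erase _ _ (mem_range.2 hi),
    ← mul_prod_erase _ (fun j => var K (b + j) ^ e' j) (mem_range.2 hi), h1, pow_succ]
  rw [prod_congr rfl fun j hj => by
    rw [← h2 j (mem_range.1 (mem_of_mem_erase hj)) (ne_of_mem_erase hj)]]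
  ring

lemma permVar_swap_varProd {b N l : ℕ} (hl : l + 1 < N) (e e' : ℕ → ℕ)
    (h0 : e' l = e (l + 1)) (h1 : e' (l + 1) = e l)
    (h2 : ∀ j < N, j ≠ l → j ≠ l + 1 → e' j = e j) :
    permVar (Equiv.swap (b + l) (b + l + 1)) (varProd K b N e) = varProd K b N e' := by
  simp only [varProd, map_prod, map_pow, permVar_var]
  refine prod_equiv (Equiv.swap l (l + 1)) (fun j => ?_) fun j hj => ?_
  · simp only [mem_range]
    rcases eq_or_ne j l with rfl | h
    · rw [Equiv.swap_apply_left]; omega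
    rcases eq_or_ne j (l + 1) with rfl | h'
    · rw [Equiv.swap_apply_right]; omega
    rw [Equiv.swap_apply_of_ne_of_ne h h']
  · rcases eq_or_ne j l with rfl | h
    · rw [Equiv.swap_apply_left, Equiv.swap_apply_left, h1, add_assoc]
    rcases eq_or_ne j (l + 1) with rfl | h'
    · rw [Equiv.swap_apply_right, ← add_assoc, Equiv.swap_apply_right, h0]
    rw [Equiv.swap_apply_of_ne_of_ne h h',
      Equiv.swap_apply_of_ne_of_ne (by omega) (by omega), h2 j (mem_range.1 hj) h h']

/-- `ψ` kills everything symmetric under an adjacent transposition of `x_b, …, x_{b+m-1}`. -/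
def IsAlternating (ψ : Laurent K →ₗ[K] K) (b m : ℕ) : Prop :=
  ∀ i, b ≤ i → i + 1 < b + m → ∀ g, permVar (Equiv.swap i (i + 1)) g = g → ψ g = 0

/-- `g` is symmetric under the adjacent transpositions of `x_b, …, x_{b+m-1}`. -/
def IsSymmetricOn (g : Laurent K) (b m : ℕ) : Prop :=
  ∀ i, b ≤ i → i + 1 < b + m → permVar (Equiv.swap i (i + 1)) g = g

lemma permVar_swap_swap (i j : ℕ) (f : Laurent K) :
    permVar (Equiv.swap i j) (permVar (Equiv.swap i j) f) = f := by
  induction f using Laurent.induction_mon with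
  | zero => simp
  | add f g hf hg => simp [hf, hg]
  | smul_mon r u =>
    simp only [map_smul, permVar_mon, ← Finsupp.mapDomain_comp]
    have : (⇑(Equiv.swap i j) ∘ ⇑(Equiv.swap i j)) = id := by ext; simp
    rw [this, Finsupp.mapDomain_id]

lemma IsAlternating.swap {ψ : Laurent K →ₗ[K] K} {b m : ℕ} (h : IsAlternating ψ b m) {i : ℕ}
    (h1 : b ≤ i) (h2 : i + 1 < b + m) (f : Laurent K) :
    ψ (permVar (Equiv.swap i (i + 1)) f) = -ψ f := by
  have := h i h1 h2 (f + permVar (Equiv.swap i (i + 1)) f)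
    (by rw [map_add, permVar_swap_swap, add_comm])
  rw [map_add] at this
  linear_combination this

/-- The product `∏_{j < l} (x_b - s x_{b+1+j})`. -/
noncomputable def firstProd (s : K) (b l : ℕ) : Laurent K :=
  ∏ j ∈ range l, (var K b - s • var K (b + 1 + j))

lemma firstProd_succ (s : K) (b l : ℕ) :
    firstProd s b (l + 1) = firstProd s b l * (var K b - s • var K (b + 1 + l)) :=
  prod_range_succ _ _

lemma permVar_swap_firstProd_of_lt (s : K) {b l i : ℕ} (h : b + l < i) :
    permVar (Equiv.swap i (i + 1)) (firstProd s b l) = firstProd s b l := by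
  simp only [firstProd, map_prod, map_sub, map_smul, permVar_var]
  refine prod_congr rfl fun j hj => ?_
  have := mem_range.1 hj
  rw [Equiv.swap_apply_of_ne_of_ne (by omega) (by omega),
    Equiv.swap_apply_of_ne_of_ne (by omega) (by omega)]

lemma permVar_swap_firstProd (s : K) {b m i : ℕ} (h1 : b + 1 ≤ i) (h2 : i + 1 < b + 1 + m) :
    permVar (Equiv.swap i (i + 1)) (firstProd s b m) = firstProd s b m := by
  simp only [firstProd, map_prod, map_sub, map_smul, permVar_var]
  obtain ⟨l, rfl⟩ := Nat.exists_eq_add_of_le h1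
  refine prod_equiv (Equiv.swap l (l + 1)) (fun j => ?_) fun j hj => ?_
  · simp only [mem_range]
    rcases eq_or_ne j l with rfl | h
    · rw [Equiv.swap_apply_left]; omega
    rcases eq_or_ne j (l + 1) with rfl | h'
    · rw [Equiv.swap_apply_right]; omega
    rw [Equiv.swap_apply_of_ne_of_ne h h']
  · rw [Equiv.swap_apply_of_ne_of_ne (show b ≠ b + 1 + l by omega) (by omega)]
    congr 3
    rcases eq_or_ne j l with rfl | h
    · rw [Equiv.swap_apply_left, Equiv.swap_apply_left, add_assoc]
    rcases eq_or_ne j (l + 1) with rfl | h'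
    · rw [Equiv.swap_apply_right, ← add_assoc, Equiv.swap_apply_right]
    rw [Equiv.swap_apply_of_ne_of_ne h h', Equiv.swap_apply_of_ne_of_ne (by omega) (by omega)]

/-- Each adjacent transposition changes the sign. Carrying the exponent of the first variable past l
neighbours turns (m-1-r, m, m-1, …) step by step into the decreasing staircase, which is reached at
l = r + 1. -/
lemma IsAlternating.move_exponent {ψ : Laurent K →ₗ[K] K} {b m : ℕ}
    (hψ : IsAlternating ψ b (m + 1)) {g : Laurent K} (hg : IsSymmetricOn g b (m + 1)) {r : ℕ}
    (hr : r < m) (l : ℕ) (hl : l ≤ r + 1) :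
    ψ (g * varProd K b (m + 1) fun j => if j = 0 then m - 1 - r else if j ≤ r + 1 then m - j + 1
        else m - j) =
      (-1) ^ l * ψ (g * varProd K b (m + 1) fun j => if j < l then m - j else if j = l then m - 1 - r
        else if j ≤ r + 1 then m - j + 1 else m - j) := by
  induction l with
  | zero =>
    simp
  | succ l ih =>
    rw [ih (by omega), pow_succ, mul_assoc, neg_one_mul]
    congr 1
    rw [← hψ.swap (i := b + l) (by omega) (by omega),
      map_mul (permVar _), hg _ (by omega) (by omega), permVar_swap_varProd (by omega)]
    · grind
    · grind
    · grind

/-- Expand the last factor x_b - s x_{b+l+1}. The term x_b leaves two neighbouring exponents equal,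
so it is killed; only -s x_{b+l+1} survives, and it raises the exponent of its variable by one. -/
lemma IsAlternating.firstProd_step {ψ : Laurent K →ₗ[K] K} {b m : ℕ}
    (hψ : IsAlternating ψ b (m + 1)) {g : Laurent K} (hg : IsSymmetricOn g b (m + 1)) (s : K)
    {r : ℕ} (hr : r < m) (l : ℕ) (hl : l ≤ r) :
    ψ (g * firstProd s b l * varProd K b (m + 1) fun j => if j = 0 then m - 1 - r else
        if l < j ∧ j ≤ r + 1 then m - j + 1 else m - j) =
      (-s) ^ l * ψ (g * varProd K b (m + 1) fun j => if j = 0 then m - 1 - r else if j ≤ r + 1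
        then m - j + 1 else m - j) := by
  induction l with
  | zero =>
    simp only [firstProd, range_zero, prod_empty, mul_one, pow_zero, one_mul]
    congr 2
    exact varProd_congr fun j _ => by grind
  | succ l ih =>
    rw [pow_succ', mul_assoc (-s), ← ih (by omega), firstProd_succ]
    set e : ℕ → ℕ := fun j => if j = 0 then m - 1 - r else
        if l + 1 < j ∧ j ≤ r + 1 then m - j + 1 else m - j with he
    have e1 : varProd K b (m + 1) e * var K (b + (l + 1)) = varProd K b (m + 1) fun j =>
        if j = 0 then m - 1 - r else if l < j ∧ j ≤ r + 1 then m - j + 1 else m - j :=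
      varProd_mul_var (by omega) _ _ (by grind) (by grind)
    have e2 := varProd_mul_var (K := K) (b := b) (N := m + 1) (i := 0) (by omega) e
      (fun j => if j = 0 then e 0 + 1 else e j) (by simp) (by grind)
    -- The variables at positions l + 1 and l + 2 both carry the exponent m - l - 1 here.
    have e3 : ψ (g * firstProd s b l *
        varProd K b (m + 1) (fun j => if j = 0 then e 0 + 1 else e j)) = 0 := by
      refine hψ (b + (l + 1)) (by omega) (by omega) _ ?_
      rw [map_mul, map_mul, hg _ (by omega) (by omega), permVar_swap_firstProd_of_lt _ (by omega),
        permVar_swap_varProd (l := l + 1) (by omega)]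
      · grind
      · grind
      · grind
    have e4 : g * (firstProd s b l * (var K b - s • var K (b + 1 + l))) * varProd K b (m + 1) e =
        g * firstProd s b l * (varProd K b (m + 1) e * var K (b + 0)) +
          (-s) • (g * firstProd s b l * (varProd K b (m + 1) e * var K (b + (l + 1)))) := by
      rw [show b + 1 + l = b + (l + 1) by ring, add_zero]
      simp only [Algebra.smul_def, map_neg]
      ring
    rw [e4, map_add, map_smul, smul_eq_mul, e1, e2, e3, zero_add]

/-- In passing from r to r + 1, the term x_b of the new factor reproduces the case r. The other term
contributes (-s)(-s)^r from `firstProd_step` and the sign (-1)^{r+1} from `move_exponent`, that is,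
s^{r+1}. -/
lemma IsAlternating.firstProd_mul {ψ : Laurent K →ₗ[K] K} {b m : ℕ}
    (hψ : IsAlternating ψ b (m + 1)) {g : Laurent K} (hg : IsSymmetricOn g b (m + 1)) (s : K)
    (r : ℕ) (hr : r ≤ m) :
    ψ (g * firstProd s b r * varProd K b (m + 1) fun j => if j = 0 then m - r else m - j) =
      (∑ i ∈ range (r + 1), s ^ i) * ψ (g * varProd K b (m + 1) fun j => m - j) := by
  induction r with
  | zero =>
    simp only [firstProd, range_zero, prod_empty, mul_one, zero_add, sum_range_one, pow_zero,
      one_mul]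
    congr 2
    exact varProd_congr fun j _ => by grind
  | succ r ih =>
    have h1 := hψ.firstProd_step hg s (show r < m by omega) r le_rfl
    rw [hψ.move_exponent hg (show r < m by omega) (r + 1) le_rfl] at h1
    rw [show varProd K b (m + 1) (fun j => if j < r + 1 then m - j else if j = r + 1 then m - 1 - r
        else if j ≤ r + 1 then m - j + 1 else m - j) = varProd K b (m + 1) fun j => m - j from
      varProd_congr fun j _ => by grind] at h1
    rw [sum_range_succ, add_mul, ← ih (by omega)]
    have e1 : varProd K b (m + 1) (fun j => if j = 0 then m - (r + 1) else m - j) * var K (b + (r + 1))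
      = varProd K b (m + 1) fun j => if j = 0 then m - 1 - r else
        if r < j ∧ j ≤ r + 1 then m - j + 1 else m - j :=
      varProd_mul_var (by omega) _ _ (by grind) (by grind)
    have e2 : varProd K b (m + 1) (fun j => if j = 0 then m - (r + 1) else m - j) * var K (b + 0)
      = varProd K b (m + 1) fun j => if j = 0 then m - r else m - j :=
      varProd_mul_var (by omega) _ _ (by grind) (by grind)
    rw [← e1] at h1
    rw [← e2, firstProd_succ]
    have e4 : g * (firstProd s b r * (var K b - s • var K (b + 1 + r))) *
        varProd K b (m + 1) (fun j => if j = 0 then m - (r + 1) else m - j) =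
        g * firstProd s b r * (varProd K b (m + 1) (fun j => if j = 0 then m - (r + 1) else m - j) *
          var K (b + 0)) + (-s) • (g * firstProd s b r *
          (varProd K b (m + 1) (fun j => if j = 0 then m - (r + 1) else m - j) *
            var K (b + (r + 1)))) := by
      rw [show b + 1 + r = b + (r + 1) by ring, add_zero]
      simp only [Algebra.smul_def, map_neg]
      ring
    have h3 : s ^ (r + 1) * ψ (g * varProd K b (m + 1) fun j => m - j) = -s * ((-s) ^ r *
        ((-1) ^ (r + 1) * ψ (g * varProd K b (m + 1) fun j => m - j))) := by
      rw [neg_pow s r, pow_succ s, pow_succ (-1 : K)]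
      have : (-1 : K) ^ r * (-1) ^ r = 1 := by rw [← mul_pow]; simp
      linear_combination (- s ^ r * s * ψ (g * varProd K b (m + 1) fun j => m - j)) * this
    rw [h3, ← h1, e4, map_add, map_smul, smul_eq_mul]

/-- An alternating functional sees `∏_{i<j} (x_i - s x_j)` as a multiple of the staircase monomial. -/
lemma IsAlternating.prod_sub {ψ : Laurent K →ₗ[K] K} {b m : ℕ}
    (hψ : IsAlternating ψ b m) {g : Laurent K} (hg : IsSymmetricOn g b m) (s : K) :
    ψ (g * ∏ j ∈ range m, ∏ i ∈ range j, (var K (b + i) - s • var K (b + j))) =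
      (∏ k ∈ range m, ∑ i ∈ range (k + 1), s ^ i) *
        ψ (g * varProd K b m fun j => m - 1 - j) := by
  induction m generalizing b g with
  | zero => simp [varProd]
  | succ m ih =>
    have e1 : ∏ j ∈ range (m + 1), ∏ i ∈ range j, (var K (b + i) - s • var K (b + j)) =
        firstProd s b m * ∏ j ∈ range m, ∏ i ∈ range j,
          (var K (b + 1 + i) - s • var K (b + 1 + j)) := by
      rw [prod_range_succ', range_zero, prod_empty, mul_one, firstProd, ← prod_mul_distrib]
      refine prod_congr rfl fun j _ => ?_
      rw [prod_range_succ', mul_comm]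
      congr 1
      · rw [add_zero, show b + (j + 1) = b + 1 + j by ring]
      · exact prod_congr rfl fun i _ => by
          rw [show b + (j + 1) = b + 1 + j by ring, show b + (i + 1) = b + 1 + i by ring]
    -- The variables after the first are treated by induction, with `firstProd` absorbed into the
    -- symmetric factor. This produces the staircase in those variables, against which
    -- `firstProd_mul` with r = m evaluates the remaining product.
    rw [e1, ← mul_assoc, ih (b := b + 1), prod_range_succ,
      mul_assoc (∏ k ∈ range m, _)]
    · congr 1
      rw [Nat.add_sub_cancel, ← hψ.firstProd_mul hg s m le_rfl]
      congr 2
      rw [varProd, varProd, prod_range_succ']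
      simp only [Nat.sub_self, ↓reduceIte, pow_zero, mul_one]
      exact prod_congr rfl fun j _ => by
        rw [show b + (j + 1) = b + 1 + j by ring, show m - (j + 1) = m - 1 - j by omega,
          if_neg (by omega)]
    · exact fun i h1 h2 => hψ i (by omega) (by omega)
    · intro i h1 h2
      rw [map_mul, hg i (by omega) (by omega), permVar_swap_firstProd s h1 h2]

end Alternating

end BakerForrester

namespace BakerForrester

open Finset

/-! ### Stripping factors from the last block. -/

section LastBlock

variable {K : Type*} [Field K]

/-- Isolating the factor `f l (l+1)` from a product over pairs, the rest being symmetric. -/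
lemma exists_symmetric_cofactor (f : ℕ → ℕ → Laurent K) {N l : ℕ} (hl : l + 1 < N)
    (hf : ∀ i j, i < j → j < N → ¬(i = l ∧ j = l + 1) →
      permVar (Equiv.swap l (l + 1)) (f i j) =
        f (Equiv.swap l (l + 1) i) (Equiv.swap l (l + 1) j)) :
    ∃ S, permVar (Equiv.swap l (l + 1)) S = S ∧
      ∏ j ∈ range N, ∏ i ∈ range j, f i j = f l (l + 1) * S := by
  set P : Finset (Σ _ : ℕ, ℕ) := (range N).sigma range with hP
  have hmem : (⟨l + 1, l⟩ : Σ _ : ℕ, ℕ) ∈ P := by simp [hP, hl]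
  refine ⟨∏ p ∈ P.erase ⟨l + 1, l⟩, f p.2 p.1, ?_, ?_⟩
  · rw [map_prod]
    have hsw : ∀ i, Equiv.swap l (l + 1) i = if i = l then l + 1 else if i = l + 1 then l else i :=
      fun i => by rw [Equiv.swap_apply_def]
    have hmap : ∀ p ∈ P.erase ⟨l + 1, l⟩,
        (⟨Equiv.swap l (l + 1) p.1, Equiv.swap l (l + 1) p.2⟩ : Σ _ : ℕ, ℕ) ∈
          P.erase ⟨l + 1, l⟩ := by
      rintro ⟨j, i⟩ h
      simp only [hP, mem_erase, ne_eq, Sigma.mk.injEq, heq_eq_eq, mem_sigma, mem_range, hsw] at h ⊢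
      split_ifs <;> omega
    refine prod_nbij' (fun p => ⟨Equiv.swap l (l + 1) p.1, Equiv.swap l (l + 1) p.2⟩)
      (fun p => ⟨Equiv.swap l (l + 1) p.1, Equiv.swap l (l + 1) p.2⟩) hmap hmap ?_ ?_ ?_
    · rintro ⟨j, i⟩ _; simp
    · rintro ⟨j, i⟩ _; simp
    · rintro ⟨j, i⟩ h
      simp only [hP, mem_erase, ne_eq, Sigma.mk.injEq, heq_eq_eq, mem_sigma, mem_range] at h
      exact hf i j (by omega) (by omega) (by omega)
  · rw [prod_sigma', mul_comm, prod_erase_mul P (fun p => f p.2 p.1) hmem]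

lemma ct_sub_mul_eq_zero {i : ℕ} {S : Laurent K}
    (hS : permVar (Equiv.swap i (i + 1)) S = S) :
    ct ((var K (i + 1) - var K i) * S) = 0 := by
  have h : ct (permVar (Equiv.swap i (i + 1)) (var K (i + 1) * S)) = ct (var K (i + 1) * S) :=
    ct_permVar _ _
  rw [map_mul, hS, permVar_var, Equiv.swap_apply_right] at h
  rw [sub_mul, map_sub, h, sub_self]

/-- The product `(x_i/x_j)_{m+1} (q x_j/x_i)_m`. -/
noncomputable def halfPair (q : K) (m i j : ℕ) : Laurent K :=
  qPoch q (ratio K i j) (m + 1) * qPoch q (q • ratio K j i) m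

lemma permVar_halfPair (σ : Equiv.Perm ℕ) (q : K) (m i j : ℕ) :
    permVar σ (halfPair q m i j) = halfPair q m (σ i) (σ j) := by
  simp [halfPair, map_qPoch]

lemma pair_succ (q : K) (m i j : ℕ) :
    pair q (m + 1) i j = halfPair q m i j * (1 - q ^ (m + 1) • ratio K j i) := by
  rw [pair, halfPair, qPoch_succ q (q • ratio K j i), smul_smul, ← pow_succ, mul_assoc]

/-- Halving the pair leaves a symmetric expression times the single factor 1 - x_i/x_j, the source
of antisymmetry. -/
lemma halfPair_eq (q : K) (m i j : ℕ) : halfPair q m i j =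
    (1 - ratio K i j) * (qPoch q (q • ratio K i j) m * qPoch q (q • ratio K j i) m) := by
  rw [halfPair, qPoch_succ', mul_assoc]

lemma permVar_symPair (q : K) (m i j : ℕ) :
    permVar (Equiv.swap i j) (qPoch q (q • ratio K i j) m * qPoch q (q • ratio K j i) m) =
      qPoch q (q • ratio K i j) m * qPoch q (q • ratio K j i) m := by
  simp [map_qPoch, mul_comm]

/-- The inverse of `varProd`. -/
noncomputable def varProdInv (K : Type*) [Field K] (b N : ℕ) (e : ℕ → ℕ) : Laurent K :=
  mon K (-∑ j ∈ range N, e j • Finsupp.single (b + j) (1 : ℤ))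

lemma varProdInv_mul (b N : ℕ) (e : ℕ → ℕ) : varProdInv K b N e * varProd K b N e = 1 := by
  simp only [varProdInv, varProd, var, mon_pow, mon_prod, mon_neg_mul]

/-- Factors of the kernel, with the pairs beyond `b` halved. -/
noncomputable def halfFactor (q : K) (c : ℕ) (κ : ℕ → ℕ) (b i j : ℕ) : Laurent K :=
  if b ≤ i then halfPair q c i j else pair q (c + colEps κ i j) i j

/-- Under the transposition of x_l and x_{l+1} the halved kernel is (1 - x_l/x_{l+1}) times
something symmetric, and the inverse staircase is x_{l+1} times something symmetric. Against a
symmetric g one gets the constant term of (x_{l+1} - x_l) times a symmetric expression, which is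
zero. -/
lemma isAlternating_halfFactor (q : K) (c : ℕ) (κ : ℕ → ℕ) (b m k : ℕ)
    (hk : ∀ i, i < b + (m + 1) → (κ i = k ↔ b ≤ i)) :
    IsAlternating ((ct : Laurent K →ₗ[K] K) ∘ₗ LinearMap.mulLeft K
      ((∏ j ∈ range (b + (m + 1)), ∏ i ∈ range j, halfFactor q c κ b i j) *
        varProdInv K b (m + 1) fun j => m - j)) b (m + 1) := by
  intro l h1 h2 g hg
  obtain ⟨S, hS, hS'⟩ := exists_symmetric_cofactor (halfFactor q c κ b) (N := b + (m + 1)) h2 (by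
    intro i j hij hj hne
    have hsw : ∀ i, Equiv.swap l (l + 1) i = if i = l then l + 1 else if i = l + 1 then l else i :=
      fun i => by rw [Equiv.swap_apply_def]
    by_cases hi : b ≤ i
    · rw [halfFactor, if_pos hi, halfFactor, if_pos, permVar_halfPair]
      rw [hsw]; split_ifs <;> omega
    · have hi' : Equiv.swap l (l + 1) i = i :=
        Equiv.swap_apply_of_ne_of_ne (by omega) (by omega)
      rw [halfFactor, if_neg hi, halfFactor, hi', if_neg hi, permVar_pair, hi']
      congr 2
      have : κ (Equiv.swap l (l + 1) j) = κ j := by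
        rw [hsw]
        split_ifs with e1 e2
        · rw [e1, (hk _ h2).2 (by omega), (hk l (by omega)).2 h1]
        · rw [e2, (hk _ h2).2 (by omega), (hk l (by omega)).2 h1]
        · rfl
      simp only [colEps, this])
  have hT : halfFactor q c κ b l (l + 1) = (1 - ratio K l (l + 1)) *
      (qPoch q (q • ratio K l (l + 1)) c * qPoch q (q • ratio K (l + 1) l) c) := by
    rw [halfFactor, if_pos h1, halfPair_eq]
  obtain ⟨p, rfl⟩ := Nat.exists_eq_add_of_le h1
  set ν := varProdInv K b (m + 1) fun j => m - j
  set V := varProd K b (m + 1) fun j => m - j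
  have hV : varProd K b (m + 1) (fun j => m - j) * var K (b + (p + 1)) =
      varProd K b (m + 1) (fun j => if j = p + 1 then m - p else m - j) :=
    varProd_mul_var (by omega) _ _ (by grind) (by grind)
  -- The extra inverse variable equalises the two exponents concerned, so `ν'` is symmetric under
  -- the transposition.
  set ν' := ν * mon K (-Finsupp.single (b + p + 1) 1)
  have hν' : ν' * (V * var K (b + (p + 1))) = 1 := by
    have e1 : ν * V = 1 := varProdInv_mul _ _ _
    have e2 : mon K (-Finsupp.single (b + p + 1) 1) * var K (b + p + 1) = 1 := mon_neg_mul _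
    calc _ = (ν * V) * (mon K (-Finsupp.single (b + p + 1) 1) * var K (b + p + 1)) := by
            rw [← add_assoc]; ring
      _ = 1 := by rw [e1, e2, one_mul]
  have hν : permVar (Equiv.swap (b + p) (b + p + 1)) ν' = ν' := by
    have h := congrArg (permVar (Equiv.swap (b + p) (b + p + 1))) hν'
    rw [map_mul, map_one, hV, permVar_swap_varProd (l := p) (by omega) _
      (fun j => if j = p + 1 then m - p else m - j) (by grind) (by grind) (by grind), ← hV] at h
    exact left_inv_eq_right_inv h (by rw [mul_comm]; exact hν')
  have hνν : ν = ν' * var K (b + p + 1) := by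
    have e2 : mon K (-Finsupp.single (b + p + 1) 1) * var K (b + p + 1) = 1 := mon_neg_mul _
    rw [mul_assoc, e2, mul_one]
  rw [LinearMap.comp_apply, LinearMap.mulLeft_apply, hS', hT, hνν]
  have := ct_sub_mul_eq_zero (i := b + p) (S := (qPoch q (q • ratio K (b + p) (b + p + 1)) c *
    qPoch q (q • ratio K (b + p + 1) (b + p)) c) * S * ν' * g)
    (by rw [map_mul, map_mul, map_mul, permVar_symPair, hS, hν, hg])
  rw [← this]
  congr 1
  linear_combination (-(qPoch q (q • ratio K (b + p) (b + p + 1)) c *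
    qPoch q (q • ratio K (b + p + 1) (b + p)) c) * S * ν' * g) *
      ratio_mul_var (K := K) (b + p) (b + p + 1)

/-- The constant term with a distinguished last variable `x_n`. -/
noncomputable def ctLast (q : K) (c : ℕ) (ε : ℕ → ℕ → ℕ) (n : ℕ) (A : ℕ → ℕ) (B : ℕ) : K :=
  ct ((∏ i ∈ range n, qPoch q (ratio K i n) (A i) * qPoch q (q • ratio K n i) B) *
    kernel q c ε n)

lemma prod_range_tail {R : Type*} [CommRing R] (b m : ℕ) (f : ℕ → ℕ → R) :
    ∏ j ∈ range (b + m), ∏ i ∈ range j, (if b ≤ i then f i j else 1) =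
      ∏ j ∈ range m, ∏ i ∈ range j, f (b + i) (b + j) := by
  rw [prod_range_add, prod_eq_one, one_mul]
  · refine prod_congr rfl fun j _ => ?_
    rw [prod_range_add, prod_eq_one, one_mul]
    · exact prod_congr rfl fun i _ => if_pos (by omega)
    · exact fun i hi => if_neg (by have := mem_range.1 hi; omega)
  · intro j hj
    have := mem_range.1 hj
    exact prod_eq_one fun i hi => if_neg (by have := mem_range.1 hi; omega)

lemma kernel_eq_halfFactor (q : K) (c : ℕ) (κ : ℕ → ℕ) (b m k : ℕ)
    (hk : ∀ i, i < b + m → (κ i = k ↔ b ≤ i)) :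
    kernel q c (colEps κ) (b + m) =
      (∏ j ∈ range (b + m), ∏ i ∈ range j, halfFactor q c κ b i j) *
        ∏ j ∈ range m, ∏ i ∈ range j, (1 - q ^ (c + 1) • ratio K (b + j) (b + i)) := by
  rw [kernel, ← prod_range_tail b m fun i j => 1 - q ^ (c + 1) • ratio K j i, ← prod_mul_distrib]
  refine prod_congr rfl fun j hj => ?_
  rw [← prod_mul_distrib]
  refine prod_congr rfl fun i hi => ?_
  have hj' := mem_range.1 hj
  have hi' := mem_range.1 hi
  by_cases h : b ≤ i
  · rw [halfFactor, if_pos h, if_pos h, colEps, if_pos, pair_succ]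
    rw [(hk i (by omega)).2 h, (hk j hj').2 (by omega)]
  · rw [halfFactor, if_neg h, if_neg h, mul_one]

lemma prod_one_sub_mul_varProd (s : K) (b m : ℕ) :
    (∏ j ∈ range m, ∏ i ∈ range j, (1 - s • ratio K (b + j) (b + i))) *
      varProd K b m (fun j => m - 1 - j) =
      ∏ j ∈ range m, ∏ i ∈ range j, (var K (b + i) - s • var K (b + j)) := by
  have h : varProd K b m (fun j => m - 1 - j) = ∏ j ∈ range m, ∏ i ∈ range j, var K (b + i) := by
    clear s
    induction m with
    | zero => rfl
    | succ m ih =>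
      rw [prod_range_succ, ← ih, varProd, varProd, prod_range_succ, ← prod_mul_distrib]
      simp only [Nat.add_sub_cancel, Nat.sub_self, pow_zero, mul_one]
      refine prod_congr rfl fun j hj => ?_
      rw [← pow_succ]
      congr 1
      have := mem_range.1 hj
      omega
  rw [h, ← prod_mul_distrib]
  refine prod_congr rfl fun j _ => ?_
  rw [← prod_mul_distrib]
  refine prod_congr rfl fun i _ => ?_
  rw [sub_mul, one_mul, smul_mul_assoc, ratio_mul_var]

lemma isSymmetricOn_prod_var (b m : ℕ) : IsSymmetricOn (varProd K b m fun _ => 1) b m := by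
  intro i h1 h2
  obtain ⟨p, rfl⟩ := Nat.exists_eq_add_of_le h1
  exact permVar_swap_varProd (by omega) _ _ rfl rfl fun _ _ _ _ => rfl

/-- Dropping the factors `1 - q^{c+1} x_n/x_i` in the last block costs a `q`-integer. -/
lemma ctKernel_eq_ctLast (q : K) (c : ℕ) (κ : ℕ → ℕ) (b m k : ℕ)
    (hk : ∀ i, i < b + (m + 1) → (κ i = k ↔ b ≤ i)) :
    ctKernel q c κ (b + m + 1) = (∑ i ∈ range (m + 1), (q ^ (c + 1)) ^ i) *
      ctLast q c (colEps κ) (b + m) (fun i => c + if κ i = k then 1 else 0) c := by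
  set H := ∏ j ∈ range (b + (m + 1)), ∏ i ∈ range j, halfFactor q c κ b i j with hH
  set ν := varProdInv K b (m + 1) fun j => m - j
  have hν : ν * varProd K b (m + 1) (fun j => m - j) = 1 := varProdInv_mul _ _ _
  have halt : IsAlternating ((ct : Laurent K →ₗ[K] K) ∘ₗ LinearMap.mulLeft K (H * ν)) b (m + 1) :=
    isAlternating_halfFactor q c κ b m k hk
  -- Both constant terms are written through one alternating functional. The full kernel supplies
  -- ∏(x_i - q^{c+1} x_j) over all m + 1 variables of the block.
  have hmain : ctKernel q c κ (b + m + 1) =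
      (ct ∘ₗ LinearMap.mulLeft K (H * ν)) (1 * ∏ j ∈ range (m + 1), ∏ i ∈ range j,
        (var K (b + i) - q ^ (c + 1) • var K (b + j))) := by
    rw [← prod_one_sub_mul_varProd, ctKernel, add_assoc,
      kernel_eq_halfFactor q c κ b (m + 1) k hk, ← hH, LinearMap.comp_apply,
      LinearMap.mulLeft_apply, Nat.add_sub_cancel]
    congr 1
    linear_combination (-H * ∏ j ∈ range (m + 1), ∏ i ∈ range j,
      (1 - q ^ (c + 1) • ratio K (b + j) (b + i))) * hν
  -- Here the product runs over the first m variables of the block only; the last variable enters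
  -- through half pairs alone.
  have hlast : ctLast q c (colEps κ) (b + m) (fun i => c + if κ i = k then 1 else 0) c =
      (ct ∘ₗ LinearMap.mulLeft K (H * ν)) (varProd K b m (fun _ => 1) *
        ∏ j ∈ range m, ∏ i ∈ range j, (var K (b + i) - q ^ (c + 1) • var K (b + j))) := by
    rw [← prod_one_sub_mul_varProd, ctLast,
      kernel_eq_halfFactor q c κ b m k fun i hi => hk i (by omega), LinearMap.comp_apply,
      LinearMap.mulLeft_apply]
    have e1 : ∏ i ∈ range (b + m), qPoch q (ratio K i (b + m)) (c + if κ i = k then 1 else 0) *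
        qPoch q (q • ratio K (b + m) i) c =
        ∏ i ∈ range (b + m), halfFactor q c κ b i (b + m) := by
      refine prod_congr rfl fun i hi => ?_
      have hi' := mem_range.1 hi
      by_cases h : b ≤ i
      · rw [halfFactor, if_pos h, halfPair, if_pos ((hk i (by omega)).2 h)]
      · have h2 : κ i ≠ k := fun h' => h ((hk i (by omega)).1 h')
        have h3 : κ (b + m) = k := (hk _ (by omega)).2 (by omega)
        rw [halfFactor, if_neg h, pair, if_neg h2, colEps, if_neg (by rwa [h3]),
          add_zero]
    have e2 : varProd K b m (fun _ => 1) * varProd K b m (fun j => m - 1 - j) =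
        varProd K b (m + 1) fun j => m - j := by
      rw [varProd, varProd, varProd, ← prod_mul_distrib, prod_range_succ]
      simp only [Nat.sub_self, pow_zero, mul_one]
      refine prod_congr rfl fun j hj => ?_
      rw [← pow_add]
      congr 1
      have := mem_range.1 hj
      omega
    rw [e1, hH, ← add_assoc, prod_range_succ]
    congr 1
    rw [← e2] at hν
    linear_combination (-(∏ j ∈ range (b + m), ∏ i ∈ range j, halfFactor q c κ b i j) *
      (∏ i ∈ range (b + m), halfFactor q c κ b i (b + m)) * ∏ j ∈ range m, ∏ i ∈ range j,
      (1 - q ^ (c + 1) • ratio K (b + j) (b + i))) * hν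
  have halt' : IsAlternating ((ct : Laurent K →ₗ[K] K) ∘ₗ LinearMap.mulLeft K (H * ν)) b m :=
    fun i h1 h2 => halt i h1 (by omega)
  -- The two sides are the s-factorials of m + 1 and of m, for s = q^{c+1}, times the same staircase
  -- value. Their quotient is the top s-integer.
  rw [hmain, hlast, halt.prod_sub (fun i _ _ => map_one _), halt'.prod_sub
    (isSymmetricOn_prod_var b m), prod_range_succ]
  have e2 : varProd K b m (fun _ => 1) * varProd K b m (fun j => m - 1 - j) =
      1 * varProd K b (m + 1) fun j => m + 1 - 1 - j := by
    rw [varProd, varProd, varProd, ← prod_mul_distrib, prod_range_succ]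
    simp only [Nat.add_sub_cancel, Nat.sub_self, pow_zero, mul_one, one_mul]
    refine prod_congr rfl fun j hj => ?_
    rw [← pow_add]
    congr 1
    have := mem_range.1 hj
    omega
  rw [e2]
  ring

end LastBlock

end BakerForrester

namespace BakerForrester

open Finset

/-! ### The q-binomial expansion as a polynomial in q^B, and its annihilators. -/

section QSeries

variable {K : Type*} [Field K]

/-- The sign and power `(-1)^k q^{k(k-1)/2}`. -/
noncomputable def sgnPow (q : K) (k : ℤ) : K := (-1) ^ k * q ^ (k * (k - 1) / 2)

lemma sgnPow_zero (q : K) : sgnPow q 0 = 1 := by simp [sgnPow]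

lemma sgnPow_succ {q : K} (hq : q ≠ 0) (k : ℤ) : sgnPow q (k + 1) = -q ^ k * sgnPow q k := by
  have h : (k + 1) * (k + 1 - 1) / 2 = k * (k - 1) / 2 + k := by
    rw [← Int.add_mul_ediv_right _ _ (by norm_num : (2 : ℤ) ≠ 0)]
    congr 1
    ring
  rw [sgnPow, sgnPow, h, zpow_add₀ hq, zpow_add₀ (by simp), zpow_one]
  ring

/-- The coefficient of `y^(A-j)` in `(y)_A (q/y)_B`, as a polynomial in `Y = q^B`. -/
noncomputable def binomCoeff (q : K) (A j : ℕ) : Polynomial K :=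
  Polynomial.C (sgnPow q (A - j) / qPoch q q j) *
    ∏ t ∈ range j, (1 - Polynomial.C (q ^ ((A : ℤ) - j + 1 + t)) * Polynomial.X)

lemma eval_binomCoeff (q : K) (A j : ℕ) (Y : K) : (binomCoeff q A j).eval Y =
    sgnPow q (A - j) / qPoch q q j * ∏ t ∈ range j, (1 - q ^ ((A : ℤ) - j + 1 + t) * Y) := by
  simp [binomCoeff, Polynomial.eval_prod]

lemma natDegree_binomCoeff_le (q : K) (A j : ℕ) : (binomCoeff q A j).natDegree ≤ j := by
  refine (Polynomial.natDegree_C_mul_le _ _).trans ?_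
  refine (Polynomial.natDegree_prod_le _ _).trans ?_
  refine (sum_le_card_nsmul _ _ 1 fun t _ => ?_).trans (by simp)
  refine (Polynomial.natDegree_sub_le _ _).trans ?_
  simpa using (Polynomial.natDegree_C_mul_le _ _).trans Polynomial.natDegree_X_le

lemma qPoch_self_ne_zero {q : K} (hq : ∀ m : ℕ, 0 < m → q ^ m ≠ 1) (j : ℕ) : qPoch q q j ≠ 0 := by
  rw [qPoch, prod_ne_zero_iff]
  intro t _ h
  rw [smul_eq_mul, ← pow_succ, sub_eq_zero] at h
  exact hq (t + 1) t.succ_pos h.symm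

lemma eval_binomCoeff_zero (q : K) (A : ℕ) (Y : K) : (binomCoeff q A 0).eval Y = sgnPow q A := by
  simp [eval_binomCoeff, qPoch_zero]

/-- This is multiplication by 1 - q^{B+1}/y, read on coefficients. It holds for an arbitrary Y, and
therefore also at negative powers of q. -/
lemma binomCoeff_step_B {q : K} (hq0 : q ≠ 0) (hq : ∀ m : ℕ, 0 < m → q ^ m ≠ 1) (A j : ℕ) (Y : K) :
    (binomCoeff q A (j + 1)).eval (q * Y) =
      (binomCoeff q A (j + 1)).eval Y - q * Y * (binomCoeff q A j).eval Y := by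
  have h1 := qPoch_self_ne_zero hq j
  have h2 : (1 : K) - q ^ (j + 1) ≠ 0 := sub_ne_zero.2 (hq (j + 1) j.succ_pos).symm
  have e0 : sgnPow q ((A : ℤ) - j) = -q ^ ((A : ℤ) - j - 1) * sgnPow q ((A : ℤ) - (j + 1 : ℕ)) := by
    rw [show (A : ℤ) - j = ((A : ℤ) - (j + 1 : ℕ)) + 1 by push_cast; ring, sgnPow_succ hq0]
    simp
  simp only [eval_binomCoeff]
  rw [e0, prod_range_succ, prod_range_succ', qPoch_succ, smul_eq_mul]
  have e1 : ∏ t ∈ range j, (1 - q ^ ((A : ℤ) - (j + 1 : ℕ) + 1 + t) * (q * Y)) =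
      ∏ t ∈ range j, (1 - q ^ ((A : ℤ) - j + 1 + t) * Y) :=
    prod_congr rfl fun t _ => by
      rw [← mul_assoc, ← zpow_add_one₀ hq0]; congr 3; push_cast; ring
  have e2 : ∏ t ∈ range j, (1 - q ^ ((A : ℤ) - (j + 1 : ℕ) + 1 + (t + 1 : ℕ)) * Y) =
      ∏ t ∈ range j, (1 - q ^ ((A : ℤ) - j + 1 + t) * Y) :=
    prod_congr rfl fun t _ => by congr 3; push_cast; ring
  rw [e1, e2]
  have e3 : q ^ ((A : ℤ) - (j + 1 : ℕ) + 1 + j) = q ^ (A : ℤ) := by congr 1; push_cast; ring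
  have e4 : q ^ ((A : ℤ) - (j + 1 : ℕ) + 1 + (0 : ℕ)) = q * q ^ ((A : ℤ) - j - 1) := by
    rw [← zpow_one_add₀ hq0]; congr 1; push_cast; ring
  have e5 : q ^ (A : ℤ) = q ^ ((A : ℤ) - j - 1) * q ^ (j + 1) := by
    rw [← zpow_natCast q (j + 1), ← zpow_add₀ hq0]; congr 1; push_cast; ring
  have h3 : q ^ j * q = q ^ (j + 1) := (pow_succ _ _).symm
  rw [e3, e4, e5, h3]
  generalize ∏ t ∈ range j, (1 - q ^ ((A : ℤ) - j + 1 + t) * Y) = P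
  field_simp
  ring

lemma binomCoeff_step_A {q : K} (hq0 : q ≠ 0) (hq : ∀ m : ℕ, 0 < m → q ^ m ≠ 1) (A j : ℕ) (Y : K) :
    (binomCoeff q (A + 1) (j + 1)).eval Y =
      (binomCoeff q A j).eval Y - q ^ A * (binomCoeff q A (j + 1)).eval Y := by
  have h1 := qPoch_self_ne_zero hq j
  have h2 : (1 : K) - q ^ (j + 1) ≠ 0 := sub_ne_zero.2 (hq (j + 1) j.succ_pos).symm
  have e0 : sgnPow q ((A : ℤ) - j) = -q ^ ((A : ℤ) - j - 1) * sgnPow q ((A : ℤ) - (j + 1 : ℕ)) := by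
    rw [show (A : ℤ) - j = ((A : ℤ) - (j + 1 : ℕ)) + 1 by push_cast; ring, sgnPow_succ hq0]
    simp
  simp only [eval_binomCoeff]
  rw [show (((A + 1 : ℕ) : ℤ) - (j + 1 : ℕ)) = (A : ℤ) - j by push_cast; ring, e0,
    prod_range_succ, prod_range_succ' _ j, qPoch_succ, smul_eq_mul]
  have e2 : ∏ t ∈ range j, (1 - q ^ ((A : ℤ) - (j + 1 : ℕ) + 1 + (t + 1 : ℕ)) * Y) =
      ∏ t ∈ range j, (1 - q ^ ((A : ℤ) - j + 1 + t) * Y) :=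
    prod_congr rfl fun t _ => by congr 3; push_cast; ring
  rw [e2]
  have e3 : q ^ ((A : ℤ) - j + 1 + j) = q * q ^ (A : ℤ) := by
    rw [← zpow_one_add₀ hq0]; congr 1; ring
  have e4 : q ^ ((A : ℤ) - (j + 1 : ℕ) + 1 + (0 : ℕ)) = q * q ^ ((A : ℤ) - j - 1) := by
    rw [← zpow_one_add₀ hq0]; congr 1; push_cast; ring
  have e5 : q ^ (A : ℤ) = q ^ ((A : ℤ) - j - 1) * q ^ (j + 1) := by
    rw [← zpow_natCast q (j + 1), ← zpow_add₀ hq0]; congr 1; push_cast; ring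
  have h3 : q ^ j * q = q ^ (j + 1) := (pow_succ _ _).symm
  rw [e3, e4, ← zpow_natCast q A, e5, h3]
  generalize ∏ t ∈ range j, (1 - q ^ ((A : ℤ) - j + 1 + t) * Y) = P
  field_simp
  ring

/-- The factor t = j - 1 - A - B of the product is 1 - q^0. The two inequalities place this t in the
range, also for negative B. -/
lemma eval_binomCoeff_eq_zero {q : K} (hq0 : q ≠ 0) {A j : ℕ} {B : ℤ} (h1 : -B ≤ A)
    (h2 : (A : ℤ) + B < j) : (binomCoeff q A j).eval (q ^ B) = 0 := by
  rw [eval_binomCoeff, prod_eq_zero (i := ((j : ℤ) - 1 - A - B).toNat), mul_zero]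
  · rw [mem_range]; omega
  · rw [← zpow_add₀ hq0, Int.toNat_of_nonneg (by omega), show (A : ℤ) - j + 1 + (j - 1 - A - B) + B = 0
      by ring, zpow_zero, sub_self]

/-- The finite `q`-binomial expansion of `(z)_A (q w)_B`, where `z w = 1`. -/
lemma qPoch_mul_qPoch_eq_sum {R : Type*} [CommRing R] [Algebra K R] {q : K} (hq0 : q ≠ 0)
    (hq : ∀ m : ℕ, 0 < m → q ^ m ≠ 1) {z w : R} (hzw : z * w = 1) (A B : ℕ) :
    qPoch q z A * qPoch q (q • w) B =
      ∑ j ∈ range (A + B + 1), (binomCoeff q A j).eval (q ^ B) • (z ^ A * w ^ j) := by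
  induction B with
  | zero =>
    rw [qPoch_zero, mul_one, pow_zero, add_zero]
    induction A with
    | zero => simp [qPoch_zero, eval_binomCoeff_zero, sgnPow_zero]
    | succ A ih =>
      rw [qPoch_succ, ih, sum_range_succ' _ (A + 1), eval_binomCoeff_zero, Nat.cast_succ,
        sgnPow_succ hq0]
      simp only [binomCoeff_step_A hq0 hq, sub_smul, sum_sub_distrib]
      rw [mul_sub, mul_one]
      have hz : (binomCoeff q A (A + 1)).eval 1 = 0 := by
        have := eval_binomCoeff_eq_zero hq0 (A := A) (j := A + 1) (B := 0) (by simp) (by simp)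
        simpa using this
      have e1 : ∀ j, z ^ (A + 1) * w ^ (j + 1) = z ^ A * w ^ j := fun j => by
        rw [pow_succ, pow_succ]; linear_combination z ^ A * w ^ j * hzw
      simp only [e1]
      have e2 : (∑ j ∈ range (A + 1), (binomCoeff q A j).eval 1 • (z ^ A * w ^ j)) * q ^ A • z =
          (∑ j ∈ range (A + 1), (q ^ A * (binomCoeff q A (j + 1)).eval 1) • (z ^ A * w ^ j)) +
            (q ^ A * sgnPow q A) • (z ^ (A + 1) * w ^ 0) := by
        have e3 : ∀ j, (binomCoeff q A j).eval 1 • (z ^ A * w ^ j) * q ^ A • z =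
            (q ^ A * (binomCoeff q A j).eval 1) • (z ^ (A + 1) * w ^ j) := fun j => by
          rw [smul_mul_smul_comm, mul_comm (q ^ A), pow_succ]; congr 1; ring
        have e30 := e3 0
        rw [eval_binomCoeff_zero] at e30
        rw [sum_mul, sum_range_succ', sum_range_succ _ A, hz, eval_binomCoeff_zero, e30]
        simp only [e3, e1, mul_zero, zero_smul, add_zero]
      rw [e2, zpow_natCast, neg_mul, neg_smul]
      abel
  | succ B ih =>
    rw [qPoch_succ, ← mul_assoc, ih, ← add_assoc, sum_range_succ' _ (A + B + 1),
      eval_binomCoeff_zero, pow_succ' q B]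
    simp only [binomCoeff_step_B hq0 hq, sub_smul, sum_sub_distrib]
    have hz : (binomCoeff q A (A + B + 1)).eval (q ^ B) = 0 := by
      have := eval_binomCoeff_eq_zero hq0 (A := A) (j := A + B + 1) (B := B) (by omega)
        (by push_cast; omega)
      simpa using this
    rw [mul_sub, mul_one, sum_range_succ' _ (A + B), sum_range_succ _ (A + B), hz, zero_smul,
      add_zero, eval_binomCoeff_zero]
    have e2 : (∑ j ∈ range (A + B), (binomCoeff q A (j + 1)).eval (q ^ B) • (z ^ A * w ^ (j + 1)) +
        sgnPow q A • (z ^ A * w ^ 0)) * q ^ B • q • w =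
        ∑ j ∈ range (A + B + 1),
          (q * q ^ B * (binomCoeff q A j).eval (q ^ B)) • (z ^ A * w ^ (j + 1)) := by
      have e3 := sum_range_succ' (fun j => (binomCoeff q A j).eval (q ^ B) • (z ^ A * w ^ j)) (A + B)
      rw [eval_binomCoeff_zero] at e3
      rw [← e3, sum_mul]
      refine sum_congr rfl fun j _ => ?_
      rw [smul_smul, smul_mul_smul_comm, pow_succ]
      congr 1
      · ring
      · ring
    rw [e2]
    abel

/-- The functional `y^e ↦` coefficient of `y^(-e)` in `(y)_A (q/y)_B` at `q^B = Y`. -/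
noncomputable def coeffFun (q : K) (A : ℕ) (Y : K) (e : ℤ) : K :=
  if 0 ≤ (A : ℤ) + e then (binomCoeff q A ((A : ℤ) + e).toNat).eval Y else 0

/-- `binomCoeff_step_B` at B = -(h+1): multiplying the argument by X - q^{-h} amounts to passing
from h + 1 to h and shifting the exponent by one. -/
lemma coeffFun_succ {q : K} (hq0 : q ≠ 0) (hq : ∀ m : ℕ, 0 < m → q ^ m ≠ 1) (A h : ℕ) (e : ℤ) :
    coeffFun q A (q ^ (-(h + 1 : ℕ) : ℤ)) (e + 1) -
      q ^ (-h : ℤ) * coeffFun q A (q ^ (-(h + 1 : ℕ) : ℤ)) e =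
      coeffFun q A (q ^ (-h : ℤ)) (e + 1) := by
  have hY : q ^ (-h : ℤ) = q * q ^ (-(h + 1 : ℕ) : ℤ) := by
    rw [← zpow_one_add₀ hq0]; congr 1; push_cast; ring
  simp only [coeffFun]
  rcases lt_trichotomy ((A : ℤ) + e) (-1) with h1 | h1 | h1
  · rw [if_neg (by omega), if_neg (by omega), if_neg (by omega)]; simp
  · rw [if_pos (by omega), if_neg (by omega), if_pos (by omega),
      show ((A : ℤ) + (e + 1)).toNat = 0 by omega, eval_binomCoeff_zero, eval_binomCoeff_zero]
    simp
  · rw [if_pos (by omega), if_pos (by omega), if_pos (by omega),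
      show ((A : ℤ) + (e + 1)).toNat = ((A : ℤ) + e).toNat + 1 by omega, hY,
      binomCoeff_step_B hq0 hq]

lemma coeffFun_eq_zero {q : K} (hq0 : q ≠ 0) {A h : ℕ} (hA : h ≤ A) {e : ℤ} (he : 1 - (h : ℤ) ≤ e) :
    coeffFun q A (q ^ (-h : ℤ)) e = 0 := by
  rw [coeffFun, if_pos (by omega)]
  exact eval_binomCoeff_eq_zero hq0 (by omega) (by omega)

/-- The linear functional on `K[X]` with given moments. -/
noncomputable def momentFun (μ : ℕ → K) : Polynomial K →ₗ[K] K :=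
  Polynomial.lsum fun m => LinearMap.mulRight K (μ m)

lemma momentFun_monomial (μ : ℕ → K) (m : ℕ) (a : K) :
    momentFun μ (Polynomial.monomial m a) = a * μ m := by
  simp [momentFun, Polynomial.lsum_apply]

/-- The polynomial with simple roots `q^α`, `1 - h ≤ α ≤ -A`. -/
noncomputable def lowPoly (q : K) (A h : ℕ) : Polynomial K :=
  ∏ α ∈ Icc (1 - (h : ℤ)) (-A), (Polynomial.X - Polynomial.C (q ^ α))

/-- Each root q^{-h} of `lowPoly` can be traded, through `coeffFun_succ`, for one more power of X
while h decreases by one; m + h is unchanged. Once h ≤ A there are no roots left, and X^m is killed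
because its moment is a coefficient beyond the end of a genuine finite expansion. -/
lemma momentFun_coeffFun {q : K} (hq0 : q ≠ 0) (hq : ∀ m : ℕ, 0 < m → q ^ m ≠ 1) (A h d m : ℕ)
    (hm : d + 1 ≤ m + h) :
    momentFun (fun m => coeffFun q A (q ^ (-h : ℤ)) ((m : ℤ) - d))
      (Polynomial.X ^ m * lowPoly q A h) = 0 := by
  induction h generalizing m with
  | zero =>
    rw [lowPoly, Icc_eq_empty (by simp; omega), prod_empty, mul_one,
      ← Polynomial.monomial_one_right_eq_X_pow, momentFun_monomial, one_mul]
    exact coeffFun_eq_zero hq0 (by omega) (by push_cast; omega)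
  | succ h ih =>
    by_cases hA : h + 1 ≤ A
    · rw [lowPoly, Icc_eq_empty (by simp; omega), prod_empty, mul_one,
        ← Polynomial.monomial_one_right_eq_X_pow, momentFun_monomial, one_mul]
      exact coeffFun_eq_zero hq0 hA (by push_cast; omega)
    · have e1 : lowPoly q A (h + 1) =
          (Polynomial.X - Polynomial.C (q ^ (-h : ℤ))) * lowPoly q A h := by
        have : Icc (1 - ((h + 1 : ℕ) : ℤ)) (-A) = insert (-h : ℤ) (Icc (1 - (h : ℤ)) (-A)) := by
          ext x
          simp only [mem_insert, mem_Icc]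
          omega
        rw [lowPoly, this, prod_insert (by simp), lowPoly]
      rw [e1, ← ih (m + 1) (by omega), pow_succ]
      -- The factor X - q^{-h} at level h + 1 becomes the factor X at level h.
      have key : ∀ p : Polynomial K,
          momentFun (fun m => coeffFun q A (q ^ (-(h + 1 : ℕ) : ℤ)) ((m : ℤ) - d))
            ((Polynomial.X - Polynomial.C (q ^ (-h : ℤ))) * p) =
          momentFun (fun m => coeffFun q A (q ^ (-h : ℤ)) ((m : ℤ) - d)) (Polynomial.X * p) := by
        intro p
        induction p using Polynomial.induction_on' with
        | add p r hp hr => rw [mul_add, mul_add, map_add, map_add, hp, hr]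
        | monomial k a =>
          rw [sub_mul, Polynomial.X_mul_monomial, Polynomial.C_mul_monomial, map_sub]
          simp only [momentFun_monomial]
          have := coeffFun_succ hq0 hq A h ((k : ℤ) - d)
          rw [show ((k + 1 : ℕ) : ℤ) - d = (k : ℤ) - d + 1 by push_cast; ring]
          linear_combination a * this
      rw [mul_left_comm, key]
      congr 1
      ring

/-- The product functional on multivariate polynomials. -/
noncomputable def prodFun {n : ℕ} (μ : Fin n → ℕ → K) : MvPolynomial (Fin n) K →ₗ[K] K :=
  (MvPolynomial.basisMonomials (Fin n) K).constr K fun f => ∏ i, μ i (f i)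

lemma prodFun_monomial {n : ℕ} (μ : Fin n → ℕ → K) (f : Fin n →₀ ℕ) (a : K) :
    prodFun μ (MvPolynomial.monomial f a) = a * ∏ i, μ i (f i) := by
  have h : MvPolynomial.monomial f a = a • MvPolynomial.basisMonomials (Fin n) K f := by
    simp [MvPolynomial.smul_monomial]
  rw [h, map_smul, prodFun, Module.Basis.constr_basis, smul_eq_mul]

/-- The functional is a product over the variables, so a polynomial in X_i all of whose multiples
are killed by the i-th factor generates an ideal killed by the whole functional. -/
lemma prodFun_mul_aeval {n : ℕ} (μ : Fin n → ℕ → K) (i : Fin n) (P : Polynomial K)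
    (hP : ∀ m, momentFun (μ i) (Polynomial.X ^ m * P) = 0) (g : MvPolynomial (Fin n) K) :
    prodFun μ (g * Polynomial.aeval (MvPolynomial.X i) P) = 0 := by
  induction g using MvPolynomial.induction_on' with
  | add p r hp hr => rw [add_mul, map_add, hp, hr, add_zero]
  | monomial f a =>
    have key : ∀ p : Polynomial K,
        prodFun μ (MvPolynomial.monomial f a * Polynomial.aeval (MvPolynomial.X i) p) =
          a * (∏ k ∈ univ.erase i, μ k (f k)) *
            momentFun (μ i) (Polynomial.X ^ (f i) * p) := by
      intro p
      induction p using Polynomial.induction_on' with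
      | add p r hp hr => rw [map_add, mul_add, map_add, hp, hr, mul_add, map_add, mul_add]
      | monomial k b =>
        rw [← Polynomial.monomial_one_right_eq_X_pow, Polynomial.monomial_mul_monomial,
          momentFun_monomial, Polynomial.aeval_monomial, MvPolynomial.X_pow_eq_monomial,
          MvPolynomial.algebraMap_eq, MvPolynomial.C_mul_monomial, MvPolynomial.monomial_mul,
          prodFun_monomial, ← mul_prod_erase univ _ (mem_univ i)]
        have : ∏ k' ∈ univ.erase i, μ k' ((f + Finsupp.single i k) k') =
            ∏ k' ∈ univ.erase i, μ k' (f k') := by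
          refine prod_congr rfl fun k' hk' => ?_
          rw [Finsupp.add_apply, Finsupp.single_eq_of_ne (ne_of_mem_erase hk'), add_zero]
        rw [this]
        simp only [Finsupp.add_apply, Finsupp.single_eq_same]
        ring
    rw [key, hP, mul_zero]

end QSeries

end BakerForrester

namespace BakerForrester

open Finset

/-! ### The constant term as a functional of the numerator of the kernel. -/

section Functional

variable {K : Type*} [Field K]

/-- The exponent of `x_l` in the denominator of the kernel. -/
def kernelDeg (m : ℕ → ℕ → ℕ) (n l : ℕ) : ℕ := ∑ j ∈ range n, if j = l then 0 else m l j

lemma prod_pair_pow {M : Type*} [CommMonoid M] (u : ℕ → M) {m : ℕ → ℕ → ℕ}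
    (hm : ∀ i j, m i j = m j i) (n : ℕ) :
    ∏ j ∈ range n, ∏ i ∈ range j, (u i * u j) ^ m i j =
      ∏ l ∈ range n, u l ^ kernelDeg m n l := by
  induction n with
  | zero => rfl
  | succ n ih =>
    rw [prod_range_succ, ih, prod_range_succ]
    have h1 : ∀ l ∈ range n, kernelDeg m (n + 1) l = kernelDeg m n l + m l n := fun l hl => by
      have := mem_range.1 hl
      rw [kernelDeg, sum_range_succ, if_neg (by omega), kernelDeg]
    have h2 : kernelDeg m (n + 1) n = ∑ i ∈ range n, m i n := by
      rw [kernelDeg, sum_range_succ, if_pos rfl, add_zero]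
      exact sum_congr rfl fun i hi => by
        have := mem_range.1 hi
        rw [if_neg (by omega), hm]
    have h3 : ∏ l ∈ range n, u l ^ kernelDeg m (n + 1) l =
        ∏ l ∈ range n, (u l ^ kernelDeg m n l * u l ^ m l n) :=
      prod_congr rfl fun l hl => by rw [h1 l hl, pow_add]
    rw [h3, prod_mul_distrib, h2, ← prod_pow_eq_pow_sum, mul_assoc, ← prod_mul_distrib]
    simp only [mul_pow, prod_mul_distrib]

lemma sum_kernelDeg {m : ℕ → ℕ → ℕ} (hm : ∀ i j, m i j = m j i) (n : ℕ) :
    ∑ j ∈ range n, ∑ i ∈ range j, 2 * m i j = ∑ l ∈ range n, kernelDeg m n l := by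
  -- The additive identity is read off from the exponents of 2.
  have h := prod_pair_pow (fun _ => 2) hm n
  simp only [← pow_two, ← pow_mul, prod_pow_eq_pow_sum] at h
  exact Nat.pow_right_injective le_rfl h

/-- The numerator of `pair`. -/
noncomputable def pairNum (q : K) {n : ℕ} (m : ℕ) (i j : Fin n) : MvPolynomial (Fin n) K :=
  ∏ t ∈ range m, ((MvPolynomial.X j - MvPolynomial.C (q ^ t) * MvPolynomial.X i) *
    (MvPolynomial.X i - MvPolynomial.C (q ^ (t + 1)) * MvPolynomial.X j))

/-- The numerator of the kernel with exponents `m`. -/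
noncomputable def kernelNum (q : K) (m : ℕ → ℕ → ℕ) (n : ℕ) : MvPolynomial (Fin n) K :=
  ∏ j : Fin n, ∏ i : Fin n, if i < j then pairNum q (m i j) i j else 1

lemma aeval_pairNum (q : K) {n : ℕ} (m : ℕ) (i j : Fin n) :
    MvPolynomial.aeval (fun i : Fin n => var K i) (pairNum q m i j) =
      pair q m i j * (var K i * var K j) ^ m := by
  rw [pairNum, pair, qPoch, qPoch, ← prod_mul_distrib, ← card_range m, ← prod_const,
    card_range, ← prod_mul_distrib, map_prod]
  refine prod_congr rfl fun t _ => ?_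
  have h1 := ratio_mul_var (K := K) i j
  have h2 := ratio_mul_var (K := K) j i
  simp only [map_mul, map_sub, MvPolynomial.aeval_X, MvPolynomial.aeval_C, ← Algebra.smul_def]
  rw [← h1, ← h2, pow_succ]
  simp only [Algebra.smul_def, map_mul]
  have h3 : ratio K i j * ratio K j i = 1 := by rw [ratio_mul, ratio_self]
  grind

lemma prod_range_range {M : Type*} [CommMonoid M] (n : ℕ) (f : ℕ → ℕ → M) :
    ∏ j ∈ range n, ∏ i ∈ range j, f i j =
      ∏ j : Fin n, ∏ i : Fin n, if i < j then f i j else 1 := by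
  rw [prod_range]
  refine prod_congr rfl fun j _ => ?_
  have : ∏ i ∈ range j, f i j = ∏ i ∈ range n, if i < j then f i j else 1 := by
    rw [← prod_filter]
    congr 1
    ext i
    simp only [mem_filter, mem_range]
    omega
  rw [this, prod_range]
  rfl

lemma sum_range_range {M : Type*} [AddCommMonoid M] (n : ℕ) (f : ℕ → ℕ → M) :
    ∑ j ∈ range n, ∑ i ∈ range j, f i j =
      ∑ j : Fin n, ∑ i : Fin n, if i < j then f i j else 0 :=
  prod_range_range (M := Multiplicative M) n f

lemma kernel_mul_prod_var (q : K) (c : ℕ) (ε : ℕ → ℕ → ℕ) (hε : ∀ i j, ε i j = ε j i) (n : ℕ) :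
    kernel q c ε n * ∏ l ∈ range n, var K l ^ kernelDeg (fun i j => c + ε i j) n l =
      MvPolynomial.aeval (fun i : Fin n => var K i) (kernelNum q (fun i j => c + ε i j) n) := by
  rw [← prod_pair_pow _ (fun i j => by rw [hε]), kernel, ← prod_mul_distrib, kernelNum, map_prod]
  simp only [← prod_mul_distrib, map_prod]
  rw [prod_range_range]
  refine prod_congr rfl fun j _ => prod_congr rfl fun i _ => ?_
  split_ifs with h
  · rw [aeval_pairNum]
  · rw [map_one]

lemma isHomogeneous_kernelNum (q : K) {m : ℕ → ℕ → ℕ} (hm : ∀ i j, m i j = m j i) (n : ℕ) :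
    (kernelNum q m n).IsHomogeneous (∑ l ∈ range n, kernelDeg m n l) := by
  rw [← sum_kernelDeg hm, sum_range_range]
  refine MvPolynomial.IsHomogeneous.prod _ _ _ fun j _ =>
    MvPolynomial.IsHomogeneous.prod _ _ _ fun i _ => ?_
  split_ifs
  · have : 2 * m i j = ∑ _t ∈ range (m i j), (1 + 1) := by simp [mul_comm]
    rw [this]
    refine MvPolynomial.IsHomogeneous.prod _ _ _ fun t _ => .mul (.sub ?_ ?_) (.sub ?_ ?_)
    · exact MvPolynomial.isHomogeneous_X _ _
    · exact (MvPolynomial.isHomogeneous_X K i).C_mul _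
    · exact MvPolynomial.isHomogeneous_X _ _
    · exact (MvPolynomial.isHomogeneous_X K j).C_mul _
  · exact MvPolynomial.isHomogeneous_one _ _

lemma sum_eq_of_mem_support {σ : Type*} [Fintype σ] {F : MvPolynomial σ K} {N : ℕ}
    (hF : F.IsHomogeneous N) {f : σ →₀ ℕ} (hf : f ∈ F.support) : ∑ i, f i = N := by
  rw [← Finsupp.degree_eq_sum, ← hF (MvPolynomial.mem_support_iff.1 hf)]
  exact DFunLike.congr_fun Finsupp.degree_eq_weight_one f

lemma prodFun_eq_sum {n : ℕ} (μ : Fin n → ℕ → K) (F : MvPolynomial (Fin n) K) :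
    prodFun μ F = ∑ f ∈ F.support, F.coeff f * ∏ i, μ i (f i) := by
  conv_lhs => rw [← F.support_sum_monomial_coeff, map_sum]
  exact sum_congr rfl fun f _ => prodFun_monomial _ _ _

/-- The variables x_0, …, x_{n-1} decouple: each exponent must be cancelled by its own factor. The
exponent of x_n is then zero automatically, the monomial having degree zero. -/
lemma ct_prod_qPoch_mul_mon {q : K} (hq0 : q ≠ 0) (hq : ∀ m : ℕ, 0 < m → q ^ m ≠ 1) (n : ℕ)
    (A : ℕ → ℕ) (B : ℕ) (r : Fin n → ℤ) (hr : ∑ i, r i = 0) :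
    ct ((∏ i ∈ range n, qPoch q (ratio K i n) (A i) * qPoch q (q • ratio K n i) B) *
      mon K (∑ i : Fin n, r i • Finsupp.single (i : ℕ) 1)) =
      ∏ i : Fin n, coeffFun q (A i) (q ^ B) (r i) := by
  classical
  rw [prod_range]
  have h1 : ∀ i : Fin n, qPoch q (ratio K i n) (A i) * qPoch q (q • ratio K n i) B =
      ∑ j ∈ range (A i + B + 1), (binomCoeff q (A i) j).eval (q ^ B) •
        mon K (((A i : ℤ) - j) • (Finsupp.single (i : ℕ) 1 - Finsupp.single n 1)) := by
    intro i
    rw [qPoch_mul_qPoch_eq_sum hq0 hq (by rw [ratio_mul, ratio_self])]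
    refine sum_congr rfl fun j _ => ?_
    rw [ratio_eq_mon, ratio_eq_mon, mon_pow, mon_pow, mon_mul]
    congr 2
    rw [sub_smul, natCast_zsmul, natCast_zsmul, ← neg_sub (Finsupp.single n (1 : ℤ)), smul_neg, smul_neg]
    abel
  simp only [h1]
  rw [prod_univ_sum, sum_mul, map_sum]
  have h2 : ∀ p ∈ Fintype.piFinset fun i : Fin n => range (A i + B + 1),
      ct ((∏ i : Fin n, (binomCoeff q (A i) (p i)).eval (q ^ B) •
        mon K (((A i : ℤ) - p i) • (Finsupp.single (i : ℕ) 1 - Finsupp.single n 1))) *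
        mon K (∑ i : Fin n, r i • Finsupp.single (i : ℕ) 1)) =
      ∏ i : Fin n, if ((A i : ℤ) + r i) = p i then (binomCoeff q (A i) (p i)).eval (q ^ B) else 0 := by
    intro p _
    rw [prod_smul, mon_prod, smul_mul_assoc, mon_mul, map_smul, ct_mon, smul_eq_mul, mul_ite,
      mul_one, mul_zero, prod_ite_zero]
    congr 1
    simp only [mem_univ, forall_true_left, eq_iff_iff]
    have hev : ∀ i : Fin n, (∑ i : Fin n, ((A i : ℤ) - p i) • (Finsupp.single (i : ℕ) (1 : ℤ) -
        Finsupp.single n 1) + ∑ i : Fin n, r i • Finsupp.single (i : ℕ) 1 : ℕ →₀ ℤ) i = (A i : ℤ) - p i + r i := by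
      intro i
      have : ∀ x : Fin n, Finsupp.single (x : ℕ) (1 : ℤ) (i : ℕ) = if x = i then 1 else 0 := by
        intro x; rw [Finsupp.single_apply]; simp [Fin.ext_iff]
      have hn : Finsupp.single n (1 : ℤ) (i : ℕ) = 0 :=
        Finsupp.single_eq_of_ne (by have := i.2; omega)
      simp only [Finsupp.add_apply, Finsupp.finsetSum_apply, Finsupp.smul_apply,
        Finsupp.sub_apply, this, hn]
      simp
    constructor
    · intro h i
      have := hev i
      rw [h, Finsupp.zero_apply] at this
      omega
    · intro h
      have h' : ∀ i, r i = -((A i : ℤ) - p i) := fun i => by have := h i; omega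
      simp only [h', sum_neg_distrib, neg_smul, smul_sub, sum_sub_distrib]
      rw [← sum_smul (f := fun i : Fin n => (A i : ℤ) - p i)]
      have : ∑ i : Fin n, ((A i : ℤ) - p i) = 0 := by
        simp only [h', sum_neg_distrib, neg_eq_zero] at hr
        exact hr
      rw [this, zero_smul]
      abel
  rw [sum_congr rfl h2, ← prod_univ_sum (fun i : Fin n => range (A i + B + 1)) fun i j =>
    if ((A i : ℤ) + r i) = (j : ℤ) then (binomCoeff q (A i) j).eval (q ^ B) else 0]
  refine prod_congr rfl fun i _ => ?_
  rw [coeffFun]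
  split_ifs with h
  · obtain ⟨k, hk⟩ := Int.eq_ofNat_of_zero_le h
    rw [hk, Int.toNat_natCast]
    simp only [Nat.cast_inj]
    rw [sum_ite_eq]
    split_ifs with h3
    · rfl
    · have h4 := eval_binomCoeff_eq_zero hq0 (A := A i) (j := k) (B := B) (by omega)
        (by rw [mem_range] at h3; omega)
      rw [zpow_natCast] at h4
      exact h4.symm
  · exact sum_eq_zero fun j _ => if_neg (by omega)

/-- `ctLast` as a functional of the numerator of the kernel. -/
lemma ctLast_eq_prodFun {q : K} (hq0 : q ≠ 0) (hq : ∀ m : ℕ, 0 < m → q ^ m ≠ 1) (c : ℕ)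
    (ε : ℕ → ℕ → ℕ) (hε : ∀ i j, ε i j = ε j i) (n : ℕ) (A : ℕ → ℕ) (B : ℕ) :
    ctLast q c ε n A B =
      prodFun (fun i : Fin n => fun m =>
        coeffFun q (A i) (q ^ B) ((m : ℤ) - kernelDeg (fun i j => c + ε i j) n i))
        (kernelNum q (fun i j => c + ε i j) n) := by
  set m : ℕ → ℕ → ℕ := fun i j => c + ε i j with hm
  set d := kernelDeg m n with hd
  have hker : kernel q c ε n = mon K (-∑ i : Fin n, (d i : ℤ) • Finsupp.single (i : ℕ) 1) *
      MvPolynomial.aeval (fun i : Fin n => var K i) (kernelNum q m n) := by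
    rw [← kernel_mul_prod_var q c ε hε, mul_comm (kernel q c ε n), ← mul_assoc, prod_range]
    have : ∏ i : Fin n, var K i ^ d i = mon K (∑ i : Fin n, (d i : ℤ) • Finsupp.single (i : ℕ) 1) := by
      simp only [var, mon_pow, mon_prod, natCast_zsmul]
    rw [← hm, ← hd, this, mon_neg_mul, one_mul]
  rw [ctLast, hker, prodFun_eq_sum]
  conv_lhs => rw [← (kernelNum q m n).support_sum_monomial_coeff]
  rw [map_sum, mul_sum, mul_sum, map_sum]
  refine sum_congr rfl fun f hf => ?_
  have hf' := sum_eq_of_mem_support (isHomogeneous_kernelNum q (m := m) (fun i j => by simp [hm, hε]) n) hf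
  rw [sum_range] at hf'
  rw [MvPolynomial.aeval_monomial, ← Algebra.smul_def]
  have h2 : f.prod (fun i k => var K i ^ k) =
      mon K (∑ i : Fin n, (f i : ℤ) • Finsupp.single (i : ℕ) 1) := by
    rw [Finsupp.prod_fintype _ _ (fun i => pow_zero _)]
    simp only [var, mon_pow, mon_prod, natCast_zsmul]
  rw [h2, mul_smul_comm, mul_smul_comm, map_smul, smul_eq_mul, mon_mul, ← sum_neg_distrib,
    ← sum_add_distrib, ← ct_prod_qPoch_mul_mon hq0 hq n A B]
  · have : ∑ i : Fin n, (-((d i : ℤ) • Finsupp.single (i : ℕ) (1 : ℤ)) +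
        (f i : ℤ) • Finsupp.single (i : ℕ) 1) =
        ∑ i : Fin n, ((f i : ℤ) - d i) • Finsupp.single (i : ℕ) 1 :=
      sum_congr rfl fun i _ => by rw [sub_smul]; abel
    rw [this]
  · rw [sum_sub_distrib, sub_eq_zero]
    exact_mod_cast hf'

/-- `ctLast` as a polynomial in `q^B`. -/
noncomputable def lastPoly (q : K) (c : ℕ) (ε : ℕ → ℕ → ℕ) (n : ℕ) (A : ℕ → ℕ) : Polynomial K :=
  ∑ f ∈ (kernelNum q (fun i j => c + ε i j) n).support,
    Polynomial.C ((kernelNum q (fun i j => c + ε i j) n).coeff f) *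
      ∏ i : Fin n, if 0 ≤ (A i : ℤ) + ((f i : ℤ) - kernelDeg (fun i j => c + ε i j) n i) then
        binomCoeff q (A i)
          ((A i : ℤ) + ((f i : ℤ) - kernelDeg (fun i j => c + ε i j) n i)).toNat else 0

lemma eval_lastPoly (q : K) (c : ℕ) (ε : ℕ → ℕ → ℕ) (n : ℕ) (A : ℕ → ℕ) (Y : K) :
    (lastPoly q c ε n A).eval Y = prodFun (fun i : Fin n => fun m =>
        coeffFun q (A i) Y ((m : ℤ) - kernelDeg (fun i j => c + ε i j) n i))
        (kernelNum q (fun i j => c + ε i j) n) := by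
  rw [prodFun_eq_sum, lastPoly, Polynomial.eval_finsetSum]
  refine sum_congr rfl fun f _ => ?_
  rw [Polynomial.eval_mul, Polynomial.eval_C, Polynomial.eval_prod]
  congr 1
  refine prod_congr rfl fun i _ => ?_
  rw [coeffFun]
  split_ifs <;> simp

/-- The degree of the term of exponent f is at most ∑_i (A_i + f_i - d_i), with d_i = `kernelDeg`.
The numerator is homogeneous of degree ∑ d_i, so this equals ∑ A_i. -/
lemma natDegree_lastPoly_le (q : K) (c : ℕ) (ε : ℕ → ℕ → ℕ) (hε : ∀ i j, ε i j = ε j i) (n : ℕ)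
    (A : ℕ → ℕ) : (lastPoly q c ε n A).natDegree ≤ ∑ i ∈ range n, A i := by
  refine Polynomial.natDegree_sum_le_of_forall_le _ _ fun f hf => ?_
  have hf' := sum_eq_of_mem_support (isHomogeneous_kernelNum q (m := fun i j => c + ε i j)
    (fun i j => by simp [hε]) n) hf
  rw [sum_range] at hf'
  refine (Polynomial.natDegree_C_mul_le _ _).trans ?_
  by_cases h : ∀ i : Fin n, 0 ≤ (A i : ℤ) + ((f i : ℤ) - kernelDeg (fun i j => c + ε i j) n i)
  · rw [prod_congr rfl fun i _ => if_pos (h i)]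
    refine (Polynomial.natDegree_prod_le _ _).trans ?_
    refine (sum_le_sum fun i _ => natDegree_binomCoeff_le _ _ _).trans ?_
    rw [sum_range]
    zify
    rw [sum_congr rfl fun i _ => Int.toNat_of_nonneg (h i), sum_add_distrib, sum_sub_distrib]
    have : (∑ i : Fin n, (f i : ℤ)) =
        ∑ i : Fin n, (kernelDeg (fun i j => c + ε i j) n i : ℤ) := by exact_mod_cast hf'
    rw [this, sub_self, add_zero]
  · push Not at h
    obtain ⟨i, hi⟩ := h
    rw [prod_eq_zero (mem_univ i) (if_neg (by omega))]
    simp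

lemma coeffFun_one_of_pos {q : K} (hq0 : q ≠ 0) (A : ℕ) {e : ℤ} (he : 0 < e) :
    coeffFun q A 1 e = 0 := by
  rw [coeffFun, if_pos (by omega)]
  have := eval_binomCoeff_eq_zero hq0 (A := A) (j := ((A : ℤ) + e).toNat) (B := 0) (by omega)
    (by omega)
  rwa [zpow_zero] at this

lemma coeffFun_one_zero {q : K} (hq0 : q ≠ 0) (hq : ∀ m : ℕ, 0 < m → q ^ m ≠ 1) (A : ℕ) :
    coeffFun q A 1 0 = 1 := by
  rw [coeffFun, if_pos (by omega), eval_binomCoeff]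
  simp only [add_zero, Int.toNat_natCast, sub_self, sgnPow_zero, zero_add]
  rw [one_div, inv_mul_eq_one₀ (qPoch_self_ne_zero hq A), qPoch]
  refine prod_congr rfl fun t _ => ?_
  rw [zpow_one_add₀ hq0, smul_eq_mul, zpow_natCast]
  ring

/-- At Y = 1 the moments vanish for positive shifts and equal 1 at shift zero. In a homogeneous
polynomial of degree ∑ d_i every exponent other than d exceeds d somewhere, so only the coefficient
at d survives; it does not involve A. -/
lemma prodFun_coeffFun_one {q : K} (hq0 : q ≠ 0) (hq : ∀ m : ℕ, 0 < m → q ^ m ≠ 1) {n : ℕ}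
    (A d : Fin n → ℕ) {F : MvPolynomial (Fin n) K} (hF : F.IsHomogeneous (∑ i, d i)) :
    prodFun (fun i m => coeffFun q (A i) 1 ((m : ℤ) - d i)) F =
      F.coeff (Finsupp.equivFunOnFinite.symm d) := by
  rw [prodFun_eq_sum, sum_eq_single (Finsupp.equivFunOnFinite.symm d)]
  · simp [coeffFun_one_zero hq0 hq]
  · intro f hf hfd
    have hf' := sum_eq_of_mem_support hF hf
    obtain ⟨i, hi⟩ : ∃ i, d i < f i := by
      by_contra! h
      refine hfd (Finsupp.ext fun i => ?_)
      exact (sum_eq_sum_iff_of_le fun i _ => h i).1 hf' i (mem_univ i)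
    rw [prod_eq_zero (mem_univ i) (coeffFun_one_of_pos hq0 _ (by omega)), mul_zero]
  · intro h
    rw [MvPolynomial.notMem_support_iff.1 h, zero_mul]

lemma eval_lastPoly_pow {q : K} (hq0 : q ≠ 0) (hq : ∀ m : ℕ, 0 < m → q ^ m ≠ 1) (c : ℕ)
    (ε : ℕ → ℕ → ℕ) (hε : ∀ i j, ε i j = ε j i) (n : ℕ) (A : ℕ → ℕ) (B : ℕ) :
    (lastPoly q c ε n A).eval (q ^ B) = ctLast q c ε n A B := by
  rw [eval_lastPoly, ctLast_eq_prodFun hq0 hq c ε hε]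

lemma ctLast_zero {q : K} (hq0 : q ≠ 0) (hq : ∀ m : ℕ, 0 < m → q ^ m ≠ 1) (c : ℕ)
    (ε : ℕ → ℕ → ℕ) (hε : ∀ i j, ε i j = ε j i) (n : ℕ) (A : ℕ → ℕ) :
    ctLast q c ε n A 0 = ct (kernel q c ε n) := by
  have hF := isHomogeneous_kernelNum q (m := fun i j => c + ε i j) (fun i j => by simp [hε]) n
  rw [sum_range] at hF
  have h : ∀ A : ℕ → ℕ, ctLast q c ε n A 0 = ctLast q c ε n (fun _ => 0) 0 := fun A => by
    rw [ctLast_eq_prodFun hq0 hq c ε hε, ctLast_eq_prodFun hq0 hq c ε hε, pow_zero]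
    exact (prodFun_coeffFun_one hq0 hq (fun i : Fin n => A i) _ hF).trans
      (prodFun_coeffFun_one hq0 hq (fun _ => 0) _ hF).symm
  rw [h, ctLast]
  simp [qPoch_zero]

end Functional

end BakerForrester

namespace BakerForrester

open Finset

/-! ### Vanishing by the Combinatorial Nullstellensatz on a deformed grid. -/

section Grid

variable {K : Type*} [Field K]

lemma zpow_injective {q : K} (hq0 : q ≠ 0) (hq : ∀ m : ℕ, 0 < m → q ^ m ≠ 1) :
    Function.Injective fun a : ℤ => q ^ a := by
  have key : ∀ (a : ℤ) (k : ℕ), 0 < k → q ^ (a + k) ≠ q ^ a := fun a k hk h => by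
    rw [zpow_add₀ hq0, zpow_natCast] at h
    exact hq k hk (by simpa [zpow_ne_zero a hq0] using h)
  intro a b h
  rcases lt_trichotomy a b with h1 | h1 | h1
  · have := key a (b - a).toNat (by omega)
    rw [Int.toNat_of_nonneg (by omega), add_sub_cancel] at this
    exact absurd h.symm this
  · exact h1
  · have := key b (a - b).toNat (by omega)
    rw [Int.toNat_of_nonneg (by omega), add_sub_cancel] at this
    exact absurd h this

/-- The condition on exponents under which `pairNum` does not vanish. -/
def Sep (m : ℕ) (a b : ℤ) : Prop := (m : ℤ) ≤ b - a ∨ (m : ℤ) + 1 ≤ a - b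

/-- The factors indexed by t vanish when b - a = t or a - b = t + 1, with t < m. The common scale u
stands for 1 or for the deformation parameter. -/
lemma sep_of_prod_ne_zero {R : Type*} [CommRing R] [IsDomain R] [Algebra K R] {q : K} (hq0 : q ≠ 0)
    (u : R) (m : ℕ) (a b : ℤ)
    (h : ∏ t ∈ range m, ((q ^ b • u - algebraMap K R (q ^ t) * q ^ a • u) *
      (q ^ a • u - algebraMap K R (q ^ (t + 1)) * q ^ b • u)) ≠ 0) : Sep m a b := by
  by_contra hs
  simp only [Sep, not_or, not_le] at hs
  refine h ?_
  by_cases hab : a ≤ b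
  · refine prod_eq_zero (i := (b - a).toNat) (by rw [mem_range]; omega) ?_
    rw [← Algebra.smul_def, smul_smul, ← zpow_natCast, ← zpow_add₀ hq0,
      Int.toNat_of_nonneg (by omega), sub_add_cancel, sub_self, zero_mul]
  · refine prod_eq_zero (i := (a - b - 1).toNat) (by rw [mem_range]; omega) ?_
    rw [mul_comm, ← Algebra.smul_def, smul_smul, ← zpow_natCast, ← zpow_add₀ hq0, Nat.cast_succ,
      Int.toNat_of_nonneg (by omega), sub_add_cancel, sub_add_cancel, sub_self, zero_mul]

lemma eval_map_kernelNum {R : Type*} [CommRing R] [Algebra K R] (q : K) (m : ℕ → ℕ → ℕ) (n : ℕ)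
    (x : Fin n → R) :
    MvPolynomial.eval x (MvPolynomial.map (algebraMap K R) (kernelNum q m n)) =
      ∏ j : Fin n, ∏ i : Fin n, if i < j then
        ∏ t ∈ range (m i j), ((x j - algebraMap K R (q ^ t) * x i) *
          (x i - algebraMap K R (q ^ (t + 1)) * x j)) else 1 := by
  simp only [kernelNum, map_prod]
  refine prod_congr rfl fun j _ => prod_congr rfl fun i _ => ?_
  split_ifs <;> simp [pairNum, map_prod]

/-- The functional vanishes on a kernel numerator for which the deformed grid of points
`q^α` (with `1 - h ≤ α ≤ -A_i`) and `q^e τ` (with `e ∈ E_i`) supports no separated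
configuration. -/
lemma prodFun_kernelNum_eq_zero {q : K} (hq0 : q ≠ 0) (hq : ∀ m : ℕ, 0 < m → q ^ m ≠ 1) {n : ℕ}
    (m : ℕ → ℕ → ℕ) (A d : Fin n → ℕ) (h : ℕ) (E : Fin n → Finset ℤ)
    (hE : ∀ i, d i + 1 ≤ (E i).card + h)
    (H : ∀ (T : Finset (Fin n)) (α : Fin n → ℤ),
      (∀ i ∈ T, α i ∈ Icc (1 - (h : ℤ)) (-A i)) → (∀ i ∉ T, α i ∈ E i) →
      (∀ i j, i < j → (i ∈ T ↔ j ∈ T) → Sep (m i j) (α i) (α j)) → False) :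
    prodFun (fun i k => coeffFun q (A i) (q ^ (-h : ℤ)) ((k : ℤ) - d i)) (kernelNum q m n) = 0 := by
  classical
  have hmom : ∀ i k, momentFun (fun k => coeffFun q (A i) (q ^ (-h : ℤ)) ((k : ℤ) - d i))
      (Polynomial.X ^ k * (Polynomial.X ^ (E i).card * lowPoly q (A i) h)) = 0 := fun i k => by
    rw [← mul_assoc, ← pow_add]
    exact momentFun_coeffFun hq0 hq _ _ _ _ (by have := hE i; omega)
  set μ : Fin n → ℕ → K := fun i k => coeffFun q (A i) (q ^ (-h : ℤ)) ((k : ℤ) - d i) with hμ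
  have hmul := fun i => prodFun_mul_aeval μ i _ (hmom i)
  -- The grid lives over K[τ], with τ the polynomial variable. The annihilator X^{|E|}·`lowPoly` has
  -- a multiple root at 0, so that root is spread out to the simple roots q^e τ; they collapse again
  -- at τ = 0.
  set S₁ : Fin n → Finset (Polynomial K) := fun i =>
    (Icc (1 - (h : ℤ)) (-A i)).image fun α => q ^ α • (1 : Polynomial K) with hS₁
  set S₂ : Fin n → Finset (Polynomial K) := fun i =>
    (E i).image fun e => q ^ e • (Polynomial.X : Polynomial K) with hS₂
  have hinj : ∀ u : Polynomial K, u ≠ 0 → Function.Injective fun a : ℤ => q ^ a • u :=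
    fun u hu a b hab => zpow_injective hq0 hq (smul_left_injective K hu hab)
  have hdisj : ∀ i, Disjoint (S₁ i) (S₂ i) := fun i => by
    rw [disjoint_left]
    intro x h1 h2
    obtain ⟨a, -, rfl⟩ := mem_image.1 h1
    obtain ⟨b, -, hb⟩ := mem_image.1 h2
    have := congrArg (Polynomial.eval 0) hb
    simp only [Polynomial.eval_smul, Polynomial.eval_X, Polynomial.eval_one, smul_eq_mul,
      mul_zero, mul_one] at this
    exact zpow_ne_zero a hq0 this.symm
  have hprod : ∀ i, MvPolynomial.map (Polynomial.evalRingHom (0 : K))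
      (∏ s ∈ S₁ i ∪ S₂ i, (MvPolynomial.X i - MvPolynomial.C s)) =
        Polynomial.aeval (MvPolynomial.X i : MvPolynomial (Fin n) K)
          (Polynomial.X ^ (E i).card * lowPoly q (A i) h) := fun i => by
    rw [prod_union (hdisj i), hS₁, hS₂, prod_image (hinj _ one_ne_zero).injOn,
      prod_image (hinj _ Polynomial.X_ne_zero).injOn, map_mul, map_mul, map_pow, lowPoly]
    simp only [map_prod, map_sub, MvPolynomial.map_X, MvPolynomial.map_C, Polynomial.aeval_X,
      Polynomial.aeval_C, Polynomial.coe_evalRingHom, Polynomial.eval_smul, Polynomial.eval_X,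
      Polynomial.eval_one, smul_eq_mul, mul_zero, mul_one, map_zero, sub_zero, prod_const,
      MvPolynomial.algebraMap_eq]
    rw [mul_comm]
  by_cases hne : ∀ i, (S₁ i ∪ S₂ i).Nonempty
  · obtain ⟨g, -, hg⟩ := MvPolynomial.combinatorial_nullstellensatz_exists_linearCombination
      (fun i => S₁ i ∪ S₂ i) hne
      (MvPolynomial.map (algebraMap K (Polynomial K)) (kernelNum q m n)) (by
        intro x hx
        by_contra hne0
        rw [eval_map_kernelNum] at hne0
        have hne1 : ∀ i j : Fin n, i < j →
            ∏ t ∈ range (m i j), ((x j - algebraMap K _ (q ^ t) * x i) *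
              (x i - algebraMap K _ (q ^ (t + 1)) * x j)) ≠ 0 := fun i j hij => by
          have := prod_ne_zero_iff.1 (prod_ne_zero_iff.1 hne0 j (mem_univ _)) i (mem_univ _)
          rwa [if_pos hij] at this
        have hx' : ∀ i, ∃ a : ℤ,
            (x i ∈ S₁ i → a ∈ Icc (1 - (h : ℤ)) (-A i) ∧ q ^ a • (1 : Polynomial K) = x i) ∧
            (x i ∉ S₁ i → a ∈ E i ∧ q ^ a • (Polynomial.X : Polynomial K) = x i) := fun i => by
          by_cases h1 : x i ∈ S₁ i
          · obtain ⟨a, ha⟩ := mem_image.1 h1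
            exact ⟨a, fun _ => ha, fun h => absurd h1 h⟩
          · obtain ⟨a, ha⟩ := mem_image.1 ((mem_union.1 (hx i)).resolve_left h1)
            exact ⟨a, fun h => absurd h h1, fun _ => ha⟩
        choose α h1 h2 using hx'
        refine H (univ.filter fun i => x i ∈ S₁ i) α (fun i hi => (h1 i (mem_filter.1 hi).2).1)
          (fun i hi => (h2 i (by simpa using hi)).1) fun i j hij hT => ?_
        have h3 := hne1 i j hij
        simp only [mem_filter, mem_univ, true_and] at hT
        by_cases hi : x i ∈ S₁ i
        · rw [← (h1 i hi).2, ← (h1 j (hT.1 hi)).2] at h3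
          exact sep_of_prod_ne_zero hq0 _ _ _ _ h3
        · rw [← (h2 i hi).2, ← (h2 j (fun h => hi (hT.2 h))).2] at h3
          exact sep_of_prod_ne_zero hq0 _ _ _ _ h3)
    -- The numerator does not involve τ, so setting τ = 0 returns it, now written as a combination
    -- of the annihilators.
    have hF : kernelNum q m n = MvPolynomial.map (Polynomial.evalRingHom (0 : K))
        (MvPolynomial.map (algebraMap K (Polynomial K)) (kernelNum q m n)) := by
      rw [MvPolynomial.map_map]
      have : (Polynomial.evalRingHom (0 : K)).comp (algebraMap K (Polynomial K)) = RingHom.id K := by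
        ext x; simp
      rw [this, MvPolynomial.map_id]
    rw [hF, hg, Finsupp.linearCombination_apply, Finsupp.sum, map_sum, map_sum]
    refine sum_eq_zero fun i _ => ?_
    rw [smul_eq_mul, map_mul, hprod]
    exact hmul i _
  · push Not at hne
    obtain ⟨i, hi⟩ := hne
    rw [union_eq_empty, hS₁, hS₂, image_eq_empty, image_eq_empty] at hi
    -- With an empty set of points the annihilator in X_i is 1, and the functional is zero.
    have := hmul i (kernelNum q m n)
    rwa [lowPoly, hi.1, hi.2, card_empty, pow_zero, prod_empty, mul_one, map_one, mul_one] at this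

lemma eval_lastPoly_eq_zero {q : K} (hq0 : q ≠ 0) (hq : ∀ m : ℕ, 0 < m → q ^ m ≠ 1) (c : ℕ)
    (ε : ℕ → ℕ → ℕ) (n : ℕ) (A : ℕ → ℕ) (h : ℕ) (E : ℕ → Finset ℤ)
    (hE : ∀ i < n, kernelDeg (fun i j => c + ε i j) n i + 1 ≤ (E i).card + h)
    (H : ∀ (T : Finset (Fin n)) (α : Fin n → ℤ),
      (∀ i ∈ T, α i ∈ Icc (1 - (h : ℤ)) (-A i)) → (∀ i ∉ T, α i ∈ E i) →
      (∀ i j, i < j → (i ∈ T ↔ j ∈ T) → Sep (c + ε i j) (α i) (α j)) → False) :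
    (lastPoly q c ε n A).eval (q ^ (-h : ℤ)) = 0 := by
  rw [eval_lastPoly]
  exact prodFun_kernelNum_eq_zero hq0 hq (fun i j => c + ε i j) (fun i => A i) _ h (fun i => E i)
    (fun i => hE i i.2) H

end Grid

end BakerForrester

namespace BakerForrester

open Finset

/-! ### Separated exponents and the pigeonhole over slots. -/

section Chains

/-- A separated configuration of `N + 1` exponents, sorted: the pairs (level, colour) increase
lexicographically. -/
lemma exists_chain {n c N : ℕ} (hc : 1 ≤ c) {κ : ℕ → ℕ}
    (hκ : ∀ i j, i ≤ j → j < n → κ i ≤ κ j) {S : Finset (Fin n)} (hS : N + 1 ≤ S.card)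
    {α : Fin n → ℤ}
    (hsep : ∀ i j : Fin n, i < j → i ∈ S → j ∈ S → Sep (c + colEps κ i j) (α i) (α j)) :
    ∃ idx : Fin (N + 1) → Fin n, (∀ a, idx a ∈ S) ∧ Function.Injective idx ∧
      StrictMono fun a : Fin (N + 1) =>
        (toLex (α (idx a) - c * (a : ℕ), κ (idx a)) : ℤ ×ₗ ℕ) := by
  obtain ⟨S', hS', hcard⟩ := exists_subset_card_eq hS
  have hinj : Set.InjOn α S' := by
    intro i hi j hj hij
    by_contra hne
    rcases lt_or_gt_of_ne hne with h | h
    · have := hsep i j h (hS' hi) (hS' hj); rw [Sep] at this; omega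
    · have := hsep j i h (hS' hj) (hS' hi); rw [Sep] at this; omega
  have himg : (S'.image α).card = N + 1 := by rw [card_image_of_injOn hinj, hcard]
  have hex : ∀ a : Fin (N + 1), ∃ i ∈ S', α i = (S'.image α).orderEmbOfFin himg a := fun a =>
    mem_image.1 (orderEmbOfFin_mem _ himg a)
  choose idx hmem hidx using hex
  have hmono : StrictMono fun a => α (idx a) := by
    simp only [hidx]
    exact ((S'.image α).orderEmbOfFin himg).strictMono
  refine ⟨idx, fun a => hS' (hmem a), fun a b hab => hmono.injective (by simp only [hab]), ?_⟩
  rw [Fin.strictMono_iff_lt_succ]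
  intro a
  rw [Prod.Lex.toLex_lt_toLex]
  simp only [Fin.val_castSucc, Fin.val_succ, Nat.cast_add, Nat.cast_one]
  have h1 : α (idx a.castSucc) < α (idx a.succ) := hmono (Fin.castSucc_lt_succ)
  rw [mul_add, mul_one]
  have hne : idx a.castSucc ≠ idx a.succ := fun h => by rw [h] at h1; exact lt_irrefl _ h1
  -- If position and exponent increase together, the gap is at least c, and equal to c only when the
  -- colour increases strictly. If the positions are reversed, the gap exceeds c.
  rcases lt_or_gt_of_ne hne with h | h
  · have h2 := hsep _ _ h (hS' (hmem _)) (hS' (hmem _))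
    have h3 := hκ _ _ (Fin.le_iff_val_le_val.1 h.le) (idx a.succ).2
    rw [Sep, colEps] at h2
    split_ifs at h2 with h4
    · left; push_cast at h2; omega
    · push_cast at h2
      have h5 : κ (idx a.castSucc) < κ (idx a.succ) := lt_of_le_of_ne h3 h4
      rcases eq_or_lt_of_le (show α (idx a.castSucc) - c * (a : ℕ) ≤
        α (idx a.succ) - (c * (a : ℕ) + c) by omega) with h6 | h6
      · exact Or.inr ⟨h6, h5⟩
      · exact Or.inl h6
  · have h2 := hsep _ _ h (hS' (hmem _)) (hS' (hmem _))
    rw [Sep] at h2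
    left; push_cast at h2; omega

/-- The number of slots `(t, l)` with `l < p` and `t < min (ν l) y`. -/
def slotCount (ν : ℕ → ℕ) (p y : ℕ) : ℕ := ∑ l ∈ range p, min (ν l) y

/-- Within the colour l the chosen positions are distinct and so are their levels, which bounds
their number by ν_l and by W_l respectively. -/
lemma card_le_sum_min {n p N : ℕ} {κ ν W : ℕ → ℕ} (hp : ∀ i < n, κ i < p)
    (hν : ∀ l < p, #{i ∈ range n | κ i = l} = ν l) {idx : Fin N → Fin n}
    (hidx : Function.Injective idx) (t : Fin N → ℤ)
    (ht : ∀ a b, κ (idx a) = κ (idx b) → t a = t b → a = b) (ht0 : ∀ a, 0 ≤ t a)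
    (htW : ∀ a, t a < W (κ (idx a))) : N ≤ ∑ l ∈ range p, min (ν l) (W l) := by
  have h1 : N = ∑ l ∈ range p, #{a : Fin N | κ (idx a) = l} := by
    rw [← card_eq_sum_card_fiberwise (f := fun a => κ (idx a)) (t := range p), card_univ,
      Fintype.card_fin]
    exact fun a _ => mem_coe.2 (mem_range.2 (hp _ (idx a).2))
  refine h1.trans_le (sum_le_sum fun l hl => le_min ?_ ?_)
  · rw [← hν l (mem_range.1 hl)]
    refine card_le_card_of_injOn (fun a => (idx a : ℕ)) (fun a ha => ?_)
      fun a _ b _ hab => hidx (Fin.ext hab)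
    have := (mem_filter.1 (mem_coe.1 ha)).2
    simpa using this
  · rw [← card_range (W l)]
    refine card_le_card_of_injOn (fun a => (t a).toNat) (fun a ha => ?_) fun a ha b hb hab => ?_
    · have := (mem_filter.1 (mem_coe.1 ha)).2
      have h2 := htW a
      rw [this] at h2
      have h3 := ht0 a
      simp only [coe_range, Set.mem_Iio]
      omega
    · have h2 := (mem_filter.1 (mem_coe.1 ha)).2
      have h3 := (mem_filter.1 (mem_coe.1 hb)).2
      have h4 := ht0 a
      have h5 := ht0 b
      have h6 : (t a).toNat = (t b).toNat := hab
      exact ht a b (h2.trans h3.symm) (by omega)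

/-- Few separated exponents fit between `1 - h` and `-A_i`. -/
lemma not_chain_low {n p c r y A k : ℕ} {κ ν : ℕ → ℕ} (hp : ∀ i < n, κ i < p)
    (hν : ∀ l < p, #{i ∈ range n | κ i = l} = ν l) (hk : ∀ i < n, κ i ≤ k)
    (hlow : ∑ l ∈ range p, min (ν l) (y - A - if l = k then 1 else 0) ≤ r)
    {idx : Fin (r + 1) → Fin n} (hidx : Function.Injective idx) {α : Fin n → ℤ}
    (hmono : StrictMono fun a : Fin (r + 1) =>
        (toLex (α (idx a) - c * (a : ℕ), κ (idx a)) : ℤ ×ₗ ℕ))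
    (hα : ∀ a, α (idx a) ∈ Icc (1 - ((r * c + y : ℕ) : ℤ))
      (-((A + if κ (idx a) = k then 1 else 0 : ℕ) : ℤ))) : False := by
  have hle : ∀ a b : Fin (r + 1), a ≤ b → α (idx a) - c * (a : ℕ) ≤ α (idx b) - c * (b : ℕ) := by
    intro a b hab
    have := (Prod.Lex.toLex_le_toLex.1 (hmono.monotone hab))
    rcases this with h | h
    · exact h.le
    · exact h.1.le
  have hlast := (mem_Icc.1 (hα (Fin.last r))).2
  have hfirst := (mem_Icc.1 (hα 0)).1
  have hr : ((c : ℤ) * (r : ℕ)) = ((r * c : ℕ) : ℤ) := by push_cast; ring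
  -- The level of the a-th exponent is α - ca, normalised so that the smallest admissible value
  -- becomes 0. Levels weakly increase, so the first and last exponents control all of them.
  refine absurd (card_le_sum_min (W := fun l => y - A - if l = k then 1 else 0) hp hν hidx
    (fun a => α (idx a) - c * (a : ℕ) + ((r * c + y : ℕ) : ℤ) - 1) ?_ ?_ ?_) (by omega)
  · intro a b h1 h2
    have h3 : α (idx a) - c * (a : ℕ) = α (idx b) - c * (b : ℕ) := by linarith
    exact hmono.injective (toLex.injective (Prod.ext h3 h1))
  · intro a
    have := hle 0 a (Fin.zero_le a)
    simp only [Fin.val_zero, Nat.cast_zero, mul_zero, sub_zero] at this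
    omega
  · intro a
    have h1 := hle a _ (Fin.le_last a)
    have h2 := hk _ (idx (Fin.last r)).2
    rw [Fin.val_last, hr] at h1
    by_cases h3 : κ (idx (Fin.last r)) = k
    · rw [if_pos h3] at hlast
      have h4 : (if κ (idx a) = k then 1 else 0) ≤ 1 := by split_ifs <;> simp
      omega
    · rw [if_neg h3] at hlast
      by_cases h4 : κ (idx a) = k
      · rw [if_pos h4]
        -- An element of colour k is subject to a bound one lower. If the last element has another
        -- colour, its colour is smaller than k, so the lexicographic order forces its level to be
        -- strictly larger.
        have h5 : a < Fin.last r := lt_of_le_of_ne (Fin.le_last a) fun h => h3 (by rw [← h, h4])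
        rcases Prod.Lex.toLex_lt_toLex.1 (hmono h5) with h6 | h6
        · have h7 : α (idx a) - c * (a : ℕ) < α (idx (Fin.last r)) - c * (r : ℕ) := h6
          omega
        · have h7 : κ (idx a) < κ (idx (Fin.last r)) := h6.2
          omega
      · rw [if_neg h4]
        omega

/-- The slots `(t, l)` with `l < p` and `t < m l`. -/
def slots (m : ℕ → ℕ) (p : ℕ) : Finset (ℤ ×ₗ ℕ) :=
  (range p).biUnion fun l => (range (m l)).image fun t : ℕ => toLex ((t : ℤ), l)

lemma mem_slots {m : ℕ → ℕ} {p : ℕ} {t : ℤ} {l : ℕ} :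
    toLex (t, l) ∈ slots m p ↔ l < p ∧ 0 ≤ t ∧ t < m l := by
  simp only [slots, mem_biUnion, mem_range, mem_image, EmbeddingLike.apply_eq_iff_eq, Prod.mk.injEq]
  constructor
  · rintro ⟨l', h1, t', h2, h3, rfl⟩
    omega
  · rintro ⟨h1, h2, h3⟩
    exact ⟨l, h1, t.toNat, by omega, by omega, rfl⟩

lemma card_slots_le (m : ℕ → ℕ) (p : ℕ) : (slots m p).card ≤ ∑ l ∈ range p, m l :=
  card_biUnion_le.trans (sum_le_sum fun _ _ => card_image_le.trans (card_range _).le)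

/-- The exponents available to the colour `l`, with one gap for each slot missing up to
the level `M`. -/
noncomputable def highSet (m : ℕ → ℕ) (p c N M l : ℕ) : Finset ℤ :=
  Ico (0 : ℤ) (N * c + M : ℕ) \ (Ico (m l) M).image fun t : ℕ =>
    ((#{s ∈ slots m p | s < toLex ((t : ℤ), l)} * c + t : ℕ) : ℤ)

lemma card_highSet (m : ℕ → ℕ) (p c N M l : ℕ) (hM : m l ≤ M) :
    N * c + m l ≤ (highSet m p c N M l).card := by
  refine le_trans ?_ (le_card_sdiff _ _)
  have : ((Ico (m l) M).image fun t : ℕ =>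
    ((#{s ∈ slots m p | s < toLex ((t : ℤ), l)} * c + t : ℕ) : ℤ)).card ≤ M - m l :=
    card_image_le.trans (Nat.card_Ico _ _).le
  rw [Int.card_Ico, sub_zero, Int.toNat_natCast]
  omega

/-- Few separated exponents fit into the sets `highSet`. -/
lemma not_chain_high {n p c N M : ℕ} {κ m : ℕ → ℕ} (hp : ∀ i < n, κ i < p)
    (hm : ∑ l ∈ range p, m l ≤ N) {idx : Fin (N + 1) → Fin n} {α : Fin n → ℤ}
    (hmono : StrictMono fun a : Fin (N + 1) =>
        (toLex (α (idx a) - c * (a : ℕ), κ (idx a)) : ℤ ×ₗ ℕ))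
    (hα : ∀ a, α (idx a) ∈ highSet m p c N M (κ (idx a))) : False := by
  set s : Fin (N + 1) → ℤ ×ₗ ℕ := fun a => toLex (α (idx a) - c * (a : ℕ), κ (idx a)) with hs
  have hle : ∀ a b : Fin (N + 1), a ≤ b → α (idx a) - c * (a : ℕ) ≤ α (idx b) - c * (b : ℕ) := by
    intro a b hab
    rcases (Prod.Lex.toLex_le_toLex.1 (hmono.monotone hab)) with h | h
    · exact h.le
    · exact h.1.le
  have hfirst := (mem_Ico.1 (mem_sdiff.1 (hα 0)).1).1
  have hlast := (mem_Ico.1 (mem_sdiff.1 (hα (Fin.last N))).1).2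
  -- The chain always consumes slots. If the a-th pair is a slot, it adds itself to those before it.
  -- Otherwise having exactly a slots before it would give precisely an exponent removed from
  -- `highSet`, so there are more than a of them.
  have hstep : ∀ a : Fin (N + 1), (a : ℕ) ≤ #{x ∈ slots m p | x < s a} →
      (a : ℕ) + 1 ≤ #{x ∈ slots m p | x ≤ s a} := by
    intro a ha
    by_cases hmem : s a ∈ slots m p
    · refine Nat.succ_le_of_lt (ha.trans_lt (card_lt_card ?_))
      refine (ssubset_iff_of_subset fun x hx => ?_).2 ⟨s a, ?_, ?_⟩
      · rw [mem_filter] at hx ⊢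
        exact ⟨hx.1, hx.2.le⟩
      · exact mem_filter.2 ⟨hmem, le_rfl⟩
      · simp
    · refine Nat.succ_le_of_lt ((lt_of_le_of_ne ha fun heq => ?_).trans_le
        (card_le_card fun x hx => ?_))
      · have h0 := hle 0 a (Fin.zero_le a)
        have h1 := hle a _ (Fin.le_last a)
        simp only [Fin.val_zero, Nat.cast_zero, mul_zero, sub_zero] at h0
        rw [Fin.val_last] at h1
        push_cast at hlast
        rw [mul_comm (N : ℤ)] at hlast
        have h2 : ¬ (α (idx a) - c * (a : ℕ) < m (κ (idx a))) := fun h =>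
          hmem (mem_slots.2 ⟨hp _ (idx a).2, by omega, h⟩)
        obtain ⟨t, ht⟩ := Int.eq_ofNat_of_zero_le (show 0 ≤ α (idx a) - c * (a : ℕ) by omega)
        refine (mem_sdiff.1 (hα a)).2 (mem_image.2 ⟨t, mem_Ico.2 ⟨by omega, by omega⟩, ?_⟩)
        rw [← ht]
        change ((#{x ∈ slots m p | x < s a} * c + t : ℕ) : ℤ) = _
        rw [← heq]
        push_cast
        rw [← ht]
        ring
      · rw [mem_filter] at hx ⊢
        exact ⟨hx.1, hx.2.le⟩
  have hall : ∀ (b : ℕ) (hb : b < N + 1), b + 1 ≤ #{x ∈ slots m p | x ≤ s ⟨b, hb⟩} := by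
    intro b
    induction b with
    | zero => exact fun hb => hstep ⟨0, hb⟩ (Nat.zero_le _)
    | succ b ih =>
      intro hb
      refine hstep ⟨b + 1, hb⟩ ((ih (by omega)).trans (card_le_card fun x hx => ?_))
      rw [mem_filter] at hx ⊢
      exact ⟨hx.1, hx.2.trans_lt (hmono (Fin.mk_lt_mk.2 b.lt_succ_self))⟩
  have h1 := hall N N.lt_succ_self
  have h2 := (card_filter_le (slots m p) fun x => x ≤ s ⟨N, N.lt_succ_self⟩).trans
    (card_slots_le m p)
  omega

lemma kernelDeg_colEps {n p c : ℕ} {κ ν : ℕ → ℕ} (hp : ∀ i < n, κ i < p)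
    (hν : ∀ l < p, #{i ∈ range n | κ i = l} = ν l) {i : ℕ} (hi : i < n) :
    kernelDeg (fun i j => c + colEps κ i j) n i + 1 = (n - 1) * c + ν (κ i) := by
  have h1 : kernelDeg (fun i j => c + colEps κ i j) n i =
      ∑ j ∈ (range n).erase i, (c + colEps κ i j) := by
    rw [kernelDeg, ← sum_erase_add _ _ (mem_range.2 hi), if_pos rfl, add_zero]
    exact sum_congr rfl fun j hj => if_neg (ne_of_mem_erase hj)
  have h2 : ∑ j ∈ (range n).erase i, colEps κ i j + 1 = ν (κ i) := by
    rw [← hν _ (hp i hi), card_filter, ← sum_erase_add _ _ (mem_range.2 hi), if_pos rfl]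
    congr 1
    exact sum_congr rfl fun j _ => by rw [colEps]; simp only [eq_comm]
  rw [h1, sum_add_distrib, sum_const, card_erase_of_mem (mem_range.2 hi), card_range, smul_eq_mul]
  omega

variable {K : Type*} [Field K]

/-- The zeros of the constant term as a polynomial in `q^B`. -/
lemma eval_lastPoly_colEps_eq_zero {q : K} (hq0 : q ≠ 0) (hq : ∀ m : ℕ, 0 < m → q ^ m ≠ 1)
    {n p c r y A k : ℕ} (hc : 1 ≤ c) {κ ν : ℕ → ℕ} (hκ : ∀ i j, i ≤ j → j < n → κ i ≤ κ j)
    (hp : ∀ i < n, κ i < p) (hν : ∀ l < p, #{i ∈ range n | κ i = l} = ν l)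
    (hk : ∀ i < n, κ i ≤ k) (hr : r < n)
    (hlow : ∑ l ∈ range p, min (ν l) (y - A - if l = k then 1 else 0) ≤ r)
    (hhigh : r < slotCount ν p y) :
    (lastPoly q c (colEps κ) n fun i => A + if κ i = k then 1 else 0).eval
      (q ^ (-(r * c + y : ℕ) : ℤ)) = 0 := by
  obtain ⟨N, rfl⟩ : ∃ N, n = r + (N + 1) := ⟨n - r - 1, by omega⟩
  -- These are the parts of the columns above level y. Since more than r cells lie below that level,
  -- at most N = n - r - 1 lie above it.
  set m : ℕ → ℕ := fun l => ν l - y with hm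
  have hsum : ∑ l ∈ range p, ν l = r + (N + 1) := by
    rw [← sum_congr rfl fun l hl => hν l (mem_range.1 hl),
      ← card_eq_sum_card_fiberwise (f := κ) (t := range p), card_range]
    exact fun i hi => mem_coe.2 (mem_range.2 (hp i (mem_range.1 (mem_coe.1 hi))))
  have hmN : ∑ l ∈ range p, m l ≤ N := by
    have : slotCount ν p y + ∑ l ∈ range p, m l = r + (N + 1) := by
      rw [slotCount, ← sum_add_distrib, ← hsum]
      exact sum_congr rfl fun l _ => by simp only [hm]; omega
    omega
  refine eval_lastPoly_eq_zero hq0 hq c _ _ _ _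
    (fun i => highSet m p c N (∑ l ∈ range p, m l) (κ i)) (fun i hi => ?_) fun T α h1 h2 h3 => ?_
  · rw [kernelDeg_colEps hp hν hi]
    have := card_highSet m p c N (∑ l ∈ range p, m l) (κ i)
      (single_le_sum (f := m) (fun l _ => Nat.zero_le _) (mem_range.2 (hp i hi)))
    have e : (r + (N + 1) - 1) * c = r * c + N * c := by
      rw [show r + (N + 1) - 1 = r + N by omega, add_mul]
    have : m (κ i) = ν (κ i) - y := rfl
    omega
  -- Of the n variables either r + 1 take low points or n - r take high points; both are impossible.
  · by_cases hT : r + 1 ≤ T.card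
    · obtain ⟨idx, h4, h5, h6⟩ := exists_chain (α := α) hc hκ hT
        (fun i j hij hi hj => h3 i j hij (by simp [hi, hj]))
      exact not_chain_low hp hν hk hlow h5 h6 fun a => h1 _ (h4 a)
    · have hT' : N + 1 ≤ Tᶜ.card := by
        rw [card_compl, Fintype.card_fin]; omega
      obtain ⟨idx, h4, -, h6⟩ := exists_chain (α := α) hc hκ hT'
        (fun i j hij hi hj => h3 i j hij (by simp [mem_compl.1 hi, mem_compl.1 hj]))
      exact not_chain_high hp hmN h6 fun a => h2 _ (mem_compl.1 (h4 a))

end Chains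

end BakerForrester

namespace BakerForrester

open Finset

/-! ### Product formulas from zeros and the value at 1. -/

section Products

variable {K : Type*} [Field K]

lemma pow_injective_of_ne_one {q : K} (hq0 : q ≠ 0) (hq : ∀ m : ℕ, 0 < m → q ^ m ≠ 1) :
    Function.Injective fun a : ℕ => q ^ a := fun a b h => by
  have := zpow_injective hq0 hq (a₁ := (a : ℤ)) (a₂ := b) (by simpa using h)
  exact_mod_cast this

lemma eval_lastPoly_one {q : K} (hq0 : q ≠ 0) (hq : ∀ m : ℕ, 0 < m → q ^ m ≠ 1) (c : ℕ)
    (ε : ℕ → ℕ → ℕ) (hε : ∀ i j, ε i j = ε j i) (n : ℕ) (A : ℕ → ℕ) :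
    (lastPoly q c ε n A).eval 1 = ct (kernel q c ε n) := by
  rw [← ctLast_zero hq0 hq c ε hε n A, ← eval_lastPoly_pow hq0 hq c ε hε, pow_zero]

/-- Both sides are polynomials in Y of degree at most |s| which agree at the |s| distinct zeros and
at Y = 1. Positivity of the exponents keeps 1 away from the zeros. -/
lemma eval_mul_prod_eq {ι : Type*} {q : K} (hq0 : q ≠ 0) (hq : ∀ m : ℕ, 0 < m → q ^ m ≠ 1)
    (Φ : Polynomial K) (s : Finset ι) (f : ι → ℕ) (hf : Set.InjOn f s) (hf0 : ∀ i ∈ s, 1 ≤ f i)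
    (hdeg : Φ.natDegree ≤ s.card) (hz : ∀ i ∈ s, Φ.eval (q ^ (-f i : ℤ)) = 0) (Y : K) :
    Φ.eval Y * ∏ i ∈ s, (1 - q ^ f i) = Φ.eval 1 * ∏ i ∈ s, (1 - q ^ f i * Y) := by
  classical
  set Ψ : Polynomial K := Polynomial.C (∏ i ∈ s, (1 - q ^ f i)) * Φ -
    Polynomial.C (Φ.eval 1) * ∏ i ∈ s, (1 - Polynomial.C (q ^ f i) * Polynomial.X) with hΨ
  have heval : ∀ y, Ψ.eval y = (∏ i ∈ s, (1 - q ^ f i)) * Φ.eval y -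
      Φ.eval 1 * ∏ i ∈ s, (1 - q ^ f i * y) := fun y => by
    simp [hΨ, Polynomial.eval_prod]
  have hinj := zpow_injective hq0 hq
  set P : Finset K := insert 1 (s.image fun i => q ^ (-f i : ℤ)) with hP
  have hcard : P.card = s.card + 1 := by
    rw [hP, card_insert_of_notMem, card_image_of_injOn]
    · intro i hi j hj hij
      have := hinj hij
      exact hf hi hj (by omega)
    · intro h
      obtain ⟨i, hi, h1⟩ := mem_image.1 h
      have := hinj (h1.trans (zpow_zero q).symm)
      have := hf0 i hi
      omega
  have hfac : ∀ i ∈ s, (1 - Polynomial.C (q ^ f i) * Polynomial.X).natDegree ≤ 1 := fun i _ => by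
    refine (Polynomial.natDegree_sub_le _ _).trans (max_le (by simp) ?_)
    exact (Polynomial.natDegree_C_mul_le _ _).trans Polynomial.natDegree_X_le
  have hprod : (∏ i ∈ s, (1 - Polynomial.C (q ^ f i) * Polynomial.X)).natDegree ≤ s.card :=
    (Polynomial.natDegree_prod_le _ _).trans
      ((sum_le_card_nsmul _ _ 1 hfac).trans (by rw [smul_eq_mul, mul_one]))
  have hdegΨ : Ψ.natDegree ≤ s.card :=
    (Polynomial.natDegree_sub_le _ _).trans (max_le
      ((Polynomial.natDegree_C_mul_le _ _).trans hdeg)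
      ((Polynomial.natDegree_C_mul_le _ _).trans hprod))
  have h0 : Ψ = 0 := by
    refine Polynomial.eq_zero_of_natDegree_lt_card_of_eval_eq_zero' Ψ P (fun x hx => ?_)
      (by omega)
    rw [heval]
    rcases mem_insert.1 hx with rfl | hx
    · simp only [mul_one]; ring
    · obtain ⟨i, hi, rfl⟩ := mem_image.1 hx
      have h1 : 1 - q ^ f i * q ^ (-f i : ℤ) = 0 := by
        rw [← zpow_natCast, ← zpow_add₀ hq0, add_neg_cancel, zpow_zero, sub_self]
      rw [hz i hi, mul_zero, zero_sub, neg_eq_zero, prod_eq_zero hi h1, mul_zero]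
  have := heval Y
  rw [h0, Polynomial.eval_zero] at this
  linear_combination -this

/-- The least `y` for which there are more than `r` slots below the level `y`. -/
noncomputable def slotLevel (ν : ℕ → ℕ) (p r : ℕ) : ℕ := sInf {y | r < slotCount ν p y}

lemma slotCount_mono (ν : ℕ → ℕ) (p : ℕ) : Monotone (slotCount ν p) := fun _ _ h =>
  sum_le_sum fun _ _ => min_le_min le_rfl h

lemma slotCount_of_le {ν : ℕ → ℕ} {p y : ℕ} (h : ∀ l < p, ν l ≤ y) :
    slotCount ν p y = ∑ l ∈ range p, ν l :=
  sum_congr rfl fun l hl => min_eq_left (h l (mem_range.1 hl))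

lemma lt_slotCount {ν : ℕ → ℕ} {p r y : ℕ} (hr : r < ∑ l ∈ range p, ν l)
    (hy : slotLevel ν p r ≤ y) : r < slotCount ν p y := by
  have h : ({y | r < slotCount ν p y} : Set ℕ).Nonempty :=
    ⟨∑ l ∈ range p, ν l, by
      rw [Set.mem_ofPred_eq, slotCount_of_le]
      · exact hr
      · exact fun l hl => single_le_sum (f := ν) (fun _ _ => Nat.zero_le _) (mem_range.2 hl)⟩
  have h1 : r < slotCount ν p (slotLevel ν p r) := Nat.sInf_mem h
  exact h1.trans_le (slotCount_mono ν p hy)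

lemma slotCount_le_of_lt {ν : ℕ → ℕ} {p r y : ℕ} (hy : y < slotLevel ν p r) :
    slotCount ν p y ≤ r := by
  have := Nat.notMem_of_lt_sInf (s := {y | r < slotCount ν p y}) hy
  exact not_lt.1 this

lemma slotLevel_le {ν : ℕ → ℕ} {p r y : ℕ} (hy : r < slotCount ν p y) : slotLevel ν p r ≤ y :=
  Nat.sInf_le hy

lemma slotLevel_pos {ν : ℕ → ℕ} {p r : ℕ} (hr : r < ∑ l ∈ range p, ν l) :
    1 ≤ slotLevel ν p r := by
  by_contra h
  have := lt_slotCount hr (y := 0) (by omega)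
  simp [slotCount] at this

lemma slotLevel_mono {ν : ℕ → ℕ} {p r s : ℕ} (hs : s < ∑ l ∈ range p, ν l) (h : r ≤ s) :
    slotLevel ν p r ≤ slotLevel ν p s :=
  slotLevel_le (h.trans_lt (lt_slotCount hs le_rfl))

lemma sum_cells {n p : ℕ} {κ ν : ℕ → ℕ} (hp : ∀ i < n, κ i < p)
    (hν : ∀ l < p, #{i ∈ range n | κ i = l} = ν l) : ∑ l ∈ range p, ν l = n := by
  rw [← sum_congr rfl fun l hl => hν l (mem_range.1 hl),
    ← card_eq_sum_card_fiberwise (f := κ) (t := range p), card_range]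
  exact fun i hi => mem_coe.2 (mem_range.2 (hp i (mem_range.1 (mem_coe.1 hi))))

lemma colEps_comm (κ : ℕ → ℕ) (i j : ℕ) : colEps κ i j = colEps κ j i := by
  simp only [colEps, eq_comm]

/-- The dependence on `B` for `1 ≤ c` and equal exponents `A_i = b ≤ c`. -/
lemma ctLast_mul_prod_eq {q : K} (hq0 : q ≠ 0) (hq : ∀ m : ℕ, 0 < m → q ^ m ≠ 1)
    {n p c b : ℕ} (hc : 1 ≤ c) (hb : b ≤ c) {κ ν : ℕ → ℕ}
    (hκ : ∀ i j, i ≤ j → j < n → κ i ≤ κ j)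
    (hp : ∀ i < n, κ i < p) (hν : ∀ l < p, #{i ∈ range n | κ i = l} = ν l) (a : ℕ) :
    ctLast q c (colEps κ) n (fun _ => b) a *
        ∏ r ∈ range n, qPoch q (q ^ (r * c + slotLevel ν p r)) b =
      ctKernel q c κ n * ∏ r ∈ range n, qPoch q (q ^ (a + r * c + slotLevel ν p r)) b := by
  have hsum := sum_cells hp hν
  -- The colour p does not occur, so the correction for a distinguished colour is void.
  set A : ℕ → ℕ := fun i => b + if κ i = p then 1 else 0 with hA
  have hA' : ∀ i < n, A i = b := fun i hi => by
    have := hp i hi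
    rw [hA]; simp only; rw [if_neg (by omega), add_zero]
  have hlast : ctLast q c (colEps κ) n (fun _ => b) a = ctLast q c (colEps κ) n A a := by
    rw [ctLast, ctLast]
    congr 2
    exact prod_congr rfl fun i hi => by rw [hA' i (mem_range.1 hi)]
  have h := eval_mul_prod_eq hq0 hq (lastPoly q c (colEps κ) n A) (range n ×ˢ range b)
    (fun x => x.1 * c + slotLevel ν p x.1 + x.2) ?_ ?_ ?_ ?_ (q ^ a)
  · rw [eval_lastPoly_pow hq0 hq c _ (colEps_comm κ), eval_lastPoly_one hq0 hq c _ (colEps_comm κ),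
      ← hlast, prod_product, prod_product] at h
    have e1 : ∏ r ∈ range n, qPoch q (q ^ (r * c + slotLevel ν p r)) b =
        ∏ r ∈ range n, ∏ j ∈ range b, (1 - q ^ (r * c + slotLevel ν p r + j)) :=
      prod_congr rfl fun r _ => prod_congr rfl fun j _ => by
        rw [smul_eq_mul, ← pow_add, add_comm j]
    have e2 : ∏ r ∈ range n, qPoch q (q ^ (a + r * c + slotLevel ν p r)) b =
        ∏ r ∈ range n, ∏ j ∈ range b, (1 - q ^ (r * c + slotLevel ν p r + j) * q ^ a) :=
      prod_congr rfl fun r _ => prod_congr rfl fun j _ => by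
        rw [smul_eq_mul, ← pow_add, ← pow_add]
        congr 2
        ring
    rw [e1, e2]
    exact h
  -- The b consecutive zeros attached to r end before those attached to r + 1 begin, because b ≤ c.
  · have key : ∀ r r' j j' : ℕ, r < r' → r' < n → j < b → 
        r * c + slotLevel ν p r + j < r' * c + slotLevel ν p r' + j' := fun r r' j j' h1 h2 h3 => by
      have h4 := slotLevel_mono (ν := ν) (p := p) (by rw [hsum]; exact h2) h1.le
      have h5 : (r + 1) * c ≤ r' * c := Nat.mul_le_mul_right c h1
      rw [add_mul, one_mul] at h5
      omega
    rintro ⟨r, j⟩ h1 ⟨r', j'⟩ h2 h3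
    simp only [coe_product, coe_range, Set.mem_prod, Set.mem_Iio] at h1 h2 h3
    rcases lt_trichotomy r r' with h4 | rfl | h4
    · have := key r r' j j' h4 h2.1 h1.2; omega
    · exact Prod.ext rfl (by simp only; omega)
    · have := key r' r j' j h4 h1.1 h2.2; omega
  · rintro ⟨r, j⟩ h1
    simp only [mem_product, mem_range] at h1
    have := slotLevel_pos (ν := ν) (p := p) (by rw [hsum]; exact h1.1)
    simp only
    omega
  · refine (natDegree_lastPoly_le q c _ (colEps_comm κ) n A).trans ?_
    rw [sum_congr rfl fun i hi => hA' i (mem_range.1 hi)]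
    simp
  · rintro ⟨r, j⟩ h1
    simp only [mem_product, mem_range] at h1
    have h2 := slotLevel_pos (ν := ν) (p := p) (by rw [hsum]; exact h1.1)
    have h3 : slotLevel ν p r + j - b < slotLevel ν p r := by omega
    simp only [add_assoc]
    refine eval_lastPoly_colEps_eq_zero hq0 hq hc hκ hp hν (fun i hi => (hp i hi).le) h1.1 ?_
      (lt_slotCount (by rw [hsum]; exact h1.1) (Nat.le_add_right _ _))
    refine le_trans (le_of_eq ?_) (slotCount_le_of_lt (ν := ν) (p := p) h3)
    refine sum_congr rfl fun l hl => ?_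
    rw [if_neg (by have := mem_range.1 hl; omega), Nat.sub_zero]

lemma exists_between_succ {g : ℕ → ℕ} {n h : ℕ} (h0 : g 0 ≤ h) (hn : h < g n) :
    ∃ r < n, g r ≤ h ∧ h < g (r + 1) := by
  induction n with
  | zero => omega
  | succ n ih =>
    by_cases h1 : h < g n
    · obtain ⟨r, h2, h3⟩ := ih h1
      exact ⟨r, h2.trans n.lt_succ_self, h3⟩
    · exact ⟨n, n.lt_succ_self, not_lt.1 h1, hn⟩

/-- The case `A_i = c + [κ i = k]`, `B = c`, where `k` is the last colour and becomes the most
frequent one when one more element is added to it. -/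
lemma ctLast_last_mul_eq {q : K} (hq0 : q ≠ 0) (hq : ∀ m : ℕ, 0 < m → q ^ m ≠ 1)
    {n p c k : ℕ} (hc : 1 ≤ c) {κ ν : ℕ → ℕ} (hκ : ∀ i j, i ≤ j → j < n → κ i ≤ κ j)
    (hp : ∀ i < n, κ i < p) (hν : ∀ l < p, #{i ∈ range n | κ i = l} = ν l)
    (hk : ∀ i < n, κ i ≤ k) (hkp : k < p) (hmax : ∀ l < p, ν l ≤ ν k + 1) :
    ctLast q c (colEps κ) n (fun i => c + if κ i = k then 1 else 0) c * qPoch q q c =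
      ctKernel q c κ n * qPoch q (q ^ (n * c + ν k + 1)) c := by
  have hsum := sum_cells hp hν
  -- The sizes after one element is added to the last colour. Their levels run from 1 at r = 0 to
  -- ν_k + 1 at r = n, so the intervals from rc + y_r to (r+1)c + y_{r+1} cover all of 1, …, nc +
  -- ν_k.
  set ν' : ℕ → ℕ := fun l => ν l + if l = k then 1 else 0 with hν'
  have hν'k : ν' k = ν k + 1 := by simp [hν']
  have hmax' : ∀ l < p, ν' l ≤ ν k + 1 := fun l hl => by
    by_cases h : l = k
    · rw [h, hν'k]
    · simpa [hν', h] using hmax l hl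
  have hsum' : ∑ l ∈ range p, ν' l = n + 1 := by
    rw [hν', sum_add_distrib, hsum, sum_ite_eq', if_pos (mem_range.2 hkp)]
  have hl0 : slotLevel ν' p 0 = 1 := by
    refine le_antisymm (slotLevel_le ?_) (slotLevel_pos (by omega))
    refine Nat.lt_of_lt_of_le ?_ (single_le_sum (f := fun l => min (ν' l) 1)
      (fun _ _ => Nat.zero_le _) (mem_range.2 hkp))
    simp only [hν'k]
    omega
  have hln : slotLevel ν' p n = ν k + 1 := by
    refine le_antisymm (slotLevel_le ?_) ?_
    · rw [slotCount_of_le hmax', hsum']; omega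
    · by_contra h
      have h1 := lt_slotCount (ν := ν') (p := p) (r := n) (y := ν k) (by omega) (by omega)
      have h2 : slotCount ν' p (ν k) < ∑ l ∈ range p, ν' l := by
        refine sum_lt_sum (fun l _ => min_le_left _ _) ⟨k, mem_range.2 hkp, ?_⟩
        rw [hν'k]; omega
      omega
  have hz : ∀ h ∈ Icc 1 (n * c + ν k),
      (lastPoly q c (colEps κ) n fun i => c + if κ i = k then 1 else 0).eval
        (q ^ (-(h : ℕ) : ℤ)) = 0 := by
    intro h hh
    rw [mem_Icc] at hh
    obtain ⟨r, hr, h1, h2⟩ := exists_between_succ (g := fun r => r * c + slotLevel ν' p r)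
      (n := n) (h := h) (by simp only [hl0]; omega) (by simp only [hln]; omega)
    simp only [add_mul, one_mul] at h2
    obtain ⟨y, rfl⟩ : ∃ y, h = r * c + y := ⟨h - r * c, by omega⟩
    refine eval_lastPoly_colEps_eq_zero hq0 hq hc hκ hp hν hk hr ?_ ?_
    · by_cases hy : y ≤ c
      · rw [Nat.sub_eq_zero_of_le hy]
        simp
      · have h3 := slotCount_le_of_lt (ν := ν') (p := p) (r := r + 1) (y := y - c) (by omega)
        have h4 : slotCount ν' p (y - c) =
            ∑ l ∈ range p, (min (ν l) (y - c - if l = k then 1 else 0) + if l = k then 1 else 0) := by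
          refine sum_congr rfl fun l _ => ?_
          simp only [hν']
          split_ifs <;> omega
        rw [sum_add_distrib, sum_ite_eq', if_pos (mem_range.2 hkp)] at h4
        omega
    · have h3 := lt_slotCount (ν := ν') (p := p) (r := r) (y := y) (by omega) (by omega)
      by_cases hy : ν k + 1 ≤ y
      · rwa [slotCount_of_le fun l hl => (hmax l hl).trans hy, hsum]
      · refine h3.trans_le (le_of_eq (sum_congr rfl fun l _ => ?_))
        by_cases h : l = k
        · rw [h, hν'k]; omega
        · simp [hν', h]
  have h := eval_mul_prod_eq hq0 hq (lastPoly q c (colEps κ) n fun i => c + if κ i = k then 1 else 0)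
    (Icc 1 (n * c + ν k)) id Function.injective_id.injOn (fun i hi => (mem_Icc.1 hi).1) ?_ hz
    (q ^ c)
  · rw [eval_lastPoly_pow hq0 hq c _ (colEps_comm κ), eval_lastPoly_one hq0 hq c _ (colEps_comm κ)] at h
    have e1 : ∏ i ∈ Icc 1 (n * c + ν k), (1 - q ^ id i) = qPoch q q (n * c + ν k) := by
      rw [← Ico_succ_right_eq_Icc, Nat.succ_eq_succ, Nat.succ_eq_add_one, prod_Ico_eq_prod_range,
        qPoch]
      refine prod_congr (by simp) fun j _ => ?_
      rw [smul_eq_mul, ← pow_succ, id, add_comm]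
    have e2 : ∏ i ∈ Icc 1 (n * c + ν k), (1 - q ^ id i * q ^ c) =
        qPoch q (q ^ c • q) (n * c + ν k) := by
      rw [← Ico_succ_right_eq_Icc, Nat.succ_eq_succ, Nat.succ_eq_add_one, prod_Ico_eq_prod_range,
        qPoch]
      refine prod_congr (by simp) fun j _ => ?_
      rw [smul_eq_mul, smul_eq_mul, id]
      congr 1
      ring
    -- Splitting (q)_{M+c} in two ways, with M = nc + ν_k, turns (q^{c+1})_M/(q)_M into
    -- (q^{M+1})_c/(q)_c.
    have h5 := qPoch_add q q c (n * c + ν k)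
    have h6 := qPoch_add q q (n * c + ν k) c
    rw [add_comm c, h6] at h5
    rw [e1, e2] at h
    refine mul_right_cancel₀ (qPoch_self_ne_zero hq (n * c + ν k)) ?_
    rw [pow_succ q, ← smul_eq_mul (q ^ (n * c + ν k)) q]
    change _ = ct (kernel q c (colEps κ) n) * _ * _
    linear_combination qPoch q q c * h - ct (kernel q c (colEps κ) n) * h5
  · refine (natDegree_lastPoly_le q c _ (colEps_comm κ) n _).trans ?_
    rw [sum_add_distrib, sum_const, card_range, smul_eq_mul, ← card_filter, hν k hkp]
    simp

end Products

end BakerForrester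

namespace BakerForrester

open Finset

/-! ### The kernel recursion for a largest block. -/

section Recursion

variable {K : Type*} [Field K]

/-- The colouring in which the block `[s, s + m]` has been moved to the end. -/
def lastCol (κ : ℕ → ℕ) (P s m e i : ℕ) : ℕ :=
  if i < e then κ (i + (s + m + 1)) else if i < e + s then κ (i - e) + P else 2 * P

variable {κ : ℕ → ℕ} {P s m e k : ℕ}

lemma lastCol_spec (hP : ∀ i < s + m + 1 + e, κ i < P)
    (hκ : ∀ i j, i ≤ j → j < s + m + 1 + e → κ i ≤ κ j)
    (hk : ∀ i < s + m + 1 + e, (κ i = k ↔ s ≤ i ∧ i ≤ s + m)) :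
    (∀ i < e, κ (i + (s + m + 1)) < P ∧ k < κ (i + (s + m + 1))) ∧
      (∀ i < s, κ i < k) ∧ k < P := by
  have h0 : κ s = k := (hk s (by omega)).2 (by omega)
  refine ⟨fun i hi => ⟨hP _ (by omega), ?_⟩, fun i hi => ?_, h0 ▸ hP s (by omega)⟩
  · have h1 := hκ s (i + (s + m + 1)) (by omega) (by omega)
    have h2 := hk (i + (s + m + 1)) (by omega)
    omega
  · have h1 := hκ i s (by omega) (by omega)
    have h2 := hk i (by omega)
    omega

/-- Colours before the block are smaller than k and those after it are larger. Hence adding P to the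
former neither merges nor splits classes, and it makes the rotated colouring nondecreasing. -/
lemma lastCol_eq_iff (hP : ∀ i < s + m + 1 + e, κ i < P)
    (hκ : ∀ i j, i ≤ j → j < s + m + 1 + e → κ i ≤ κ j)
    (hk : ∀ i < s + m + 1 + e, (κ i = k ↔ s ≤ i ∧ i ≤ s + m)) {i j : ℕ}
    (hi : i < s + m + 1 + e) (hj : j < s + m + 1 + e) :
    (if i < e then κ (i + (s + m + 1)) else κ (i - e)) =
        (if j < e then κ (j + (s + m + 1)) else κ (j - e)) ↔
      lastCol κ P s m e i = lastCol κ P s m e j := by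
  obtain ⟨h1, h2, h3⟩ := lastCol_spec hP hκ hk
  have hki := hk (i - e) (by omega)
  have hkj := hk (j - e) (by omega)
  have h1i := h1 i
  have h1j := h1 j
  have h2i := h2 (i - e)
  have h2j := h2 (j - e)
  simp only [lastCol]
  split_ifs <;> omega

lemma lastCol_mono (hP : ∀ i < s + m + 1 + e, κ i < P)
    (hκ : ∀ i j, i ≤ j → j < s + m + 1 + e → κ i ≤ κ j)
    (hk : ∀ i < s + m + 1 + e, (κ i = k ↔ s ≤ i ∧ i ≤ s + m)) {i j : ℕ}
    (hij : i ≤ j) (hj : j < s + m + e) : lastCol κ P s m e i ≤ lastCol κ P s m e j := by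
  obtain ⟨h1, h2, h3⟩ := lastCol_spec hP hκ hk
  have h1i := h1 i
  have h1j := h1 j
  have h2i := h2 (i - e)
  have h2j := h2 (j - e)
  have h4 := hκ (i + (s + m + 1)) (j + (s + m + 1)) (by omega)
  have h5 := hκ (i - e) (j - e) (by omega) (by omega)
  simp only [lastCol]
  split_ifs <;> omega

lemma card_lastCol_le {N : ℕ} (hP : ∀ i < s + m + 1 + e, κ i < P)
    (hκ : ∀ i j, i ≤ j → j < s + m + 1 + e → κ i ≤ κ j)
    (hk : ∀ i < s + m + 1 + e, (κ i = k ↔ s ≤ i ∧ i ≤ s + m))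
    (hN : ∀ l, #{i ∈ range (s + m + 1 + e) | κ i = l} ≤ N) (l : ℕ) (hl : l < 2 * P) :
    #{i ∈ range (s + m + e) | lastCol κ P s m e i = l} ≤ N := by
  obtain ⟨h1, h2, h3⟩ := lastCol_spec hP hκ hk
  refine le_trans (card_le_card_of_injOn (fun i => if i < e then i + (s + m + 1) else i - e)
    ?_ ?_) (hN (if l < P then l else l - P))
  · intro i hi
    have hi' := mem_filter.1 (mem_coe.1 hi)
    have h4 := mem_range.1 hi'.1
    have h5 := hi'.2
    have h1i := h1 i
    have h2i := h2 (i - e)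
    rw [mem_coe, mem_filter, mem_range]
    simp only [lastCol] at h5
    by_cases hie : i < e
    · simp only [if_pos hie] at h5 ⊢
      rw [if_pos (by omega)]
      omega
    · simp only [if_neg hie] at h5 ⊢
      by_cases his : i < e + s
      · rw [if_pos his] at h5
        rw [if_neg (by omega)]
        omega
      · rw [if_neg his] at h5
        omega
  · intro i hi j hj hij
    have h4 := mem_range.1 (mem_filter.1 (mem_coe.1 hi)).1
    have h5 := mem_range.1 (mem_filter.1 (mem_coe.1 hj)).1
    simp only at hij
    split_ifs at hij <;> omega

/-- Removing one element from a block of maximal size. -/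
lemma ctKernel_recursion {q : K} (hq0 : q ≠ 0) (hq : ∀ m : ℕ, 0 < m → q ^ m ≠ 1) (c : ℕ)
    (hP : ∀ i < s + m + 1 + e, κ i < P)
    (hκ : ∀ i j, i ≤ j → j < s + m + 1 + e → κ i ≤ κ j)
    (hk : ∀ i < s + m + 1 + e, (κ i = k ↔ s ≤ i ∧ i ≤ s + m))
    (hmax : ∀ l, #{i ∈ range (s + m + 1 + e) | κ i = l} ≤ m + 1) :
    ctKernel q c κ (s + m + 1 + e) * ((1 - q ^ (c + 1)) * qPoch q q c) =
      (1 - q ^ ((m + 1) * (c + 1))) * qPoch q (q ^ ((s + m + e) * c + m + 1)) c *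
        ctKernel q c (fun i => if i < s + m then κ i else κ (i + 1)) (s + m + e) := by
  obtain ⟨h1, h2, h3⟩ := lastCol_spec hP hκ hk
  set κ' := lastCol κ P s m e with hκ'
  have hbig : ctKernel q c κ (s + m + 1 + e) = ctKernel q c κ' (e + s + m + 1) := by
    rw [ctKernel_rotate hq0 c κ _ (s + m + 1), show e + s + m + 1 = s + m + 1 + e by ring]
    have hrot : ∀ i < s + m + 1 + e, κ ((i + (s + m + 1)) % (s + m + 1 + e)) =
        if i < e then κ (i + (s + m + 1)) else κ (i - e) := fun i hi => by
      split_ifs with h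
      · rw [Nat.mod_eq_of_lt (by omega)]
      · rw [Nat.mod_eq_sub_mod (by omega), Nat.mod_eq_of_lt (by omega)]
        congr 1
        omega
    refine ctKernel_congr fun i hi j hj => ?_
    rw [hrot i hi, hrot j hj]
    exact lastCol_eq_iff hP hκ hk hi hj
  have hsmall : ctKernel q c (fun i => if i < s + m then κ i else κ (i + 1)) (s + m + e) =
      ctKernel q c κ' (e + s + m) := by
    rw [ctKernel_rotate hq0 c _ _ (s + m), show e + s + m = s + m + e by ring]
    have hrot : ∀ i < s + m + e, (if (i + (s + m)) % (s + m + e) < s + m then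
        κ ((i + (s + m)) % (s + m + e)) else κ ((i + (s + m)) % (s + m + e) + 1)) =
        if i < e then κ (i + (s + m + 1)) else κ (i - e) := fun i hi => by
      by_cases h : i < e
      · rw [Nat.mod_eq_of_lt (by omega), if_neg (by omega), if_pos h, add_assoc i]
      · rw [Nat.mod_eq_sub_mod (by omega), Nat.mod_eq_of_lt (by omega), if_pos (by omega),
          if_neg h]
        congr 1
        omega
    refine ctKernel_congr fun i hi j hj => ?_
    rw [hrot i hi, hrot j hj]
    exact lastCol_eq_iff hP hκ hk (by omega) (by omega)
  have hlastk : ∀ i, κ' i = 2 * P ↔ e + s ≤ i ∨ 0 = P := fun i => by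
    have h1i := h1 i
    have h2i := h2 (i - e)
    simp only [hκ', lastCol]
    split_ifs <;> omega
  have hlast : ∀ i, κ' i = 2 * P ↔ e + s ≤ i := fun i => by
    have := hlastk i
    omega
  have hν2P : #{i ∈ range (e + s + m) | κ' i = 2 * P} = m := by
    simp only [hlast]
    have : {i ∈ range (e + s + m) | e + s ≤ i} = Ico (e + s) (e + s + m) := by
      ext i
      simp only [mem_filter, mem_range, mem_Ico]
      omega
    rw [this, Nat.card_Ico]
    omega
  have hle : ∀ i, κ' i ≤ 2 * P := fun i => by
    have h1i := h1 i
    have h2i := h2 (i - e)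
    simp only [hκ', lastCol]
    split_ifs <;> omega
  have hW : ctLast q c (colEps κ') (e + s + m) (fun i => c + if κ' i = 2 * P then 1 else 0) c *
      qPoch q q c = ctKernel q c κ' (e + s + m) * qPoch q (q ^ ((e + s + m) * c + m + 1)) c := by
    -- For c = 0 equal exponents count as separated and the chain argument is not available, but
    -- then B = 0 and `ctLast` is the kernel constant term itself.
    rcases Nat.eq_zero_or_pos c with rfl | hc
    · rw [ctLast_zero hq0 hq 0 _ (colEps_comm κ'), qPoch_zero, qPoch_zero]
      rfl
    · have := ctLast_last_mul_eq hq0 hq (n := e + s + m) (p := 2 * P + 1) (k := 2 * P)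
        (ν := fun l => #{i ∈ range (e + s + m) | κ' i = l}) hc
        (fun i j hij hj => lastCol_mono hP hκ hk hij (by omega))
        (fun i _ => Nat.lt_succ_of_le (hle i)) (fun _ _ => rfl) (fun i _ => hle i)
        (Nat.lt_succ_self _) (fun l hl => by
          simp only [hν2P]
          by_cases hl' : l = 2 * P
          · rw [hl', hν2P]; omega
          · rw [show e + s + m = s + m + e by ring]
            exact card_lastCol_le hP hκ hk hmax l (by omega))
      simpa only [hν2P] using this
  have hgeom := mul_neg_geom_sum (q ^ (c + 1)) (m + 1)
  rw [hbig, hsmall, ctKernel_eq_ctLast q c κ' (e + s) m (2 * P) (fun i _ => hlast i),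
    show s + m + e = e + s + m by ring, mul_comm (m + 1) (c + 1), pow_mul, ← hgeom]
  linear_combination (1 - q ^ (c + 1)) * (∑ i ∈ range (m + 1), (q ^ (c + 1)) ^ i) * hW

end Recursion

end BakerForrester

namespace BakerForrester

open Finset

/-! ### Dependence on c: rationality in q^c. -/

section Rationality

variable {K : Type*} [Field K]

/-- The total degree of an exponent vector. -/
noncomputable def expDeg : (ℕ →₀ ℤ) →+ ℤ := Finsupp.liftAddHom fun _ => AddMonoidHom.id ℤ

@[simp] lemma expDeg_single (i : ℕ) (u : ℤ) : expDeg (Finsupp.single i u) = u := by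
  simp [expDeg]

/-- The simultaneous scaling of all variables. -/
noncomputable def scaleAll (u : Kˣ) : Laurent K →ₐ[K] Laurent K :=
  subst (AddMonoidHom.id _)
    { toFun := fun r => ((u ^ expDeg r.toAdd : Kˣ) : K)
      map_one' := by simp
      map_mul' := fun r s => by simp [zpow_add] }

lemma scaleAll_mon (u : Kˣ) (r : ℕ →₀ ℤ) :
    scaleAll u (mon K r) = ((u ^ expDeg r : Kˣ) : K) • mon K r := by
  simp only [scaleAll, subst_mon]; rfl

lemma ct_scaleAll (u : Kˣ) (f : Laurent K) : ct (scaleAll u f) = ct f :=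
  ct_subst Function.injective_id _ f

lemma scaleAll_ratio (u : Kˣ) (i j : ℕ) : scaleAll u (ratio K i j) = ratio K i j := by
  simp [ratio_eq_mon, scaleAll_mon]

lemma scaleAll_kernel (u : Kˣ) (q : K) (c : ℕ) (ε : ℕ → ℕ → ℕ) (n : ℕ) :
    scaleAll u (kernel q c ε n) = kernel q c ε n := by
  simp [kernel, pair, map_prod, map_qPoch, scaleAll_ratio]

/-- The constant term of a monomial multiple of the uncoloured kernel. -/
noncomputable def ctMon (q : K) (n c : ℕ) (r : ℕ →₀ ℤ) : K :=
  ct (mon K r * kernel q c (fun _ _ => 0) n)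

lemma ctMon_eq_zero_of_ne_zero {q : K} (hq0 : q ≠ 0) (hq : ∀ m : ℕ, 0 < m → q ^ m ≠ 1)
    (n c : ℕ) {r : ℕ →₀ ℤ} {i : ℕ} (hi : n ≤ i) (hr : r i ≠ 0) : ctMon q n c r = 0 := by
  have h1 := ct_scaleVar i (Units.mk0 q hq0) (mon K r * kernel q c (fun _ _ => 0) n)
  have h2 : scaleVar i (Units.mk0 q hq0) (kernel q c (fun _ _ => 0) n) =
      kernel q c (fun _ _ => 0) n := by
    simp only [kernel, map_prod]
    refine prod_congr rfl fun j hj => prod_congr rfl fun l hl => ?_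
    rw [mem_range] at hj hl
    exact scaleVar_pair_of_ne (by omega) (by omega) _ _ _
  rw [map_mul, h2, scaleVar_mon, smul_mul_assoc, map_smul, smul_eq_mul] at h1
  have h3 : (q ^ r i : K) ≠ 1 := fun h =>
    hr (zpow_injective hq0 hq (h.trans (zpow_zero q).symm))
  simp only [Units.val_zpow_eq_zpow_val, Units.val_mk0] at h1
  have h4 : (q ^ r i - 1) * ctMon q n c r = 0 := by rw [ctMon]; linear_combination h1
  exact (mul_eq_zero.1 h4).resolve_left (sub_ne_zero.2 h3)

lemma ctMon_eq_zero_of_expDeg {q : K} (hq0 : q ≠ 0) (hq : ∀ m : ℕ, 0 < m → q ^ m ≠ 1)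
    (n c : ℕ) {r : ℕ →₀ ℤ} (hr : expDeg r ≠ 0) : ctMon q n c r = 0 := by
  have h1 := ct_scaleAll (Units.mk0 q hq0) (mon K r * kernel q c (fun _ _ => 0) n)
  rw [map_mul, scaleAll_kernel, scaleAll_mon, smul_mul_assoc, map_smul, smul_eq_mul] at h1
  have h3 : (q ^ expDeg r : K) ≠ 1 := fun h =>
    hr (zpow_injective hq0 hq (h.trans (zpow_zero q).symm))
  simp only [Units.val_zpow_eq_zpow_val, Units.val_mk0] at h1
  have h4 : (q ^ expDeg r - 1) * ctMon q n c r = 0 := by rw [ctMon]; linear_combination h1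
  exact (mul_eq_zero.1 h4).resolve_left (sub_ne_zero.2 h3)

/-- The rotation of the kernel is a scaling of x_0, which only sees the exponent of x_0 in the
monomial. -/
lemma ctMon_rotate {q : K} (hq0 : q ≠ 0) (n c : ℕ) (r : ℕ →₀ ℤ) :
    ctMon q (n + 1) c (r.mapDomain (rotPerm n)) = q ^ (-r 0) * ctMon q (n + 1) c r := by
  lift q to Kˣ using hq0.isUnit
  have h := kernel_rotate q c (fun _ _ => 0) (fun _ _ => 0) n (fun _ _ _ _ => rfl)
    (fun _ _ => rfl)
  have hinv : (r.mapDomain (rotPerm n)).mapDomain (rotPerm n).symm = r := by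
    rw [← Finsupp.mapDomain_comp]
    simp
  rw [ctMon, ← ct_permVar (rotPerm n).symm, ← ct_scaleVar 0 q⁻¹, map_mul, map_mul, ← h,
    permVar_mon, hinv, scaleVar_mon, smul_mul_assoc, map_smul, smul_eq_mul, ctMon]
  simp

/-- Multiplying the pair (i, i+1) by 1 - q^c x_i/x_{i+1} gives (1 - x_i/x_{i+1}) times a symmetric
expression, so the constant term is antisymmetric. -/
lemma ct_swap_rel (q : K) {n i : ℕ} (hi : i + 1 < n) (c : ℕ) {g : Laurent K}
    (hg : permVar (Equiv.swap i (i + 1)) g = g) :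
    ct ((var K (i + 1) - q ^ c • var K i) * g * kernel q c (fun _ _ => 0) n) = 0 := by
  obtain ⟨S, hS, hprod⟩ := exists_symmetric_cofactor (fun a b => pair q c a b) hi
    (fun a b _ _ _ => permVar_pair _ _ _ _ _)
  have h1 : kernel q c (fun _ _ => 0) n = pair q c i (i + 1) * S := hprod
  have h2 : (1 - q ^ c • ratio K i (i + 1)) * pair q c i (i + 1) = halfPair q c i (i + 1) := by
    rw [pair, halfPair, qPoch_succ]; ring
  rw [halfPair_eq] at h2
  have h3 := ratio_mul_var (K := K) i (i + 1)
  have := ct_sub_mul_eq_zero (i := i) (S := (qPoch q (q • ratio K i (i + 1)) c *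
    qPoch q (q • ratio K (i + 1) i) c) * S * g) (by
      rw [map_mul, map_mul, permVar_symPair, hS, hg])
  rw [← this, h1]
  congr 1
  simp only [Algebra.smul_def] at h2 h3 ⊢
  linear_combination (-(algebraMap K (Laurent K) (q ^ c)) * g * S * pair q c i (i + 1) +
    qPoch q (algebraMap K (Laurent K) q * ratio K i (i + 1)) c *
      qPoch q (algebraMap K (Laurent K) q * ratio K (i + 1) i) c * S * g) * (-h3) +
    var K (i + 1) * S * g * h2

lemma var_mul_mon (i : ℕ) (r : ℕ →₀ ℤ) : var K i * mon K r = mon K (r + Finsupp.single i 1) := by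
  rw [var, mon_mul, add_comm]

/-- The relation between neighbouring exponents `u, v` and `u - 1, v + 1`, up to the order. -/
lemma ctMon_swap_rel (q : K) {n i : ℕ} (hi : i + 1 < n) (c : ℕ) (r : ℕ →₀ ℤ) :
    ctMon q n c (r + Finsupp.single (i + 1) 1) +
        ctMon q n c ((r + Finsupp.single i 1).mapDomain (Equiv.swap i (i + 1))) =
      q ^ c * (ctMon q n c (r + Finsupp.single i 1) +
        ctMon q n c ((r + Finsupp.single (i + 1) 1).mapDomain (Equiv.swap i (i + 1)))) := by
  have h := ct_swap_rel q hi c (g := mon K r + permVar (Equiv.swap i (i + 1)) (mon K r))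
    (by rw [map_add, permVar_swap_swap, add_comm])
  rw [permVar_mon] at h
  simp only [sub_mul, mul_add, add_mul, smul_mul_assoc, var_mul_mon, map_sub, map_add,
    map_smul, smul_eq_mul] at h
  rw [Finsupp.mapDomain_add, Finsupp.mapDomain_add, Finsupp.mapDomain_single,
    Finsupp.mapDomain_single, Equiv.swap_apply_left, Equiv.swap_apply_right]
  simp only [ctMon]
  linear_combination h

lemma ctMon_swap_of_eq (q : K) {n i : ℕ} (hi : i + 1 < n) (c : ℕ) (r : ℕ →₀ ℤ)
    (hr : r.mapDomain (Equiv.swap i (i + 1)) = r) :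
    ctMon q n c (r + Finsupp.single (i + 1) 1) = q ^ c * ctMon q n c (r + Finsupp.single i 1) := by
  have h := ct_swap_rel q hi c (g := mon K r) (by rw [permVar_mon, hr])
  simp only [sub_mul, smul_mul_assoc, var_mul_mon, map_sub, map_smul, smul_eq_mul] at h
  simp only [ctMon]
  linear_combination h

/-- `φ` is a rational function of `q^c` times the constant term of the uncoloured kernel. -/
def IsRationalMultiple (q : K) (n : ℕ) (φ : ℕ → K) : Prop :=
  ∃ P G : Polynomial K, (∀ c : ℕ, P.eval (q ^ c) ≠ 0) ∧
    ∀ c : ℕ, P.eval (q ^ c) * φ c = G.eval (q ^ c) * ctMon q n c 0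

variable {q : K} {n : ℕ} {φ ψ : ℕ → K}

lemma IsRationalMultiple.zero : IsRationalMultiple q n fun _ => 0 :=
  ⟨1, 0, by simp, by simp⟩

lemma IsRationalMultiple.add (hφ : IsRationalMultiple q n φ) (hψ : IsRationalMultiple q n ψ) :
    IsRationalMultiple q n fun c => φ c + ψ c := by
  obtain ⟨P, G, h1, h2⟩ := hφ
  obtain ⟨P', G', h1', h2'⟩ := hψ
  refine ⟨P * P', G * P' + G' * P, fun c => ?_, fun c => ?_⟩
  · rw [Polynomial.eval_mul]; exact mul_ne_zero (h1 c) (h1' c)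
  · simp only [Polynomial.eval_mul, Polynomial.eval_add]
    linear_combination P'.eval (q ^ c) * h2 c + P.eval (q ^ c) * h2' c

lemma IsRationalMultiple.eval_mul (H : Polynomial K) (hφ : IsRationalMultiple q n φ) :
    IsRationalMultiple q n fun c => H.eval (q ^ c) * φ c := by
  obtain ⟨P, G, h1, h2⟩ := hφ
  refine ⟨P, H * G, h1, fun c => ?_⟩
  simp only [Polynomial.eval_mul]
  linear_combination H.eval (q ^ c) * h2 c

lemma IsRationalMultiple.of_eval_mul (H : Polynomial K) (hH : ∀ c : ℕ, H.eval (q ^ c) ≠ 0)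
    (hφ : IsRationalMultiple q n fun c => H.eval (q ^ c) * φ c) : IsRationalMultiple q n φ := by
  obtain ⟨P, G, h1, h2⟩ := hφ
  refine ⟨P * H, G, fun c => ?_, fun c => ?_⟩
  · rw [Polynomial.eval_mul]; exact mul_ne_zero (h1 c) (hH c)
  · rw [Polynomial.eval_mul, mul_assoc]; exact h2 c

lemma IsRationalMultiple.const_mul (a : K) (hφ : IsRationalMultiple q n φ) :
    IsRationalMultiple q n fun c => a * φ c := by
  simpa using hφ.eval_mul (Polynomial.C a)

lemma IsRationalMultiple.pow_mul (k : ℕ) (hφ : IsRationalMultiple q n φ) :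
    IsRationalMultiple q n fun c => (q ^ c) ^ k * φ c := by
  simpa using hφ.eval_mul (Polynomial.X ^ k)

lemma IsRationalMultiple.sub (hφ : IsRationalMultiple q n φ) (hψ : IsRationalMultiple q n ψ) :
    IsRationalMultiple q n fun c => φ c - ψ c := by
  simpa [sub_eq_add_neg] using hφ.add (hψ.const_mul (-1))

/-- The sum of the squares of the first `n` exponents. -/
def expNorm (n : ℕ) (r : ℕ →₀ ℤ) : ℤ := ∑ i ∈ range n, r i ^ 2

lemma expNorm_mapDomain (σ : Equiv.Perm ℕ) (hσ : ∀ i, i < n ↔ σ i < n) (r : ℕ →₀ ℤ) :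
    expNorm n (r.mapDomain σ) = expNorm n r := by
  refine (sum_equiv σ (fun i => by simpa using hσ i) fun i _ => ?_).symm
  rw [Finsupp.mapDomain_apply σ.injective]

lemma mapDomain_swap_of_eq {r : ℕ →₀ ℤ} {i j : ℕ} (h : r i = r j) :
    r.mapDomain (Equiv.swap i j) = r := by
  ext l
  have := Finsupp.mapDomain_apply (Equiv.swap i j).injective r (Equiv.swap i j l)
  rw [Equiv.swap_apply_self] at this
  rw [this, Equiv.swap_apply_def]
  split_ifs with h1 h2
  · rw [h1, h]
  · rw [h2, h]
  · rfl

lemma swap_lt_iff {i : ℕ} (hi : i + 1 < n) (j : ℕ) : j < n ↔ Equiv.swap i (i + 1) j < n := by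
  rw [Equiv.swap_apply_def]
  split_ifs <;> omega

lemma rotPerm_lt_iff {m : ℕ} (hm : m < n) (j : ℕ) : j < n ↔ rotPerm m j < n := by
  change j < n ↔ (if j = 0 then m else if j ≤ m then j - 1 else j) < n
  split_ifs <;> omega

lemma expNorm_add_single_lt {i : ℕ} (hi : i + 1 < n) (r : ℕ →₀ ℤ) (h : r (i + 1) < r i) :
    expNorm n (r + Finsupp.single (i + 1) 1) < expNorm n (r + Finsupp.single i 1) := by
  have h1 : ∀ s : ℕ →₀ ℤ, expNorm n s = s i ^ 2 + (s (i + 1) ^ 2 +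
      ∑ j ∈ ((range n).erase i).erase (i + 1), s j ^ 2) := fun s => by
    rw [expNorm, ← add_sum_erase _ _ (mem_range.2 (show i < n by omega)),
      ← add_sum_erase _ _ (mem_erase.2 ⟨Nat.succ_ne_self i, mem_range.2 hi⟩)]
  have h2 : ∀ l, l = i ∨ l = i + 1 → ∑ j ∈ ((range n).erase i).erase (i + 1),
      (r + Finsupp.single l 1 : ℕ →₀ ℤ) j ^ 2 = ∑ j ∈ ((range n).erase i).erase (i + 1), r j ^ 2 := by
    intro l hl
    refine sum_congr rfl fun j hj => ?_
    simp only [mem_erase] at hj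
    rw [Finsupp.add_apply, Finsupp.single_eq_of_ne (by omega), add_zero]
  rw [h1, h1, h2 _ (Or.inl rfl), h2 _ (Or.inr rfl)]
  simp only [Finsupp.add_apply, Finsupp.single_eq_same]
  rw [Finsupp.single_eq_of_ne (show i ≠ i + 1 by omega),
    Finsupp.single_eq_of_ne (show i + 1 ≠ i by omega)]
  linarith

/-- Exchanging neighbouring exponents costs a factor `q^c`, up to smaller exponents. -/
lemma isRationalMultiple_swap {i : ℕ} (hi : i + 1 < n) {r : ℕ →₀ ℤ} (h : r (i + 1) < r i)
    (ih : ∀ s : ℕ →₀ ℤ, expNorm n s < expNorm n r →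
      IsRationalMultiple q n fun c => ctMon q n c s) :
    IsRationalMultiple q n fun c =>
      ctMon q n c (r.mapDomain (Equiv.swap i (i + 1))) - q ^ c * ctMon q n c r := by
  obtain ⟨r₀, rfl⟩ : ∃ r₀, r = r₀ + Finsupp.single i 1 := ⟨r - Finsupp.single i 1, by simp⟩
  simp only [Finsupp.add_apply, Finsupp.single_eq_same] at h
  rw [Finsupp.single_eq_of_ne (show i + 1 ≠ i by omega), add_zero] at h
  rcases eq_or_lt_of_le (Int.lt_add_one_iff.1 h) with h1 | h1
  · have h2 : r₀.mapDomain (Equiv.swap i (i + 1)) = r₀ := mapDomain_swap_of_eq h1.symm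
    rw [Finsupp.mapDomain_add, h2, Finsupp.mapDomain_single, Equiv.swap_apply_left]
    simp only [ctMon_swap_of_eq q hi _ r₀ h2, sub_self]
    exact .zero
  · have h3 := expNorm_add_single_lt hi r₀ h1
    -- The two remaining terms of the exchange relation have the exponents u - 1, v + 1 in place of
    -- u, v; for u - 1 > v this strictly decreases the sum of squares.
    have h4 := ih _ h3
    have h5 := ih ((r₀ + Finsupp.single (i + 1) 1).mapDomain (Equiv.swap i (i + 1)))
      (by rwa [expNorm_mapDomain _ (swap_lt_iff hi)])
    have h6 := (h5.pow_mul 1).sub h4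
    convert h6 using 2 with c
    linear_combination ctMon_swap_rel q hi c r₀

lemma rotPerm_zero_eq : rotPerm 0 = 1 := by
  ext i
  change (if i = 0 then 0 else if i ≤ 0 then i - 1 else i) = i
  split_ifs <;> omega

lemma rotPerm_succ_eq (j : ℕ) :
    rotPerm (j + 1) = Equiv.swap j (j + 1) * rotPerm j := by
  ext i
  rw [Equiv.Perm.mul_apply, Equiv.swap_apply_def]
  change (if i = 0 then j + 1 else if i ≤ j + 1 then i - 1 else i) =
    if (if i = 0 then j else if i ≤ j then i - 1 else i) = j then j + 1 else
      if (if i = 0 then j else if i ≤ j then i - 1 else i) = j + 1 then j else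
        (if i = 0 then j else if i ≤ j then i - 1 else i)
  split_ifs <;> omega

/-- Moving a maximal exponent from the front to the position `j`. -/
lemma isRationalMultiple_move {r : ℕ →₀ ℤ} (hmax : ∀ i < n, r i ≤ r 0)
    (ih : ∀ s : ℕ →₀ ℤ, expNorm n s < expNorm n r →
      IsRationalMultiple q n fun c => ctMon q n c s) {j : ℕ} (hj : j < n) :
    ∃ k : ℕ, IsRationalMultiple q n fun c =>
      ctMon q n c (r.mapDomain (rotPerm j)) - (q ^ c) ^ k * ctMon q n c r := by
  induction j with
  | zero =>
    refine ⟨0, ?_⟩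
    simp only [rotPerm_zero_eq, Equiv.Perm.coe_one, Finsupp.mapDomain_id, pow_zero, one_mul,
      sub_self]
    exact .zero
  | succ j ihj =>
    obtain ⟨k, hk⟩ := ihj (by omega)
    have h0 : (r.mapDomain (rotPerm j)) j = r 0 := by
      have := Finsupp.mapDomain_apply (rotPerm j).injective r 0
      rwa [rotPerm_zero] at this
    have h1 : (r.mapDomain (rotPerm j)) (j + 1) = r (j + 1) := by
      have := Finsupp.mapDomain_apply (rotPerm j).injective r (j + 1)
      have h2 : rotPerm j (j + 1) = j + 1 := by
        change (if j + 1 = 0 then j else if j + 1 ≤ j then j + 1 - 1 else j + 1) = j + 1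
        rw [if_neg (by omega), if_neg (by omega)]
      rwa [h2] at this
    have hcomp : r.mapDomain (rotPerm (j + 1)) =
        (r.mapDomain (rotPerm j)).mapDomain (Equiv.swap j (j + 1)) := by
      rw [rotPerm_succ_eq, ← Finsupp.mapDomain_comp]; rfl
    rw [hcomp]
    rcases eq_or_lt_of_le (hmax (j + 1) hj) with h2 | h2
    · refine ⟨k, ?_⟩
      have : (r.mapDomain (rotPerm j)).mapDomain (Equiv.swap j (j + 1)) =
          r.mapDomain (rotPerm j) := mapDomain_swap_of_eq (by rw [h0, h1, h2])
      rwa [this]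
    · refine ⟨k + 1, ?_⟩
      have h3 := isRationalMultiple_swap (q := q) hj (r := r.mapDomain (rotPerm j))
        (by rwa [h0, h1]) (by rwa [expNorm_mapDomain _ (rotPerm_lt_iff (show j < n by omega))])
      convert h3.add (hk.pow_mul 1) using 2 with c
      ring

lemma exists_max_of_expDeg {r : ℕ →₀ ℤ} (hr0 : r ≠ 0) (hr : ∀ i, n ≤ i → r i = 0)
    (hdeg : expDeg r = 0) : ∃ i < n, 0 < r i ∧ ∀ j < n, r j ≤ r i := by
  have hn : (range n).Nonempty := by
    by_contra h
    rw [not_nonempty_iff_eq_empty, range_eq_empty_iff] at h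
    exact hr0 (Finsupp.ext fun i => hr i (by omega))
  obtain ⟨i, hi, hmax⟩ := exists_max_image (range n) r hn
  rw [mem_range] at hi
  refine ⟨i, hi, ?_, fun j hj => hmax j (mem_range.2 hj)⟩
  by_contra hneg
  have hle : ∀ j, r j ≤ 0 := fun j => by
    by_cases hj : j < n
    · have := hmax j (mem_range.2 hj); omega
    · rw [hr j (by omega)]
  refine hr0 (Finsupp.ext fun j => ?_)
  have h1 : ∑ j ∈ r.support, r j = 0 := by
    simpa [expDeg, Finsupp.liftAddHom_apply, Finsupp.sum] using hdeg
  by_cases hj : j ∈ r.support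
  · exact (sum_eq_zero_iff_of_nonpos fun j _ => hle j).1 h1 j hj
  · exact Finsupp.notMem_support_iff.1 hj

/-- Constant terms of monomial multiples of the kernel are rational multiples of that of the
kernel. -/
lemma isRationalMultiple_ctMon (hq0 : q ≠ 0) (hq : ∀ m : ℕ, 0 < m → q ^ m ≠ 1) (n : ℕ)
    (r : ℕ →₀ ℤ) : IsRationalMultiple q (n + 1) fun c => ctMon q (n + 1) c r := by
  have hpos : ∀ s : ℕ →₀ ℤ, 0 ≤ expNorm (n + 1) s := fun s => sum_nonneg fun i _ => sq_nonneg _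
  obtain ⟨N, hN⟩ : ∃ N : ℕ, expNorm (n + 1) r = N := Int.eq_ofNat_of_zero_le (hpos r)
  induction N using Nat.strong_induction_on generalizing r with
  | _ N ihN =>
  have ih : ∀ s : ℕ →₀ ℤ, expNorm (n + 1) s < expNorm (n + 1) r →
      IsRationalMultiple q (n + 1) fun c => ctMon q (n + 1) c s := fun s hs => by
    obtain ⟨M, hM⟩ := Int.eq_ofNat_of_zero_le (hpos s)
    exact ihN M (by omega) s hM
  by_cases hr0 : r = 0
  · exact ⟨1, 1, by simp, by simp [hr0]⟩
  by_cases hr : ∀ i, n + 1 ≤ i → r i = 0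
  swap
  · push Not at hr
    obtain ⟨i, hi, hri⟩ := hr
    simp only [ctMon_eq_zero_of_ne_zero hq0 hq _ _ hi hri]
    exact .zero
  by_cases hdeg : expDeg r = 0
  swap
  · simp only [ctMon_eq_zero_of_expDeg hq0 hq _ _ hdeg]
    exact .zero
  obtain ⟨p, hp, hpos', hmax⟩ := exists_max_of_expDeg hr0 hr hdeg
  clear hr0 hr hdeg hN ihN
  induction p generalizing r with
  | zero =>
    obtain ⟨k, hk⟩ := isRationalMultiple_move hmax ih n.lt_succ_self
    simp only [ctMon_rotate hq0, ← sub_mul] at hk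
    -- Moving the maximal exponent from front to back costs a power (q^c)^k by exchanges, up to
    -- smaller terms, and exactly q^{-r_0} by rotation. As r_0 > 0 ≥ -ck the two factors differ for
    -- every c, so the constant term can be solved for.
    refine .of_eval_mul (Polynomial.C (q ^ (-r 0)) - Polynomial.X ^ k) (fun c => ?_) (by simpa using hk)
    simp only [Polynomial.eval_sub, Polynomial.eval_C, Polynomial.eval_pow, Polynomial.eval_X]
    rw [sub_ne_zero, ← pow_mul, ← zpow_natCast]
    intro h
    have := zpow_injective hq0 hq h
    omega
  | succ p ihp =>
    -- A rotation brings the maximal exponent one place closer to the front, at the cost of a power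
    -- of q independent of c.
    have hval : ∀ i < n, (r.mapDomain (rotPerm n)) i = r (i + 1) := fun i hi => by
      have := Finsupp.mapDomain_apply (rotPerm n).injective r (i + 1)
      rwa [rotPerm_succ hi] at this
    have hval' : (r.mapDomain (rotPerm n)) n = r 0 := by
      have := Finsupp.mapDomain_apply (rotPerm n).injective r 0
      rwa [rotPerm_zero] at this
    have h := ihp (r.mapDomain (rotPerm n))
      (by rwa [expNorm_mapDomain _ (rotPerm_lt_iff n.lt_succ_self)]) (by omega)
      (by rwa [hval p (by omega)]) (fun j hj => by
        rw [hval p (by omega)]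
        rcases Nat.lt_succ_iff_lt_or_eq.1 hj with h | rfl
        · rw [hval j h]; exact hmax _ (by omega)
        · rw [hval']; exact hmax _ (by omega))
    convert h.const_mul (q ^ r 0) using 2 with c
    rw [ctMon_rotate hq0, ← mul_assoc, ← zpow_add₀ hq0, add_neg_cancel, zpow_zero, one_mul]

end Rationality

end BakerForrester

namespace BakerForrester

open Finset

/-! ### Removing the restriction b ≤ c. -/

section Extension

variable {K : Type*} [Field K] {q : K} {n : ℕ}

/-- A family of Laurent polynomials all of whose multiples have constant terms, against the
uncoloured kernel, that are rational multiples of that of the kernel. -/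
def IsRationalFamily (q : K) (n : ℕ) (F : ℕ → Laurent K) : Prop :=
  ∀ g, IsRationalMultiple q n fun c => ct (g * F c * kernel q c (fun _ _ => 0) n)

lemma IsRationalFamily.one (hq0 : q ≠ 0) (hq : ∀ m : ℕ, 0 < m → q ^ m ≠ 1) :
    IsRationalFamily q (n + 1) fun _ => 1 := by
  intro g
  simp only [mul_one]
  induction g using Laurent.induction_mon with
  | zero => simpa using IsRationalMultiple.zero
  | add f g hf hg => simpa only [add_mul, map_add] using hf.add hg
  | smul_mon r u =>
    simp only [smul_mul_assoc, map_smul, smul_eq_mul]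
    exact (isRationalMultiple_ctMon hq0 hq n r).const_mul u

lemma IsRationalFamily.mul_one_sub {F : ℕ → Laurent K} (hF : IsRationalFamily q n F)
    (z : Laurent K) : IsRationalFamily q n fun c => F c * (1 - q ^ c • z) := by
  intro g
  convert (hF g).sub ((hF (g * z)).pow_mul 1) using 2 with c
  rw [pow_one, ← smul_eq_mul (q ^ c), ← map_smul, ← map_sub]
  congr 1
  simp only [Algebra.smul_def]
  ring

lemma IsRationalFamily.mul_prod {ι : Type*} {F : ℕ → Laurent K} (hF : IsRationalFamily q n F)
    (s : Finset ι) (z : ι → Laurent K) :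
    IsRationalFamily q n fun c => F c * ∏ i ∈ s, (1 - q ^ c • z i) := by
  classical
  induction s using Finset.induction_on with
  | empty => simpa using hF
  | insert a s ha ih =>
    convert ih.mul_one_sub (z a) using 2 with c
    rw [prod_insert ha]
    ring

/-- The colours contribute only factors affine in q^c, which preserve rational families. -/
lemma kernel_colEps_eq (q : K) (c : ℕ) (κ : ℕ → ℕ) (n : ℕ) :
    kernel q c (colEps κ) n =
      ((1 * ∏ x ∈ (range n).sigma range,
        (1 - q ^ c • if κ x.2 = κ x.1 then ratio K x.2 x.1 else 0)) *
        ∏ x ∈ (range n).sigma range,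
        (1 - q ^ c • if κ x.2 = κ x.1 then q • ratio K x.1 x.2 else 0)) *
      kernel q c (fun _ _ => 0) n := by
  rw [kernel, kernel, prod_sigma', prod_sigma', one_mul, ← prod_mul_distrib, ← prod_mul_distrib]
  refine prod_congr rfl fun x _ => ?_
  rw [colEps]
  split_ifs with h
  · rw [pair, pair, add_zero, qPoch_succ, qPoch_succ]
    ring
  · simp

lemma isRationalMultiple_kernel (hq0 : q ≠ 0) (hq : ∀ m : ℕ, 0 < m → q ^ m ≠ 1) (κ : ℕ → ℕ)
    (g : Laurent K) :
    IsRationalMultiple q (n + 1) fun c => ct (g * kernel q c (colEps κ) (n + 1)) := by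
  simp only [kernel_colEps_eq, ← mul_assoc]
  have := ((IsRationalFamily.one (n := n) hq0 hq).mul_prod ((range (n + 1)).sigma range)
    (fun x => if κ x.2 = κ x.1 then ratio K x.2 x.1 else 0)).mul_prod ((range (n + 1)).sigma range)
    (fun x => if κ x.2 = κ x.1 then q • ratio K x.1 x.2 else 0) g
  simpa only [← mul_assoc] using this

lemma qPoch_pow_ne_zero (hq : ∀ m : ℕ, 0 < m → q ^ m ≠ 1) {m : ℕ} (hm : 1 ≤ m) (c : ℕ) :
    qPoch q (q ^ m) c ≠ 0 := by
  rw [qPoch, prod_ne_zero_iff]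
  intro t _ h
  rw [smul_eq_mul, ← pow_add, sub_eq_zero] at h
  exact hq (t + m) (by omega) h.symm

lemma ctMon_zero_eq (q : K) (n c : ℕ) : ctMon q n c 0 = ctKernel q c id n := by
  rw [ctMon, mon_zero, one_mul, ctKernel, kernel_congr]
  intro j _ i hi
  rw [colEps, if_neg (show ¬id i = id j from hi.ne)]

/-- With all colours distinct every class is a singleton of maximal size. The recursion then removes
one variable at a time, with factors that are nonzero because q is not a root of unity. -/
lemma ctKernel_id_ne_zero (hq0 : q ≠ 0) (hq : ∀ m : ℕ, 0 < m → q ^ m ≠ 1) (c n : ℕ) :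
    ctKernel q c id n ≠ 0 := by
  induction n with
  | zero =>
    rw [ctKernel, kernel, range_zero, prod_empty, ← mon_zero, ct_mon, if_pos rfl]
    exact one_ne_zero
  | succ n ih =>
    have h := ctKernel_recursion (κ := id) (P := n + 1) (s := 0) (m := 0) (e := n) (k := 0)
      hq0 hq c (fun i hi => by simp only [id]; omega) (fun i j hij _ => hij)
      (fun i _ => by simp only [id]; omega) (fun l => by
        refine card_le_one.2 fun a ha b hb => ?_
        exact (mem_filter.1 ha).2.trans (mem_filter.1 hb).2.symm)
    have h1 : ctKernel q c (fun i => if i < 0 + 0 then id i else id (i + 1)) (0 + 0 + n) =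
        ctKernel q c id n := by
      rw [show 0 + 0 + n = n by omega]
      exact ctKernel_congr fun i _ j _ => by simp
    rw [h1, show 0 + 0 + 1 + n = n + 1 by omega] at h
    intro h0
    rw [h0, zero_mul] at h
    refine mul_ne_zero (mul_ne_zero ?_ (qPoch_pow_ne_zero hq (by omega) c)) ih h.symm
    exact sub_ne_zero.2 (hq _ (by positivity)).symm

/-- The product of shifted factorials as a polynomial in `q^c`. -/
noncomputable def pochPoly (q : K) (n b : ℕ) (ρ : ℕ → ℕ) : Polynomial K :=
  ∏ r ∈ range n, ∏ j ∈ range b, (1 - Polynomial.C (q ^ (ρ r + j)) * Polynomial.X ^ r)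

lemma eval_pochPoly (q : K) (n b c : ℕ) (ρ : ℕ → ℕ) : (pochPoly q n b ρ).eval (q ^ c) =
    ∏ r ∈ range n, qPoch q (q ^ (r * c + ρ r)) b := by
  simp only [pochPoly, Polynomial.eval_prod, qPoch]
  refine prod_congr rfl fun r _ => prod_congr rfl fun j _ => ?_
  simp only [Polynomial.eval_sub, Polynomial.eval_one, Polynomial.eval_mul, Polynomial.eval_C,
    Polynomial.eval_pow, Polynomial.eval_X, smul_eq_mul]
  rw [← pow_mul, ← pow_add, ← pow_add]
  congr 2
  ring

/-- The dependence on `a` of the constant term with equal exponents `A_i = b`. -/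
lemma ctLast_const_mul_prod_eq (hq0 : q ≠ 0) (hq : ∀ m : ℕ, 0 < m → q ^ m ≠ 1)
    {p : ℕ} {κ ν : ℕ → ℕ} (hκ : ∀ i j, i ≤ j → j < n + 1 → κ i ≤ κ j)
    (hp : ∀ i < n + 1, κ i < p) (hν : ∀ l < p, #{i ∈ range (n + 1) | κ i = l} = ν l)
    (a b c : ℕ) :
    ctLast q c (colEps κ) (n + 1) (fun _ => b) a *
        ∏ r ∈ range (n + 1), qPoch q (q ^ (r * c + slotLevel ν p r)) b =
      ctKernel q c κ (n + 1) *
        ∏ r ∈ range (n + 1), qPoch q (q ^ (a + r * c + slotLevel ν p r)) b := by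
  obtain ⟨P, G, hP, hPG⟩ := isRationalMultiple_kernel (n := n) hq0 hq κ
    (∏ i ∈ range (n + 1), qPoch q (ratio K i (n + 1)) b * qPoch q (q • ratio K (n + 1) i) a)
  obtain ⟨P', G', hP', hPG'⟩ := isRationalMultiple_kernel (n := n) hq0 hq κ 1
  simp only [one_mul] at hPG'
  set R := pochPoly q (n + 1) b (slotLevel ν p) with hR
  set R' := pochPoly q (n + 1) b (fun r => a + slotLevel ν p r) with hR'
  have e1 : ∀ c, ∏ r ∈ range (n + 1), qPoch q (q ^ (r * c + slotLevel ν p r)) b =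
      R.eval (q ^ c) := fun c => (eval_pochPoly q (n + 1) b c _).symm
  have e2 : ∀ c, ∏ r ∈ range (n + 1), qPoch q (q ^ (a + r * c + slotLevel ν p r)) b =
      R'.eval (q ^ c) := fun c => by
    rw [hR', eval_pochPoly]
    exact prod_congr rfl fun r _ => by rw [show a + r * c = r * c + a by ring, add_assoc]
  -- After division by the nonzero uncoloured constant term the formula is a polynomial identity in
  -- q^c. It is known at the infinitely many points q^{c+b+1}, where b does not exceed the exponent.
  have hpoly : G * P' * R = G' * P * R' := by
    refine Polynomial.eq_of_infinite_eval_eq _ _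
      (Set.infinite_of_injective_forall_mem (f := fun c : ℕ => q ^ (c + b + 1)) ?_ fun c => ?_)
    · intro x y hxy
      have := pow_injective_of_ne_one hq0 hq hxy
      omega
    · have h := ctLast_mul_prod_eq hq0 hq (c := c + b + 1) (b := b) (by omega) (by omega) hκ hp hν a
      rw [e1, e2] at h
      have h1 := hPG (c + b + 1)
      have h2 := hPG' (c + b + 1)
      have h3 := ctKernel_id_ne_zero hq0 hq (c + b + 1) (n + 1)
      rw [← ctMon_zero_eq] at h3
      rw [Set.mem_ofPred_eq]
      simp only [Polynomial.eval_mul]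
      refine mul_right_cancel₀ h3 ?_
      rw [ctLast, ctKernel] at h
      linear_combination (P.eval (q ^ (c + b + 1)) * P'.eval (q ^ (c + b + 1))) * h -
        P'.eval (q ^ (c + b + 1)) * R.eval (q ^ (c + b + 1)) * h1 +
        P.eval (q ^ (c + b + 1)) * R'.eval (q ^ (c + b + 1)) * h2
  have h := congrArg (Polynomial.eval (q ^ c)) hpoly
  simp only [Polynomial.eval_mul] at h
  rw [e1, e2, ctLast, ctKernel]
  refine mul_left_cancel₀ (mul_ne_zero (hP c) (hP' c)) ?_
  linear_combination ctMon q (n + 1) c 0 * h + P'.eval (q ^ c) * R.eval (q ^ c) * hPG c -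
    P.eval (q ^ c) * R'.eval (q ^ c) * hPG' c

end Extension

end BakerForrester

namespace BakerForrester

open Finset

/-! ### Block colourings and the removal of one element. -/

section Blocks

/-- The index of the block that contains the position `i`, for blocks of sizes `n 0, n 1, …`. -/
def blockIdx (n : ℕ → ℕ) (p i : ℕ) : ℕ := #{r ∈ range p | ∑ m ∈ range (r + 1), n m ≤ i}

/-- The colouring by blocks, in which the positions in the first block have distinct colours. -/
def blockCol (n : ℕ → ℕ) (p i : ℕ) : ℕ := if i < n 0 then i else n 0 + blockIdx n p i

/-- The number of positions of a given colour. -/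
def blockCount (n : ℕ → ℕ) (l : ℕ) : ℕ := if l < n 0 then 1 else if l = n 0 then 0 else n (l - n 0)

variable {n : ℕ → ℕ} {p i j r k : ℕ}

lemma sum_range_mono (n : ℕ → ℕ) : Monotone fun r => ∑ m ∈ range r, n m := fun _ _ h =>
  sum_le_sum_of_subset (range_subset_range.2 h)

lemma blockIdx_eq (hr : r < p) (h1 : ∑ m ∈ range r, n m ≤ i) (h2 : i < ∑ m ∈ range (r + 1), n m) :
    blockIdx n p i = r := by
  have : {t ∈ range p | ∑ m ∈ range (t + 1), n m ≤ i} = range r := by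
    ext t
    rw [mem_filter, mem_range, mem_range]
    constructor
    · rintro ⟨h3, h4⟩
      by_contra h5
      have := sum_range_mono n (show r + 1 ≤ t + 1 by omega)
      simp only at this
      omega
    · intro h3
      have := sum_range_mono n (show t + 1 ≤ r by omega)
      simp only at this
      omega
  rw [blockIdx, this, card_range]

lemma exists_block (hi : i < ∑ m ∈ range p, n m) :
    ∃ r < p, ∑ m ∈ range r, n m ≤ i ∧ i < ∑ m ∈ range (r + 1), n m :=
  exists_between_succ (g := fun r => ∑ m ∈ range r, n m) (by simp) hi

lemma blockIdx_eq_iff (hr : r < p) (hi : i < ∑ m ∈ range p, n m) :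
    blockIdx n p i = r ↔ ∑ m ∈ range r, n m ≤ i ∧ i < ∑ m ∈ range (r + 1), n m := by
  constructor
  · rintro rfl
    obtain ⟨t, ht, h1, h2⟩ := exists_block hi
    rw [blockIdx_eq ht h1 h2]
    exact ⟨h1, h2⟩
  · exact fun h => blockIdx_eq hr h.1 h.2

lemma blockIdx_lt (hi : i < ∑ m ∈ range p, n m) : blockIdx n p i < p := by
  obtain ⟨t, ht, h1, h2⟩ := exists_block hi
  rwa [blockIdx_eq ht h1 h2]

lemma blockIdx_pos (hp : 0 < p) (hi : i < ∑ m ∈ range p, n m) (h : n 0 ≤ i) :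
    0 < blockIdx n p i := by
  by_contra h0
  have := (blockIdx_eq_iff hp hi).1 (by omega)
  simp only [zero_add, sum_range_one] at this
  omega

lemma blockIdx_mono (h : i ≤ j) : blockIdx n p i ≤ blockIdx n p j :=
  card_le_card (monotone_filter_right _ fun _ _ h' => h'.trans h)

lemma blockCol_mono (h : i ≤ j) : blockCol n p i ≤ blockCol n p j := by
  have := blockIdx_mono (n := n) (p := p) h
  simp only [blockCol]
  split_ifs <;> omega

lemma blockCol_lt (hi : i < ∑ m ∈ range p, n m) : blockCol n p i < n 0 + p := by
  have := blockIdx_lt hi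
  simp only [blockCol]
  split_ifs <;> omega

lemma blockCol_eq_add_iff (hr : r < p) (hr0 : 1 ≤ r) (hi : i < ∑ m ∈ range p, n m) :
    blockCol n p i = n 0 + r ↔ ∑ m ∈ range r, n m ≤ i ∧ i < ∑ m ∈ range (r + 1), n m := by
  rw [← blockIdx_eq_iff hr hi, blockCol]
  split_ifs with h
  · have h1 : blockIdx n p i = 0 := blockIdx_eq (by omega) (by simp) (by simpa using h)
    omega
  · omega

lemma card_blockCol (hp : 0 < p) {l : ℕ} (hl : l < n 0 + p) :
    #{i ∈ range (∑ m ∈ range p, n m) | blockCol n p i = l} = blockCount n l := by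
  have h0 : n 0 ≤ ∑ m ∈ range p, n m :=
    single_le_sum (f := n) (fun _ _ => Nat.zero_le _) (mem_range.2 hp)
  rcases lt_trichotomy l (n 0) with h | h | h
  · have : {i ∈ range (∑ m ∈ range p, n m) | blockCol n p i = l} = {l} := by
      ext i
      rw [mem_filter, mem_range, mem_singleton, blockCol]
      split_ifs <;> omega
    rw [this, card_singleton, blockCount, if_pos h]
  · rw [blockCount, if_neg (by omega), if_pos h, card_eq_zero, filter_eq_empty_iff]
    intro i hi
    have := blockIdx_pos hp (mem_range.1 hi)
    rw [blockCol]
    split_ifs <;> omega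
  · have : {i ∈ range (∑ m ∈ range p, n m) | blockCol n p i = l} =
        Ico (∑ m ∈ range (l - n 0), n m) (∑ m ∈ range (l - n 0 + 1), n m) := by
      ext i
      have h1 := sum_range_mono n (show l - n 0 + 1 ≤ p by omega)
      have h2 := blockCol_eq_add_iff (n := n) (p := p) (i := i) (r := l - n 0) (by omega) (by omega)
      rw [show n 0 + (l - n 0) = l by omega] at h2
      simp only at h1
      rw [mem_filter, mem_range, mem_Ico]
      constructor
      · exact fun h3 => (h2 h3.1).1 h3.2
      · exact fun h3 => ⟨by omega, (h2 (by omega)).2 h3⟩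
    rw [this, Nat.card_Ico, sum_range_succ, Nat.add_sub_cancel_left, blockCount, if_neg (by omega),
      if_neg (by omega)]

lemma sum_range_update (n : ℕ → ℕ) {k : ℕ} (hnk : 1 ≤ n k) (r : ℕ) :
    ∑ m ∈ range r, n m =
      ∑ m ∈ range r, Function.update n k (n k - 1) m + if k < r then 1 else 0 := by
  have h : ∀ m, n m = Function.update n k (n k - 1) m + if m = k then 1 else 0 := fun m => by
    by_cases hm : m = k
    · subst hm; simp; omega
    · simp [hm]
  rw [sum_congr rfl fun m _ => h m, sum_add_distrib, sum_ite_eq']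
  simp only [mem_range]

lemma blockCol_update (hk0 : 1 ≤ k) (hnk : 1 ≤ n k)
    (hi : i < ∑ m ∈ range p, Function.update n k (n k - 1) m) :
    blockCol (Function.update n k (n k - 1)) p i =
      if i < ∑ m ∈ range k, n m + (n k - 1) then blockCol n p i else blockCol n p (i + 1) := by
  set n' := Function.update n k (n k - 1) with hn'
  have hsum := sum_range_update n hnk
  rw [← hn'] at hsum
  have hn0 : n' 0 = n 0 := Function.update_of_ne (by omega) _ _
  have hle : n 0 ≤ ∑ m ∈ range k, n m :=
    single_le_sum (f := n) (fun _ _ => Nat.zero_le _) (mem_range.2 (by omega))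
  obtain ⟨r, hr, h1, h2⟩ := exists_block hi
  have h3 := blockIdx_eq hr h1 h2
  have e1 := hsum r
  have e2 := hsum (r + 1)
  have e3 := sum_range_succ n k
  have hidx : blockIdx n p (if i < ∑ m ∈ range k, n m + (n k - 1) then i else i + 1) = r := by
    refine blockIdx_eq hr ?_ ?_
    · by_cases h : k < r
      · have := sum_range_mono n (show k + 1 ≤ r by omega)
        simp only at this
        rw [if_pos h] at e1
        split_ifs <;> omega
      · rw [if_neg h] at e1
        split_ifs <;> omega
    · by_cases h : k < r + 1
      · rw [if_pos h] at e2
        split_ifs <;> omega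
      · have := sum_range_mono n (show r + 1 ≤ k by omega)
        simp only at this
        rw [if_neg h] at e2
        split_ifs <;> omega
  simp only [blockCol, hn0, h3]
  split_ifs at hidx ⊢ <;> omega

lemma blockCount_update (hk0 : 1 ≤ k) (hnk : 1 ≤ n k) (l : ℕ) :
    blockCount n l = blockCount (Function.update n k (n k - 1)) l +
      if l = n 0 + k then 1 else 0 := by
  have hn0 : Function.update n k (n k - 1) 0 = n 0 := Function.update_of_ne (by omega) _ _
  simp only [blockCount, hn0]
  by_cases h : l = n 0 + k
  · subst h
    rw [if_neg (by omega), if_neg (by omega), if_neg (by omega), if_neg (by omega), if_pos rfl,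
      Nat.add_sub_cancel_left, Function.update_self]
    omega
  · rw [if_neg h, add_zero]
    split_ifs with h1 h2
    · rfl
    · rfl
    · rw [Function.update_of_ne (by omega)]

/-- Adding one slot on top of a maximal column. -/
lemma slotCount_add_one {ν ν' : ℕ → ℕ} {P k : ℕ} (hk : k < P)
    (h : ∀ l, ν l = ν' l + if l = k then 1 else 0) (y : ℕ) :
    slotCount ν P y = slotCount ν' P y + if ν k ≤ y then 1 else 0 := by
  have hk' := h k
  rw [if_pos rfl] at hk'
  have : ∀ l ∈ range P, min (ν l) y =
      min (ν' l) y + if l = k then (if ν k ≤ y then 1 else 0) else 0 := fun l _ => by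
    by_cases hl : l = k
    · subst hl
      rw [if_pos rfl]
      split_ifs <;> omega
    · rw [h l, if_neg hl, if_neg hl, add_zero, add_zero]
  rw [slotCount, sum_congr rfl this, sum_add_distrib, sum_ite_eq', if_pos (mem_range.2 hk),
    slotCount]

/-- The removed cell sits on top of a largest column, hence at the highest level; no earlier slot is
affected. -/
lemma slotLevel_of_lt {ν ν' : ℕ → ℕ} {P k r : ℕ} (hk : k < P)
    (h : ∀ l, ν l = ν' l + if l = k then 1 else 0) (hmax : ∀ l < P, ν l ≤ ν k)
    (hr : r < ∑ l ∈ range P, ν' l) : slotLevel ν P r = slotLevel ν' P r := by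
  rw [slotLevel, slotLevel]
  congr 1
  ext y
  rw [Set.mem_ofPred_eq, Set.mem_ofPred_eq, slotCount_add_one hk h]
  split_ifs with hy
  · rw [slotCount_of_le (ν := ν') fun l hl => by have := h l; have := hmax l hl; omega]
    omega
  · omega

lemma slotLevel_total {ν ν' : ℕ → ℕ} {P k : ℕ} (hk : k < P)
    (h : ∀ l, ν l = ν' l + if l = k then 1 else 0) (hmax : ∀ l < P, ν l ≤ ν k) :
    slotLevel ν P (∑ l ∈ range P, ν' l) = ν k := by
  have hle : ∀ y, slotCount ν' P y ≤ ∑ l ∈ range P, ν' l := fun y =>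
    sum_le_sum fun _ _ => min_le_left _ _
  refine le_antisymm (slotLevel_le ?_) ?_
  · rw [slotCount_add_one hk h, if_pos le_rfl, slotCount_of_le fun l hl => by
      have := h l; have := hmax l hl; omega]
    omega
  · by_contra hlt
    have h1 := lt_slotCount (ν := ν) (p := P) (r := ∑ l ∈ range P, ν' l)
      (y := slotLevel ν P (∑ l ∈ range P, ν' l)) (by
        rw [sum_congr rfl fun l _ => h l, sum_add_distrib, sum_ite_eq', if_pos (mem_range.2 hk)]
        omega) le_rfl
    rw [slotCount_add_one hk h, if_neg (by omega)] at h1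
    have := hle (slotLevel ν P (∑ l ∈ range P, ν' l))
    omega

variable {K : Type*} [Field K]

/-- The effect on the kernel of removing an element from a maximal block. -/
lemma ctKernel_blockCol_recursion {q : K} (hq0 : q ≠ 0) (hq : ∀ m : ℕ, 0 < m → q ^ m ≠ 1)
    (hk0 : 1 ≤ k) (hkp : k < p) (hnk : 1 ≤ n k) (hmax : ∀ r < p, 1 ≤ r → n r ≤ n k) {M : ℕ}
    (hN : ∑ m ∈ range p, n m = M + 1) (c : ℕ) :
    ctKernel q c (blockCol n p) (M + 1) * ((1 - q ^ (c + 1)) * qPoch q q c) =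
      (1 - q ^ (n k * (c + 1))) * qPoch q (q ^ (M * c + n k)) c *
        ctKernel q c (blockCol (Function.update n k (n k - 1)) p) M := by
  have hNk := sum_range_update n hnk p
  rw [if_pos hkp, hN] at hNk
  have hk1 := sum_range_succ n k
  have hk2 := sum_range_mono n (show k + 1 ≤ p by omega)
  simp only [hN] at hk2
  obtain ⟨s, hs⟩ : ∃ s, ∑ m ∈ range k, n m = s := ⟨_, rfl⟩
  obtain ⟨m, hm⟩ : ∃ m, n k = m + 1 := ⟨n k - 1, by omega⟩
  obtain ⟨e, he⟩ : ∃ e, M + 1 = s + m + 1 + e := ⟨M + 1 - (s + m + 1), by omega⟩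
  obtain rfl : M = s + m + e := by omega
  have hlt : ∀ i < s + m + 1 + e, blockCol n p i < n 0 + p := fun i hi =>
    blockCol_lt (by omega)
  have hcol : ∀ i < s + m + 1 + e, (blockCol n p i = n 0 + k ↔ s ≤ i ∧ i ≤ s + m) := fun i hi => by
    rw [blockCol_eq_add_iff hkp hk0 (by omega)]
    omega
  have hcard : ∀ l, #{i ∈ range (s + m + 1 + e) | blockCol n p i = l} ≤ m + 1 := fun l => by
    rw [← he, ← hN]
    by_cases hl : l < n 0 + p
    · rw [card_blockCol (by omega) hl, blockCount, ← hm]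
      split_ifs with h1 h2
      · exact hnk
      · exact Nat.zero_le _
      · exact hmax _ (by omega) (by omega)
    · rw [filter_false_of_mem]
      · simp
      · intro i hi
        have := blockCol_lt (mem_range.1 hi)
        omega
  have h4 := ctKernel_recursion hq0 hq c hlt (fun i j hij _ => blockCol_mono hij) hcol hcard
  have hupd : ∀ i < s + m + e, blockCol (Function.update n k (n k - 1)) p i =
      if i < s + m then blockCol n p i else blockCol n p (i + 1) := fun i hi => by
    rw [blockCol_update hk0 hnk (by omega), hs, hm, Nat.add_sub_cancel]
  have h5 : ctKernel q c (blockCol (Function.update n k (n k - 1)) p) (s + m + e) =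
      ctKernel q c (fun i => if i < s + m then blockCol n p i else blockCol n p (i + 1))
        (s + m + e) :=
    ctKernel_congr fun i hi j hj => by rw [hupd i hi, hupd j hj]
  rw [h5, he, h4, hm, add_assoc ((s + m + e) * c)]

/-- The recursion for the constant terms in the size of a maximal block. -/
lemma ctLast_blockCol_recursion {q : K} (hq0 : q ≠ 0) (hq : ∀ m : ℕ, 0 < m → q ^ m ≠ 1)
    (hk0 : 1 ≤ k) (hkp : k < p) (hn0 : 1 ≤ n 0) (hnk : 1 ≤ n k)
    (hmax : ∀ r < p, 1 ≤ r → n r ≤ n k) {N : ℕ} (hN : ∑ m ∈ range p, n m = N) (a b c : ℕ) :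
    ctLast q c (colEps (blockCol n p)) N (fun _ => b) a =
      (((1 - q ^ (n k * (c + 1))) * qPoch q (q ^ (a + (N - 1) * c + n k)) b) /
          ((1 - q ^ (c + 1)) * qPoch q (q ^ ((N - 1) * c + n k)) b) *
        qBinom q (N * c + n k - 1) c) *
      ctLast q c (colEps (blockCol (Function.update n k (n k - 1)) p)) (N - 1) (fun _ => b) a := by
  set n' := Function.update n k (n k - 1) with hn'
  have hn0' : n' 0 = n 0 := Function.update_of_ne (by omega) _ _
  have hNk := sum_range_update n hnk p
  rw [if_pos hkp, hN, ← hn'] at hNk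
  have hM0 : 1 ≤ ∑ m ∈ range p, n' m :=
    (by omega : 1 ≤ n' 0).trans
      (single_le_sum (f := n') (fun _ _ => Nat.zero_le _) (mem_range.2 (by omega)))
  obtain ⟨M, hM⟩ : ∃ M, ∑ m ∈ range p, n' m = M + 1 := ⟨_, (Nat.sub_add_cancel hM0).symm⟩
  obtain rfl : N = M + 2 := by omega
  rw [show M + 2 - 1 = M + 1 from rfl]
  have hcount := blockCount_update (n := n) hk0 hnk
  rw [← hn'] at hcount
  have hcountk : blockCount n (n 0 + k) = n k := by
    rw [blockCount, if_neg (by omega), if_neg (by omega), Nat.add_sub_cancel_left]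
  -- The elements of the first block form columns of height 1, which do not exceed n_k because n_k ≥
  -- 1.
  have hmaxc : ∀ l < n 0 + p, blockCount n l ≤ blockCount n (n 0 + k) := fun l hl => by
    rw [hcountk, blockCount]
    split_ifs with h1 h2
    · exact hnk
    · exact Nat.zero_le _
    · exact hmax _ (by omega) (by omega)
  have hcard : ∀ l < n 0 + p, #{i ∈ range (M + 2) | blockCol n p i = l} = blockCount n l :=
    fun l hl => hN ▸ card_blockCol (by omega) hl
  have hcard' : ∀ l < n 0 + p, #{i ∈ range (M + 1) | blockCol n' p i = l} = blockCount n' l :=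
    fun l hl => hM ▸ card_blockCol (by omega) (by rwa [hn0'])
  have hlt : ∀ i < M + 2, blockCol n p i < n 0 + p := fun i hi => blockCol_lt (by rwa [hN])
  have hlt' : ∀ i < M + 1, blockCol n' p i < n 0 + p := fun i hi =>
    hn0' ▸ blockCol_lt (by rwa [hM])
  have hsum' := sum_cells hlt' hcard'
  have h1 := ctLast_const_mul_prod_eq (n := M + 1) hq0 hq
    (fun i j hij _ => blockCol_mono hij) hlt hcard a b c
  have h2 := ctLast_const_mul_prod_eq (n := M) hq0 hq
    (fun i j hij _ => blockCol_mono hij) hlt' hcard' a b c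
  have hlev : ∀ r < M + 1, slotLevel (blockCount n) (n 0 + p) r =
      slotLevel (blockCount n') (n 0 + p) r := fun r hr =>
    slotLevel_of_lt (by omega) hcount hmaxc (by rwa [hsum'])
  -- The products for the two block systems differ only in the factor r = M + 1, whose level is n_k.
  have hlast : slotLevel (blockCount n) (n 0 + p) (M + 1) = n k := by
    rw [← hsum', slotLevel_total (by omega) hcount hmaxc, hcountk]
  have h3 := ctKernel_blockCol_recursion hq0 hq hk0 hkp hnk hmax (M := M + 1) hN c
  rw [← hn'] at h3
  rw [prod_range_succ, prod_range_succ _ (M + 1), hlast,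
    prod_congr rfl fun r hr => by rw [hlev r (mem_range.1 hr)],
    prod_congr (M := K) (f := fun r => qPoch q (q ^ (a + r * c + slotLevel (blockCount n) (n 0 + p) r)) b)
      rfl fun r hr => by rw [hlev r (mem_range.1 hr)]] at h1
  have hb : qBinom q ((M + 2) * c + n k - 1) c =
      qPoch q (q ^ ((M + 1) * c + n k)) c / qPoch q q c := by
    rw [qBinom]
    congr 3
    have : (M + 2) * c = (M + 1) * c + c := by ring
    omega
  have hR : ∏ r ∈ range (M + 1), qPoch q (q ^ (r * c + slotLevel (blockCount n') (n 0 + p) r)) b ≠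
      0 := prod_ne_zero_iff.2 fun r hr => qPoch_pow_ne_zero hq (by
    have := slotLevel_pos (ν := blockCount n') (p := n 0 + p) (r := r) (by
      rw [hsum']; exact mem_range.1 hr)
    omega) b
  have hQ := qPoch_self_ne_zero hq c
  have hY : qPoch q (q ^ ((M + 1) * c + n k)) b ≠ 0 := qPoch_pow_ne_zero hq (by omega) b
  have hB : (1 : K) - q ^ (c + 1) ≠ 0 := sub_ne_zero.2 (hq _ c.succ_pos).symm
  rw [hb, div_mul_div_comm, div_mul_eq_mul_div, eq_div_iff (mul_ne_zero (mul_ne_zero hB hY) hQ)]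
  refine mul_right_cancel₀ hR ?_
  generalize ∏ r ∈ range (M + 1), qPoch q (q ^ (r * c + slotLevel (blockCount n') (n 0 + p) r)) b = R
    at *
  generalize ∏ r ∈ range (M + 1), qPoch q (q ^ (a + r * c + slotLevel (blockCount n') (n 0 + p) r)) b
    = R' at *
  generalize qPoch q (q ^ ((M + 1) * c + n k)) b = Y at *
  generalize qPoch q (q ^ (a + (M + 1) * c + n k)) b = X at *
  linear_combination (1 - q ^ (c + 1)) * qPoch q q c * h1 + R' * X * h3 -
    (1 - q ^ (n k * (c + 1))) * qPoch q (q ^ ((M + 1) * c + n k)) c * X * h2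

end Blocks

end BakerForrester

namespace BakerForrester

open Finset

/-! ### From the q-Morris constant term to the coloured kernel. -/

section Translation

variable {K : Type*} [Field K]

lemma coeff_eq_ct (f : Laurent K) (e : ℕ →₀ ℤ) : f.coeff e = ct (mon K (-e) * f) := by
  classical
  induction f using Laurent.induction_mon with
  | zero => simp
  | add f g hf hg => rw [mul_add, map_add, ← hf, ← hg]; rfl
  | smul_mon r u =>
    rw [mul_smul_comm, map_smul, mon_mul, ct_mon, ← single_eq_smul_mon,
      AddMonoidAlgebra.coeff_single, Finsupp.single_apply]
    by_cases h : r = e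
    · simp [h]
    · have h' : -e + r ≠ 0 := fun h' => h (neg_add_eq_zero.1 h').symm
      simp [h, h']

/-- A constant term is unchanged by the substitution, yet the one that computes this coefficient is
multiplied by χ ≠ 1. -/
lemma coeff_eq_zero_of_subst {χ : K} (hχ : χ ≠ 1) {Θ : Laurent K →ₐ[K] Laurent K}
    (hct : ∀ f, ct (Θ f) = ct f) {e : ℕ →₀ ℤ} (he : Θ (mon K (-e)) = χ • mon K (-e))
    {f : Laurent K} (hf : Θ f = f) : f.coeff e = 0 := by
  have h := hct (mon K (-e) * f)
  rw [map_mul, hf, he, smul_mul_assoc, map_smul, ← coeff_eq_ct, smul_eq_mul] at h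
  have h2 : (χ - 1) * f.coeff e = 0 := by linear_combination h
  exact (mul_eq_zero.1 h2).resolve_left (sub_ne_zero.2 hχ)

/-- For a homogeneous Laurent polynomial of degree zero in `x_0, …, x_N` the constant term in
`x_1, …, x_N` is a scalar. -/
lemma constTerm_eq_smul_one {q : K} (hq0 : q ≠ 0) (hq : ∀ m : ℕ, 0 < m → q ^ m ≠ 1) (N : ℕ)
    {f : Laurent K} (hall : scaleAll (Units.mk0 q hq0) f = f)
    (hi : ∀ i, N < i → scaleVar i (Units.mk0 q hq0) f = f) :
    constTerm (Icc 1 N) f = ct f • (1 : Laurent K) := by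
  classical
  have hpow : ∀ a : ℤ, a ≠ 0 → q ^ a ≠ 1 := fun a ha h =>
    ha (zpow_injective hq0 hq (h.trans (zpow_zero q).symm))
  have h1 : ∀ e : ℕ →₀ ℤ, expDeg e ≠ 0 → f.coeff e = 0 := fun e he =>
    coeff_eq_zero_of_subst (χ := q ^ (expDeg (-e))) (hpow _ (by simpa using he))
      (ct_scaleAll (Units.mk0 q hq0)) (by rw [scaleAll_mon]; simp) hall
  have h2 : ∀ (e : ℕ →₀ ℤ) (i : ℕ), N < i → e i ≠ 0 → f.coeff e = 0 := fun e i hNi he =>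
    coeff_eq_zero_of_subst (χ := q ^ ((-e) i)) (hpow _ (by simpa using he))
      (ct_scaleVar i (Units.mk0 q hq0)) (by rw [scaleVar_mon]; simp) (hi i hNi)
  have h3 : (f.coeff.filter fun e => ∀ i ∈ Icc 1 N, e i = 0) = Finsupp.single 0 (f.coeff 0) := by
    ext e
    rw [Finsupp.single_apply]
    by_cases he : e = 0
    · subst he
      rw [if_pos rfl, Finsupp.filter_apply, if_pos]
      exact fun _ _ => Finsupp.zero_apply
    · rw [if_neg (Ne.symm he)]
      by_cases hp : ∀ i ∈ Icc 1 N, e i = 0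
      · rw [Finsupp.filter_apply, if_pos hp]
        by_cases h4 : ∃ i, N < i ∧ e i ≠ 0
        · obtain ⟨i, h5, h6⟩ := h4
          exact h2 e i h5 h6
        · push Not at h4
          refine h1 e fun hdeg => he ?_
          have h5 : e = Finsupp.single 0 (e 0) := by
            ext i
            rcases Nat.eq_zero_or_pos i with rfl | hpos
            · simp
            · rw [Finsupp.single_eq_of_ne (by omega)]
              by_cases h6 : i ≤ N
              · exact hp i (mem_Icc.2 ⟨hpos, h6⟩)
              · exact h4 i (by omega)
          have h6 := congrArg expDeg h5
          rw [expDeg_single, hdeg] at h6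
          rw [h5, ← h6, Finsupp.single_zero]
      · rw [Finsupp.filter_apply, if_neg hp]
  rw [constTerm, h3]
  change AddMonoidAlgebra.single 0 (ct f) = _
  rw [single_eq_smul_mon, mon_zero]

lemma prod_Icc_Ioc {M : Type*} [CommMonoid M] (N : ℕ) (f : ℕ → ℕ → M) :
    ∏ i ∈ Icc 1 N, ∏ j ∈ Ioc i N, f i j = ∏ j ∈ range N, ∏ i ∈ range j, f (i + 1) (j + 1) := by
  rw [prod_sigma', prod_sigma']
  refine prod_nbij' (fun x => ⟨x.2 - 1, x.1 - 1⟩) (fun x => ⟨x.2 + 1, x.1 + 1⟩) ?_ ?_ ?_ ?_ ?_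
  · rintro ⟨i, j⟩ h
    simp only [mem_sigma, mem_Icc, mem_Ioc, mem_range] at h ⊢
    omega
  · rintro ⟨j, i⟩ h
    simp only [mem_sigma, mem_Icc, mem_Ioc, mem_range] at h ⊢
    omega
  · rintro ⟨i, j⟩ h
    simp only [mem_sigma, mem_Icc, mem_Ioc] at h
    simp only [Sigma.mk.injEq, heq_eq_eq]
    omega
  · rintro ⟨j, i⟩ _
    simp
  · rintro ⟨i, j⟩ h
    simp only [mem_sigma, mem_Icc, mem_Ioc] at h
    simp only
    rw [Nat.sub_add_cancel (by omega), Nat.sub_add_cancel (by omega)]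

/-- The constant term of the `q`-Morris product, after the variable `x_0` is moved to the end. -/
lemma ct_L {q : K} (hq0 : q ≠ 0) {p : ℕ} (n : Fin (p + 1) → ℕ) (a b c : ℕ) :
    ct (L q n a b c) =
      ctLast q c (fun i j => eps n (i + 1) (j + 1)) (∑ l, n l) (fun _ => b) a := by
  set N := ∑ l, n l with hN
  -- The rotation sends x_0 to x_N and gives (x_N/x_i)_a (q x_i/x_N)_b. Scaling x_N by q moves the q
  -- to the first factor, as in `ctLast` with A = b and B = a.
  rw [← ct_permVar (rotPerm N), ← ct_scaleVar N (Units.mk0 q hq0), ctLast, L, ← hN,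
    prod_Icc_Ioc, kernel]
  congr 1
  simp only [map_mul, map_prod]
  refine congrArg₂ (· * ·) ?_ ?_
  · rw [← Ico_succ_right_eq_Icc, Nat.succ_eq_succ, Nat.succ_eq_add_one, prod_Ico_eq_prod_range,
      Nat.add_sub_cancel]
    refine prod_congr rfl fun i hi => ?_
    have hi' := mem_range.1 hi
    simp only [map_qPoch, map_smul, permVar_ratio, add_comm 1 i, rotPerm_succ hi', rotPerm_zero]
    rw [scaleVar_ratio_left (by omega), scaleVar_ratio_right (by omega), smul_smul, mul_comm]
    simp [hq0]
  · refine prod_congr rfl fun j hj => prod_congr rfl fun i hi => ?_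
    have hj' := mem_range.1 hj
    have hi' := mem_range.1 hi
    rw [← map_mul, ← map_mul]
    change scaleVar N _ (permVar (rotPerm N) (pair q _ (i + 1) (j + 1))) = _
    rw [permVar_pair, rotPerm_succ hj', rotPerm_succ (by omega),
      scaleVar_pair_of_ne (by omega) (by omega)]

lemma scaleAll_L {q : K} (u : Kˣ) {p : ℕ} (n : Fin (p + 1) → ℕ) (a b c : ℕ) :
    scaleAll u (L q n a b c) = L q n a b c := by
  simp only [L, map_mul, map_prod, map_qPoch, map_smul, scaleAll_ratio]

lemma scaleVar_L {q : K} (u : Kˣ) {p : ℕ} (n : Fin (p + 1) → ℕ) (a b c : ℕ) {i : ℕ}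
    (hi : ∑ l, n l < i) : scaleVar i u (L q n a b c) = L q n a b c := by
  simp only [L, map_mul, map_prod, map_qPoch, map_smul]
  refine congrArg₂ (· * ·) ?_ ?_
  · refine prod_congr rfl fun j hj => ?_
    have := mem_Icc.1 hj
    rw [scaleVar_ratio_of_ne (by omega) (by omega), scaleVar_ratio_of_ne (by omega) (by omega)]
  · refine prod_congr rfl fun j hj => prod_congr rfl fun l hl => ?_
    have := mem_Icc.1 hj
    have := mem_Ioc.1 hl
    rw [scaleVar_ratio_of_ne (by omega) (by omega), scaleVar_ratio_of_ne (by omega) (by omega)]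

/-- The extension of the block sizes by zero. -/
def extendSizes {p : ℕ} (n : Fin (p + 1) → ℕ) (m : ℕ) : ℕ := if h : m < p + 1 then n ⟨m, h⟩ else 0

variable {p : ℕ} (n : Fin (p + 1) → ℕ)

lemma extendSizes_val (l : Fin (p + 1)) : extendSizes n l = n l := by
  simp [extendSizes, l.2]

lemma extendSizes_update (k : Fin (p + 1)) (v : ℕ) :
    extendSizes (Function.update n k v) = Function.update (extendSizes n) k v := by
  funext m
  by_cases hm : m = k
  · subst hm
    rw [extendSizes_val, Function.update_self, Function.update_self]
  · rw [Function.update_of_ne hm]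
    simp only [extendSizes]
    split_ifs with h
    · rw [Function.update_of_ne (fun h' => hm (by rw [← h']))]
    · rfl

lemma sum_extendSizes : ∑ m ∈ range (p + 1), extendSizes n m = ∑ l, n l := by
  rw [sum_range]
  exact sum_congr rfl fun l _ => extendSizes_val n l

lemma block_eq (l : Fin (p + 1)) :
    block n l = Ioc (∑ m ∈ range l, extendSizes n m) (∑ m ∈ range (l + 1), extendSizes n m) := by
  have h1 : ∑ m ∈ Iio l, n m = ∑ m ∈ range l, extendSizes n m := by
    rw [← Nat.Iio_eq_range, ← Fin.map_valEmbedding_Iio, sum_map]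
    exact sum_congr rfl fun m _ => (extendSizes_val n m).symm
  have h2 : ∑ m ∈ Iic l, n m = ∑ m ∈ range (l + 1), extendSizes n m := by
    have : range ((l : ℕ) + 1) = Iic (l : ℕ) := by ext; simp
    rw [this, ← Fin.map_valEmbedding_Iic, sum_map]
    exact sum_congr rfl fun m _ => (extendSizes_val n m).symm
  rw [block, h1, h2]

lemma eps_eq_colEps {i j : ℕ} (hij : i < j) (hj : j < ∑ l, n l) :
    eps n (i + 1) (j + 1) = colEps (blockCol (extendSizes n) (p + 1)) i j := by
  rw [← sum_extendSizes] at hj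
  have hi := hij.trans hj
  have hmem : ∀ (l : Fin (p + 1)) (x : ℕ), x < ∑ m ∈ range (p + 1), extendSizes n m →
      (x + 1 ∈ block n l ↔ blockIdx (extendSizes n) (p + 1) x = l) := fun l x hx => by
    rw [blockIdx_eq_iff l.2 hx, block_eq, mem_Ioc]
    omega
  have hpi := blockIdx_pos (Nat.succ_pos p) hi
  have h0 : ∀ x, x < extendSizes n 0 → blockIdx (extendSizes n) (p + 1) x = 0 := fun x hx =>
    blockIdx_eq (Nat.succ_pos p) (by simp) (by simpa using hx)
  rw [eps, colEps]
  congr 1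
  rw [eq_iff_iff]
  constructor
  · rintro ⟨l, hl, h1, h2⟩
    rw [hmem l i hi] at h1
    rw [hmem l j hj] at h2
    have hl' : (l : ℕ) ≠ 0 := fun h => hl (Fin.ext h)
    rw [blockCol, blockCol, if_neg, if_neg, h1, h2]
    · intro h; exact hl' (h2 ▸ h0 j h)
    · intro h; exact hl' (h1 ▸ h0 i h)
  · intro h
    simp only [blockCol] at h
    have h3 : ¬ i < extendSizes n 0 := by
      intro h3
      rw [if_pos h3] at h
      split_ifs at h <;> omega
    have h4 : ¬ j < extendSizes n 0 := by omega
    rw [if_neg h3, if_neg h4] at h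
    have h5 := hpi (by omega)
    refine ⟨⟨_, blockIdx_lt hi⟩, fun h6 => ?_, (hmem _ i hi).2 rfl, (hmem _ j hj).2 ?_⟩
    · have h7 : blockIdx (extendSizes n) (p + 1) i = 0 := congrArg Fin.val h6
      rw [h7] at h5
      exact lt_irrefl _ h5
    · simp only
      omega

lemma D_eq {q : K} (hq0 : q ≠ 0) (hq : ∀ m : ℕ, 0 < m → q ^ m ≠ 1) (a b c : ℕ) :
    D q n a b c =
      ctLast q c (colEps (blockCol (extendSizes n) (p + 1))) (∑ l, n l) (fun _ => b) a •
        (1 : Laurent K) := by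
  rw [D, constTerm_eq_smul_one hq0 hq _ (scaleAll_L _ n a b c)
    fun i hi => scaleVar_L _ n a b c hi, ct_L hq0, ctLast, ctLast,
    kernel_congr fun j hj i hi => eps_eq_colEps n hi hj]

end Translation

end BakerForrester
theorem mainTheorem1 {K : Type*} [Field K] (q : K) (hq0 : q ≠ 0)
    (hq : ∀ m : ℕ, 0 < m → q ^ m ≠ 1)
    (p : ℕ) (n : Fin (p + 1) → ℕ) (hn0 : 0 < n 0)
    (k : Fin (p + 1)) (hk : k ≠ 0) (hnk : 0 < n k) (hmax : ∀ i : Fin (p + 1), i ≠ 0 → n i ≤ n k)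
    (N : ℕ) (hN : N = ∑ i, n i) (a b c : ℕ) :
    BakerForrester.D q n a b c =
      (((1 - q ^ (n k * (c + 1))) * BakerForrester.qPoch q (q ^ (a + (N - 1) * c + n k)) b) /
          ((1 - q ^ (c + 1)) * BakerForrester.qPoch q (q ^ ((N - 1) * c + n k)) b) *
        BakerForrester.qBinom q (N * c + n k - 1) c) •
      BakerForrester.D q (Function.update n k (n k - 1)) a b c := by

  subst hN
  have hk' : 1 ≤ (k : ℕ) := Nat.one_le_iff_ne_zero.2 fun h => hk (Fin.ext h)
  have hval := BakerForrester.extendSizes_val n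
  have hsum := BakerForrester.sum_extendSizes n
  have hupd := BakerForrester.extendSizes_update n k (n k - 1)
  have hsum' : ∑ l, Function.update n k (n k - 1) l = ∑ l, n l - 1 := by
    have h := BakerForrester.sum_range_update (BakerForrester.extendSizes n) (k := k)
      (by rw [hval]; exact hnk) (p + 1)
    rw [hval, ← hupd, hsum, BakerForrester.sum_extendSizes, if_pos k.2] at h
    omega
  have h := BakerForrester.ctLast_blockCol_recursion hq0 hq hk' k.2
    (n := BakerForrester.extendSizes n) (by rw [← Fin.val_zero (p + 1), hval]; exact hn0)
    (by rw [hval]; exact hnk) (fun r hr hr1 => by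
      have := hmax ⟨r, hr⟩ fun h => by simp [Fin.ext_iff] at h; omega
      rwa [← hval, ← hval k] at this) hsum a b c
  rw [hval, ← hupd] at h
  rw [BakerForrester.D_eq n hq0 hq, BakerForrester.D_eq _ hq0 hq, hsum', h, mul_smul]
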